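/- Let $n\ge 1$, let $g>1$ be real and let $x=(x_1,\dots,x_n)\in\mathbb R^n$. For $\lambda=(\lambda_1,\dots,\lambda_n)\in(\imath\mathbb R)^n$ put $\gamma_{n,j}=\lambda_j$, $\gamma_{i,j}=0$ if $j>i$, and $$\Phi^{(g)}_{\lambda}(x)=\int_{(\imath\mathbb R)^{n(n-1)/2}}\ \prod_{i=1}^{n-1}\frac{\prod_{j=1}^{i}\prod_{k=1}^{i+1}\Gamma\!\left(\frac{\gamma_{i,j}-\gamma_{i+1,k}+g}{2}\right)\Gamma\!\left(\frac{\gamma_{i+1,k}-\gamma_{i,j}+g}{2}\right)}{\prod_{1\le r\ne s\le i}\Gamma\!\left(\frac{\gamma_{i,r}-\gamma_{i,s}}{2}\right)\Gamma\!\left(\frac{\gamma_{i,r}-\gamma_{i,s}+2g}{2}\right)}\ e^{\sum_{i,j=1}^n(\gamma_{i,j}-\gamma_{i-1,j})x_i}\prod_{1\le j\le i\le n-1}d\gamma_{i,j},$$ $$\Psi^{(g)}_\lambda(x)=\prod_{j<k}\sinh^g|x_j-x_k|\;\Phi^{(g)}_\lambda(x).$$ For $1\le r\le n$ let $$\mathcal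 H^{(g)}_r=(-1)^{r(n-1)}\sum_{I\subset\{1,\dots,n\},\ |I|=r}\ \prod_{i\in I,\ j\notin I}\frac{\lambda_i-\lambda_j+2-2g}{\lambda_i-\lambda_j}\ \prod_{i\in I}T_{\lambda_i},\qquad T_{\lambda_i}f(\dots,\lambda_i,\dots)=f(\dots,\lambda_i+2,\dots).$$ Then: 1. The integral $\Phi^{(g)}_\lambda(x)$ converges absolutely for all $\lambda\in(\imath\mathbb R)^n$. 2. $\lambda\mapsto\Psi^{(g)}_\lambda(x)$ extends from $(\imath\mathbb R)^n$ to a holomorphic function on the tube $U=\{\lambda\in\mathbb C^n:\ |\mathrm{Re}(\lambda_j-\lambda_k)|<2g\ \text{for all } j,k\}$, which contains all points of $(\imath\mathbb R)^n$ together with all their shifts by $2$ in any subset of the coordinates. 3. In the sense of analytic continuation in $\lambda$, for $r=1,\dots,n$, $$\mathcal H^{(g)}_r\Psi^{(g)}_\lambda(x)=e_r(e^{2x_1},\dots,e^{2x_n})\,\Psi^{(g)}_\lambda(x),$$ where $e_r$ is the $r$-th elementary symmetric function. Precisely: let $W\supseteq U$ be open and connected, let $F$ be a holomorphic function on $W$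 that equals $\Psi^{(g)}_\lambda(x)$ on $(\imath\mathbb R)^n$, and let $V\subseteq W$ be open and connected, meeting $(\imath\mathbb R)^n$, such that for every $\lambda\in V$ all points obtained from $\lambda$ by adding $2$ to exactly $r$ coordinates lie in $W$. Then $\mathcal H^{(g)}_rF(\lambda)=e_r(e^{2x_1},\dots,e^{2x_n})F(\lambda)$ for all $\lambda\in V$ with pairwise distinct coordinates. -/

import Mathlib

noncomputable section

open Finset

namespace Sutherland

/-- The triangular array of spectral variables. Row `i` (`1 ≤ i ≤ n`) has entries
`j = 0, …, i - 1`; row `n` is `lam`, and for `i < n` row `i` consists of the purely imaginary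
integration variables `γ_{i,j} = √-1 * t_{i,j}`. All other entries are zero. -/
def gam {n : ℕ} (lam : Fin n → ℂ) (t : ∀ i : Fin (n - 1), Fin ((i : ℕ) + 1) → ℝ)
    (i j : ℕ) : ℂ :=
  if hj : j < i then
    if hn : i = n then lam ⟨j, hn ▸ hj⟩
    else if hi : i < n then
      Complex.I * (t ⟨i - 1, by omega⟩ ⟨j, by simp only; omega⟩ : ℂ)
    else 0
  else 0

/-- The Mellin–Barnes integrand. The index `i` of the product over the rows is shifted by one:
it refers to row `i + 1`, which has `i + 1` entries. -/
def integrand {n : ℕ} (g : ℝ) (lam : Fin n → ℂ) (x : Fin n → ℝ)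
    (t : ∀ i : Fin (n - 1), Fin ((i : ℕ) + 1) → ℝ) : ℂ :=
  (∏ i ∈ range (n - 1),
    (∏ j ∈ range (i + 1), ∏ k ∈ range (i + 2),
      Complex.Gamma ((gam lam t (i + 1) j - gam lam t (i + 2) k + g) / 2) *
        Complex.Gamma ((gam lam t (i + 2) k - gam lam t (i + 1) j + g) / 2)) /
    (∏ r ∈ range (i + 1), ∏ s ∈ (range (i + 1)).erase r,
      Complex.Gamma ((gam lam t (i + 1) r - gam lam t (i + 1) s) / 2) *
        Complex.Gamma ((gam lam t (i + 1) r - gam lam t (i + 1) s + 2 * g) / 2))) *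
  Complex.exp (∑ i : Fin n,
    (∑ j ∈ range n, (gam lam t ((i : ℕ) + 1) j - gam lam t i j)) * (x i : ℂ))

/-- The Mellin–Barnes integral over `(√-1 ℝ)^{n(n-1)/2}`; each `dγ_{i,j}` is `√-1 dt_{i,j}`. -/
def Phi {n : ℕ} (g : ℝ) (lam : Fin n → ℂ) (x : Fin n → ℝ) : ℂ :=
  Complex.I ^ (n * (n - 1) / 2) *
    ∫ t : (∀ i : Fin (n - 1), Fin ((i : ℕ) + 1) → ℝ), integrand g lam x t

/-- The wave function `∏_{j<k} sinh^g |x_j - x_k| · Φ_λ(x)`, for purely imaginary `lam`. -/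
def Psi {n : ℕ} (g : ℝ) (lam : Fin n → ℂ) (x : Fin n → ℝ) : ℂ :=
  ((∏ j : Fin n, ∏ k ∈ univ.filter (fun k => j < k), Real.sinh |x j - x k| ^ g : ℝ) : ℂ) *
    Phi g lam x

/-- The purely imaginary parameters `(√-1 ℝ)^n`. -/
def imagSpace (n : ℕ) : Set (Fin n → ℂ) := {lam | ∀ j, (lam j).re = 0}

/-- The tube `|Re (λ_j - λ_k)| < 2 g`. -/
def tube (n : ℕ) (g : ℝ) : Set (Fin n → ℂ) :=
  {lam | ∀ j k, |(lam j - lam k).re| < 2 * g}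

/-- The shift `λ_i ↦ λ_i + 2` for `i ∈ S`. -/
def shift {n : ℕ} (S : Finset (Fin n)) (lam : Fin n → ℂ) : Fin n → ℂ :=
  fun i => if i ∈ S then lam i + 2 else lam i

/-- The dual Ruijsenaars–Macdonald difference operator `𝓗_r^{(g)}`. -/
def dualHam {n : ℕ} (g : ℝ) (r : ℕ) (F : (Fin n → ℂ) → ℂ) (lam : Fin n → ℂ) : ℂ :=
  (-1) ^ (r * (n - 1)) *
    ∑ S ∈ powersetCard r (univ : Finset (Fin n)),
      (∏ i ∈ S, ∏ j ∈ Sᶜ, (lam i - lam j + 2 - 2 * g) / (lam i - lam j)) * F (shift S lam)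

/-- The elementary symmetric function `e_r(e^{2x_1}, …, e^{2x_n})`. -/
def eigenvalue {n : ℕ} (r : ℕ) (x : Fin n → ℝ) : ℝ :=
  MvPolynomial.eval (fun i => Real.exp (2 * x i)) (MvPolynomial.esymm (Fin n) ℝ r)

end Sutherland

end

noncomputable section

open Finset

namespace Sutherland

/-! ### Bounds for the Gamma function on vertical strips -/

/-! The integrand factors along the rows of the triangular array, so Fubini turns `Phi` into the
recursion `wave`: the function of N + 1 parameters is an integral over N imaginary parameters of
`kern`, `density`, an exponential and the function of N parameters (`integrand_integral`).

Convergence is a balance of exponential rates. Up to polynomial factors, `kern` decays like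
exp(-(π/2) `crossDist`) and `density` grows at most like exp((π/2) `pairDist`). The energy
inequality `energy_le` makes the bound exp(-(π/4) `pairDist`) for `wave` reproduce itself from one
row to the next, with room left for integrability. This gives absolute convergence, and holomorphy
where all |Re λ_j| < g. A common translation of the parameters multiplies `wave` by an exponential.
A point of the tube can be centred by a real translation, so `wave` extends to the tube (`waveExt`).

The difference equations are proved at imaginary points by induction on the number of parameters
(`sum_shiftCoef_mul_wave`). By `kernel_identity`, the operator of order r in the outer parameters
acts on the kernel as the operators of orders r and r - 1 in the integration variables. Absorbed
into the density, their coefficients leave an entire function (`gammaDensity_offset`), so the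
contours can be translated until the operators act on the inner wave function
(`gammaDensity_offset_add`); the induction hypothesis then applies. The translation has length 1 and
fits in the domain of holomorphy because g > 1. The exponentials supply the recursion of the
elementary symmetric functions in the number of variables.

Finally, imaginary points form a set of uniqueness (`eqOn_zero_of_imagSpace`). After denominators
are cleared, the equations pass from imaginary points to all of V. -/

lemma norm_betaIntegral_le {u : ℂ} {v : ℝ} (hu : 0 < u.re) (hv : 0 < v) :
    ‖Complex.betaIntegral u v‖ ≤ ‖Complex.betaIntegral (u.re : ℂ) v‖ := by
  set f : ℝ → ℝ := fun x => x ^ (u.re - 1) * (1 - x) ^ (v - 1) with hf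
  have key : ∀ x ∈ Set.Ioc (0 : ℝ) 1,
      (x : ℂ) ^ ((u.re : ℂ) - 1) * (1 - (x : ℂ)) ^ ((v : ℂ) - 1) = (f x : ℂ) := by
    intro x hx
    have h1 : (0 : ℝ) ≤ 1 - x := by linarith [hx.2]
    simp only [hf]
    push_cast [Complex.ofReal_cpow hx.1.le, Complex.ofReal_cpow h1]
    rfl
  have hB : Complex.betaIntegral (u.re : ℂ) v = ((∫ x in (0 : ℝ)..1, f x : ℝ) : ℂ) := by
    rw [Complex.betaIntegral, ← intervalIntegral.integral_ofReal]
    refine intervalIntegral.integral_congr_ae (Filter.Eventually.of_forall fun x hx => ?_)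
    rw [Set.uIoc_of_le zero_le_one] at hx
    exact key x hx
  have hfi : IntervalIntegrable f MeasureTheory.volume 0 1 := by
    have := (Complex.betaIntegral_convergent (u := (u.re : ℂ)) (v := (v : ℂ))
      (by simpa using hu) (by simpa using hv)).norm
    refine this.congr_ae ?_
    rw [Set.uIoc_of_le zero_le_one]
    refine (MeasureTheory.ae_restrict_iff' measurableSet_Ioc).2
      (Filter.Eventually.of_forall fun x hx => ?_)
    simp only
    rw [key x hx, Complex.norm_real, Real.norm_of_nonneg]
    exact mul_nonneg (Real.rpow_nonneg hx.1.le _) (Real.rpow_nonneg (by linarith [hx.2]) _)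
  rw [hB, Complex.norm_real]
  refine le_trans ?_ (le_abs_self _)
  rw [Complex.betaIntegral]
  refine intervalIntegral.norm_integral_le_of_norm_le zero_le_one
    (MeasureTheory.ae_of_all _ fun x hx => ?_) hfi
  have e1 := Complex.norm_cpow_eq_rpow_re_of_pos hx.1 (u - 1)
  have h1 : (0 : ℝ) ≤ 1 - x := by linarith [hx.2]
  have e2 : ‖(1 - (x : ℂ)) ^ ((v : ℂ) - 1)‖ = (1 - x) ^ (v - 1) := by
    have : (1 - (x : ℂ)) ^ ((v : ℂ) - 1) = (((1 - x) ^ (v - 1) : ℝ) : ℂ) := by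
      push_cast [Complex.ofReal_cpow h1]; rfl
    rw [this, Complex.norm_real, Real.norm_of_nonneg (Real.rpow_nonneg h1 _)]
  rw [norm_mul, e1, e2]
  simp [hf]

/-- Since |B(z, v)| ≤ B(Re z, v), the ratio |Γ(z)| / Γ(Re z) can only increase when z moves to the
right. A bound on one vertical line therefore controls Γ on every line to its left in the right
half-plane. -/
lemma norm_Gamma_mul_le {z : ℂ} {v : ℝ} (hz : 0 < z.re) (hv : 0 < v) :
    ‖Complex.Gamma z‖ * Real.Gamma (z.re + v) ≤ ‖Complex.Gamma (z + v)‖ * Real.Gamma z.re := by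
  have h1 := congrArg norm (Complex.Gamma_mul_Gamma_eq_betaIntegral (s := z) (t := (v : ℂ)) hz
    (by simpa using hv))
  have h2 := congrArg norm (Complex.Gamma_mul_Gamma_eq_betaIntegral (s := (z.re : ℂ))
    (t := (v : ℂ)) (by simpa using hz) (by simpa using hv))
  have h3 := norm_betaIntegral_le hz hv
  rw [← Complex.ofReal_add] at h2
  simp only [norm_mul, Complex.Gamma_ofReal, Complex.norm_real] at h1 h2
  have p1 := Real.Gamma_pos_of_pos hz
  have p2 := Real.Gamma_pos_of_pos hv
  have p3 := Real.Gamma_pos_of_pos (add_pos hz hv)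
  rw [Real.norm_of_nonneg p1.le, Real.norm_of_nonneg p2.le, Real.norm_of_nonneg p3.le] at h2
  rw [Real.norm_of_nonneg p2.le] at h1
  have h4 := mul_le_mul_of_nonneg_left h3 (mul_nonneg (norm_nonneg (Complex.Gamma (z + v))) p3.le)
  refine le_of_mul_le_mul_right ?_ p2
  calc _ = Real.Gamma (z.re + v) * (‖Complex.Gamma z‖ * Real.Gamma v) := by ring
    _ = ‖Complex.Gamma (z + v)‖ * Real.Gamma (z.re + v) * ‖Complex.betaIntegral z v‖ := by
      rw [h1]; ring
    _ ≤ _ := h4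
    _ = ‖Complex.Gamma (z + v)‖ * (Real.Gamma z.re * Real.Gamma v) := by rw [h2]; ring
    _ = _ := by ring

/-- On the critical line the reflection formula reads |Γ(1/2 + iτ)|² = π / cosh(πτ). -/
lemma norm_Gamma_half_le (τ : ℝ) :
    ‖Complex.Gamma (1 / 2 + Complex.I * τ)‖ ≤
      √(2 * Real.pi) * Real.exp (-(Real.pi / 2) * |τ|) := by
  have h := congrArg norm (Complex.Gamma_mul_Gamma_one_sub (1 / 2 + Complex.I * τ))
  have hc : Complex.sin (Real.pi * (1 / 2 + Complex.I * τ)) = (Real.cosh (Real.pi * τ) : ℝ) := by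
    rw [show (Real.pi : ℂ) * (1 / 2 + Complex.I * τ) =
      (Real.pi * τ : ℂ) * Complex.I + Real.pi / 2 by ring, Complex.sin_add_pi_div_two,
      Complex.cos_mul_I]
    push_cast; rfl
  have hconj : Complex.Gamma (1 - (1 / 2 + Complex.I * τ)) =
      (starRingEnd ℂ) (Complex.Gamma (1 / 2 + Complex.I * τ)) := by
    rw [← Complex.Gamma_conj]
    congr 1
    simp only [map_add, map_div₀, map_one, map_mul, Complex.conj_I, Complex.conj_ofReal, map_ofNat]
    ring
  rw [hconj, norm_mul, RCLike.norm_conj, hc, norm_div, Complex.norm_real, Complex.norm_real,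
    Real.norm_of_nonneg Real.pi_pos.le, Real.norm_of_nonneg (Real.cosh_pos _).le] at h
  refine abs_le_of_sq_le_sq' ?_ (by positivity) |>.2
  rw [sq, h, mul_pow, Real.sq_sqrt (by positivity), ← Real.exp_nat_mul, div_le_iff₀ (Real.cosh_pos _)]
  have : Real.exp (Real.pi * |τ|) / 2 ≤ Real.cosh (Real.pi * τ) := by
    rw [← Real.cosh_abs, abs_mul, abs_of_pos Real.pi_pos, Real.cosh_eq]
    have := Real.exp_pos (-(Real.pi * |τ|))
    linarith
  calc Real.pi = 2 * Real.pi * Real.exp ((2 : ℕ) * (-(Real.pi / 2) * |τ|)) *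
        (Real.exp (Real.pi * |τ|) / 2) := by
        rw [mul_assoc, ← mul_div_assoc, ← Real.exp_add]
        rw [show ((2 : ℕ) : ℝ) * (-(Real.pi / 2) * |τ|) + Real.pi * |τ| = 0 by push_cast; ring]
        rw [Real.exp_zero]; ring
    _ ≤ _ := by gcongr

/-- `f` is bounded on `s` by a polynomial in `ρ` times `exp w`. -/
def ExpPolyBound {P : Type*} (s : Set P) (ρ w : P → ℝ) (f : P → ℂ) : Prop :=
  ∃ (C : ℝ) (M : ℕ), 0 ≤ C ∧ ∀ p ∈ s, ‖f p‖ ≤ C * (1 + ρ p) ^ M * Real.exp (w p)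

namespace ExpPolyBound

variable {P Q : Type*} {s : Set P} {ρ w w' : P → ℝ} {f f' : P → ℂ}

lemma mul (hρ : ∀ p, 0 ≤ ρ p) (h : ExpPolyBound s ρ w f) (h' : ExpPolyBound s ρ w' f') :
    ExpPolyBound s ρ (fun p => w p + w' p) (fun p => f p * f' p) := by
  obtain ⟨C, M, hC, h⟩ := h
  obtain ⟨C', M', hC', h'⟩ := h'
  refine ⟨C * C', M + M', mul_nonneg hC hC', fun p hp => ?_⟩
  have hr := hρ p
  rw [norm_mul, pow_add, Real.exp_add]
  calc _ ≤ (C * (1 + ρ p) ^ M * Real.exp (w p)) * (C' * (1 + ρ p) ^ M' * Real.exp (w' p)) := by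
        gcongr
        · exact h p hp
        · exact h' p hp
    _ = _ := by ring

lemma one : ExpPolyBound s ρ (fun _ => 0) (fun _ => 1) :=
  ⟨1, 0, zero_le_one, fun p _ => by simp⟩

lemma prod {ι : Type*} (hρ : ∀ p, 0 ≤ ρ p) (t : Finset ι) {w : ι → P → ℝ} {f : ι → P → ℂ}
    (h : ∀ i ∈ t, ExpPolyBound s ρ (w i) (f i)) :
    ExpPolyBound s ρ (fun p => ∑ i ∈ t, w i p) (fun p => ∏ i ∈ t, f i p) := by
  classical
  induction t using Finset.induction_on with
  | empty => simpa using one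
  | insert a t ha ih =>
    simp only [Finset.sum_insert ha, Finset.prod_insert ha]
    exact mul hρ (h a (by simp)) (ih fun i hi => h i (by simp [hi]))

lemma comp {ρ' w' : Q → ℝ} {s' : Set Q} (φ : Q → P) (c : ℝ) (h : ExpPolyBound s ρ w f)
    (hρ : ∀ p, 0 ≤ ρ p) (hρ' : ∀ q, 0 ≤ ρ' q)
    (hs : ∀ q ∈ s', φ q ∈ s) (hc : ∀ q ∈ s', ρ (φ q) ≤ c * (1 + ρ' q))
    (hw : ∀ q ∈ s', w (φ q) ≤ w' q) : ExpPolyBound s' ρ' w' (fun q => f (φ q)) := by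
  obtain ⟨C, M, hC, h⟩ := h
  refine ⟨C * (1 + |c|) ^ M, M, by positivity, fun q hq => (h _ (hs q hq)).trans ?_⟩
  have h1 := hρ (φ q)
  have h2 := hρ' q
  have h3 : 1 + ρ (φ q) ≤ (1 + |c|) * (1 + ρ' q) := by
    have := hc q hq
    nlinarith [le_abs_self c]
  calc _ ≤ C * ((1 + |c|) * (1 + ρ' q)) ^ M * Real.exp (w' q) := by
        gcongr
        exact hw q hq
    _ = _ := by rw [mul_pow]; ring

lemma mono {s' : Set P} (h : ExpPolyBound s ρ w f) (hρ : ∀ p, 0 ≤ ρ p) (hs : s' ⊆ s)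
    (hw : ∀ p ∈ s', w p ≤ w' p) : ExpPolyBound s' ρ w' f :=
  comp (fun p => p) 1 h hρ hρ (fun _ h => hs h) (fun q _ => by linarith) hw

end ExpPolyBound

lemma norm_Gamma_nat_add_half_le (n : ℕ) (τ : ℝ) :
    ‖Complex.Gamma (n + 1 / 2 + Complex.I * τ)‖ ≤
      √(2 * Real.pi) * (n + 1) ^ n * (1 + |τ|) ^ n * Real.exp (-(Real.pi / 2) * |τ|) := by
  have hstep : ∀ (k : ℕ), k ≤ n → ‖Complex.Gamma (k + 1 / 2 + Complex.I * τ)‖ ≤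
      √(2 * Real.pi) * (n + 1) ^ k * (1 + |τ|) ^ k * Real.exp (-(Real.pi / 2) * |τ|) := by
    intro k
    induction k with
    | zero => intro _; simpa using norm_Gamma_half_le τ
    | succ k ih =>
      intro hk
      have hne : (k + 1 / 2 + Complex.I * τ : ℂ) ≠ 0 := by
        intro h
        have := congrArg Complex.re h
        simp at this
        have hk0 : (0 : ℝ) ≤ k := by positivity
        linarith
      rw [show ((k + 1 : ℕ) + 1 / 2 + Complex.I * τ : ℂ) = (k + 1 / 2 + Complex.I * τ) + 1 by
        push_cast; ring, Complex.Gamma_add_one _ hne, norm_mul]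
      have h1 : ‖(k + 1 / 2 + Complex.I * τ : ℂ)‖ ≤ (n + 1) * (1 + |τ|) := by
        have hk' : (k : ℝ) + 1 ≤ n := by exact_mod_cast hk
        calc _ ≤ ‖(k + 1 / 2 : ℂ)‖ + ‖Complex.I * τ‖ := norm_add_le _ _
          _ = (k + 1 / 2) + |τ| := by
            rw [norm_mul, Complex.norm_I, one_mul, Complex.norm_real, Real.norm_eq_abs,
              show (k + 1 / 2 : ℂ) = ((k + 1 / 2 : ℝ) : ℂ) by push_cast; ring, Complex.norm_real,
              Real.norm_of_nonneg (by positivity)]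
          _ ≤ _ := by nlinarith [abs_nonneg τ]
      calc _ ≤ ((n + 1) * (1 + |τ|)) * (√(2 * Real.pi) * (n + 1) ^ k * (1 + |τ|) ^ k *
            Real.exp (-(Real.pi / 2) * |τ|)) := by
            gcongr
            exact ih (by omega)
        _ = _ := by ring
  exact hstep n le_rfl

/-- Comparison with the line Re z = N + 1/2 to the right of the strip, where the functional equation
and the value at 1/2 give the decay. The loss is the factor Γ(Re z), bounded because δ > 0. -/
lemma expPolyBound_Gamma {δ R : ℝ} (hδ : 0 < δ) :
    ExpPolyBound {z : ℂ | δ ≤ z.re ∧ z.re ≤ R} (fun z => |z.im|)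
      (fun z => -(Real.pi / 2) * |z.im|) Complex.Gamma := by
  obtain ⟨n, hn⟩ := exists_nat_gt R
  set N : ℕ := n
  have hcont : ContinuousOn Real.Gamma (Set.Icc δ R) := fun x hx =>
    (Real.differentiableAt_Gamma fun m => by
      have := hx.1; have : (0 : ℝ) ≤ m := by positivity
      linarith).continuousAt.continuousWithinAt
  obtain ⟨B, hB⟩ := isCompact_Icc.exists_bound_of_continuousOn hcont
  have hG := Real.Gamma_pos_of_pos (show (0 : ℝ) < N + 1 / 2 by positivity)
  refine ⟨√(2 * Real.pi) * (N + 1) ^ N * |B| / Real.Gamma (N + 1 / 2), N, by positivity, ?_⟩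
  rintro z ⟨h1, h2⟩
  have hv : 0 < (N + 1 / 2 : ℝ) - z.re := by linarith
  have h := norm_Gamma_mul_le (hδ.trans_le h1) hv
  have hz : z + ((N + 1 / 2 - z.re : ℝ) : ℂ) = N + 1 / 2 + Complex.I * (z.im : ℂ) := by
    apply Complex.ext <;> simp
  rw [hz, show z.re + ((N + 1 / 2 : ℝ) - z.re) = N + 1 / 2 by ring] at h
  have h3 := norm_Gamma_nat_add_half_le N z.im
  have h4 : Real.Gamma z.re ≤ |B| := (le_abs_self _).trans ((hB _ ⟨h1, h2⟩).trans (le_abs_self _))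
  rw [div_mul_eq_mul_div, div_mul_eq_mul_div, le_div_iff₀ hG]
  refine h.trans ?_
  calc _ ≤ (√(2 * Real.pi) * (N + 1) ^ N * (1 + |z.im|) ^ N *
        Real.exp (-(Real.pi / 2) * |z.im|)) * |B| :=
        mul_le_mul h3 h4 (Real.Gamma_pos_of_pos (hδ.trans_le h1)).le (by positivity)
    _ = _ := by ring

/-- Γ(z) is Γ(z - n) times factors of modulus at least |Im z| ≥ 1. -/
lemma norm_inv_Gamma_le_sub {z : ℂ} (hz : 1 ≤ |z.im|) (n : ℕ) :
    ‖(Complex.Gamma z)⁻¹‖ ≤ ‖(Complex.Gamma (z - n))⁻¹‖ := by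
  induction n with
  | zero => simp
  | succ n ih =>
    refine ih.trans ?_
    have him : (z - n - 1).im = z.im := by simp
    have h1 : 1 ≤ ‖z - n - 1‖ := hz.trans (him ▸ Complex.abs_im_le_norm _)
    have hne : z - n - 1 ≠ 0 := by
      rw [← norm_pos_iff]; linarith
    have := Complex.Gamma_add_one _ hne
    rw [sub_add_cancel] at this
    rw [this, mul_inv, norm_mul, norm_inv, norm_inv]
    rw [show z - ((n + 1 : ℕ) : ℂ) = z - n - 1 by push_cast; ring, norm_inv]
    exact mul_le_of_le_one_left (by positivity) (inv_le_one_of_one_le₀ h1)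

lemma norm_sin_le (z : ℂ) : ‖Complex.sin z‖ ≤ Real.exp |z.im| := by
  rw [Complex.sin, norm_div, norm_mul, Complex.norm_I, mul_one, Complex.norm_ofNat]
  have h1 : ‖Complex.exp (-z * Complex.I)‖ ≤ Real.exp |z.im| := by
    rw [Complex.norm_exp]; gcongr; simpa using le_abs_self _
  have h2 : ‖Complex.exp (z * Complex.I)‖ ≤ Real.exp |z.im| := by
    rw [Complex.norm_exp]; gcongr; simpa using neg_le_abs _
  have := norm_sub_le (Complex.exp (-z * Complex.I)) (Complex.exp (z * Complex.I))
  linarith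

lemma expPolyBound_inv_Gamma (R : ℝ) :
    ExpPolyBound {z : ℂ | |z.re| ≤ R} (fun z => |z.im|)
      (fun z => (Real.pi / 2) * |z.im|) (fun z => (Complex.Gamma z)⁻¹) := by
  obtain ⟨n, hn⟩ := exists_nat_gt R
  obtain ⟨C, M, hC, h⟩ := expPolyBound_Gamma (δ := 1) (R := 1 + R + n) one_pos
  have hK : IsCompact {z : ℂ | |z.re| ≤ R ∧ |z.im| ≤ 1} := by
    have := (isCompact_Icc (a := -R) (b := R)).reProdIm (isCompact_Icc (a := (-1 : ℝ)) (b := 1))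
    convert this using 1
    ext z
    simp [Complex.mem_reProdIm, abs_le]
  obtain ⟨B, hB⟩ := hK.exists_bound_of_continuousOn
    Complex.differentiable_one_div_Gamma.continuous.continuousOn
  refine ⟨C + |B|, M, by positivity, fun z hz => ?_⟩
  have hz : |z.re| ≤ R := hz
  have hz' := abs_le.1 hz
  have e0 : 1 ≤ (1 + |z.im|) ^ M := one_le_pow₀ (by linarith [abs_nonneg z.im])
  have e1 : 1 ≤ Real.exp (Real.pi / 2 * |z.im|) := Real.one_le_exp (by positivity)
  rcases le_total |z.im| 1 with h1 | h1
  · refine (hB z ⟨hz, h1⟩).trans ((le_abs_self B).trans ?_)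
    calc |B| ≤ (C + |B|) * 1 * 1 := by linarith
      _ ≤ _ := by gcongr
  -- Moving left by n > R puts 1 - u in a strip with real part at least 1. In 1/Γ(u) = Γ(1 - u)
  -- sin(πu)/π the rates -π/2 and π then add up to π/2.
  · refine (norm_inv_Gamma_le_sub h1 n).trans ?_
    set u := z - n
    have hu : u.im = z.im := by simp [u]
    have hur : u.re = z.re - n := by simp [u]
    have hs : Complex.sin (Real.pi * u) ≠ 0 := by
      rw [Complex.sin_ne_zero_iff]
      intro k hk
      have := congrArg Complex.im hk
      simp [Real.pi_ne_zero] at this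
      rw [← hu, this] at h1
      norm_num at h1
    have hr := Complex.Gamma_mul_Gamma_one_sub u
    have hG1 : Complex.Gamma u ≠ 0 := by
      intro h0
      rw [h0, zero_mul, eq_comm, div_eq_zero_iff] at hr
      simp [hs, Real.pi_ne_zero] at hr
    have hinv : (Complex.Gamma u)⁻¹ = Complex.Gamma (1 - u) * Complex.sin (Real.pi * u) / Real.pi := by
      have hp : (Real.pi : ℂ) ≠ 0 := by simp [Real.pi_ne_zero]
      rw [eq_div_iff hs] at hr
      rw [eq_div_iff hp, inv_mul_eq_iff_eq_mul₀ hG1, ← mul_assoc]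
      exact hr.symm
    have h2 := h (1 - u) ⟨by simp [hur]; linarith, by simp [hur]; linarith⟩
    have h3 := norm_sin_le (Real.pi * u)
    simp only [Complex.sub_im, Complex.one_im, zero_sub, abs_neg, hu, Complex.mul_im,
      Complex.ofReal_re, Complex.ofReal_im, zero_mul, add_zero, abs_mul,
      abs_of_pos Real.pi_pos] at h2 h3
    rw [hinv, norm_div, norm_mul, Complex.norm_real, Real.norm_of_nonneg Real.pi_pos.le]
    calc _ ≤ ‖Complex.Gamma (1 - u)‖ * ‖Complex.sin (Real.pi * u)‖ :=
          div_le_self (by positivity) (by linarith [Real.pi_gt_three])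
      _ ≤ (C * (1 + |z.im|) ^ M * Real.exp (-(Real.pi / 2) * |z.im|)) *
          Real.exp (Real.pi * |z.im|) := by gcongr
      _ = C * (1 + |z.im|) ^ M * Real.exp (Real.pi / 2 * |z.im|) := by
        rw [mul_assoc, ← Real.exp_add]; congr 2; ring
      _ ≤ _ := by gcongr; linarith [abs_nonneg B]

/-! ### The energy inequality for rows of consecutive lengths -/

/-- Twice the sum of the pairwise distances of the entries of `b`. -/
def pairDist {N : ℕ} (b : Fin N → ℝ) : ℝ := ∑ i, ∑ j, |b i - b j|

/-- The sum of the distances between entries of `t` and of `b`. -/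
def crossDist {M N : ℕ} (t : Fin M → ℝ) (b : Fin N → ℝ) : ℝ := ∑ j, ∑ k, |t j - b k|

lemma sum_sign_lt (n m : ℕ) (h : m ≤ n) :
    ∑ k : Fin n, (if (k : ℕ) < m then (1 : ℝ) else -1) = 2 * m - n := by
  rw [Fin.sum_univ_eq_sum_range (fun k => if k < m then (1 : ℝ) else -1)]
  induction n, h using Nat.le_induction with
  | base =>
    rw [Finset.sum_congr rfl fun k hk => if_pos (Finset.mem_range.1 hk)]
    simp; ring
  | succ n hn ih =>
    rw [Finset.sum_range_succ, ih, if_neg (by omega)]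
    push_cast; ring

lemma sum_sign_le (n m : ℕ) (h : m ≤ n) :
    ∑ k : Fin n, (if m ≤ (k : ℕ) then (1 : ℝ) else -1) = n - 2 * m := by
  have := sum_sign_lt n m h
  rw [← neg_inj, neg_sub, ← this, ← Finset.sum_neg_distrib]
  refine Finset.sum_congr rfl fun k _ => ?_
  by_cases hk : m ≤ (k : ℕ)
  · rw [if_pos hk, if_neg (by omega)]
  · rw [if_neg hk, if_pos (by omega)]; ring

lemma pairDist_of_monotone {N : ℕ} {b : Fin N → ℝ} (hb : Monotone b) :
    pairDist b = ∑ i : Fin N, 2 * (2 * (i : ℝ) + 1 - N) * b i := by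
  have h : ∀ i j : Fin N, |b i - b j| =
      (if (j : ℕ) < i + 1 then (1 : ℝ) else -1) * b i -
        (if (j : ℕ) ≤ i then (1 : ℝ) else -1) * b j := by
    intro i j
    by_cases hij : j ≤ i
    · have h1 : (j : ℕ) ≤ i := hij
      rw [if_pos (by omega), if_pos h1, abs_of_nonneg (sub_nonneg.2 (hb hij))]; ring
    · have h1 : ¬ (j : ℕ) ≤ i := hij
      rw [if_neg (by omega), if_neg h1, abs_of_nonpos (sub_nonpos.2 (hb (not_le.1 hij).le))]; ring
  simp only [pairDist, h, Finset.sum_sub_distrib, ← Finset.sum_mul]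
  rw [Finset.sum_comm (f := fun i j : Fin N => (if (j : ℕ) ≤ i then (1 : ℝ) else -1) * b j)]
  simp only [← Finset.sum_mul, ← Finset.sum_sub_distrib]
  refine Finset.sum_congr rfl fun i _ => ?_
  rw [sum_sign_lt N (i + 1) (by omega), sum_sign_le N i (by omega)]
  push_cast; ring

/-- Replace each |t_j - b_k| by the signed difference it would equal if the sorted rows interlaced,
b_0 ≤ t_0 ≤ b_1 ≤ …. The signed differences sum exactly to half the two pair distances, and each
replacement only decreases. The second claim keeps the slack of one extreme pair, which measures how
far t sticks out of the range of b. -/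
lemma energy_of_monotone {N : ℕ} {t : Fin N → ℝ} {b : Fin (N + 1) → ℝ} (ht : Monotone t)
    (hb : Monotone b) :
    pairDist t / 2 + pairDist b / 2 ≤ crossDist t b ∧
      ∀ B, (∀ k, |b k| ≤ B) → ∀ j,
        pairDist t / 2 + pairDist b / 2 + 2 * (|t j| - B) ≤ crossDist t b := by
  set s : Fin N → Fin (N + 1) → ℝ := fun j k => if (k : ℕ) < j + 1 then 1 else -1 with hs
  have hlin : ∑ j, ∑ k, s j k * (t j - b k) = pairDist t / 2 + pairDist b / 2 := by
    rw [pairDist_of_monotone ht, pairDist_of_monotone hb]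
    simp only [mul_sub, Finset.sum_sub_distrib, ← Finset.sum_mul]
    rw [Finset.sum_comm (f := fun j k => s j k * b k)]
    simp only [← Finset.sum_mul]
    rw [Finset.sum_div, Finset.sum_div, sub_eq_add_neg, ← Finset.sum_neg_distrib]
    congr 1
    · refine Finset.sum_congr rfl fun j _ => ?_
      simp only [hs]
      rw [sum_sign_lt (N + 1) (j + 1) (by omega)]
      push_cast; ring
    · refine Finset.sum_congr rfl fun k _ => ?_
      have : ∑ j, s j k = ∑ j : Fin N, (if (k : ℕ) ≤ j then (1 : ℝ) else -1) :=
        Finset.sum_congr rfl fun j _ => by simp only [hs, Nat.lt_succ_iff]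
      rw [this, sum_sign_le N k (by omega)]
      push_cast; ring
  have hpos : ∀ j k, 0 ≤ |t j - b k| - s j k * (t j - b k) := by
    intro j k
    simp only [hs]
    split_ifs
    · linarith [le_abs_self (t j - b k)]
    · linarith [neg_le_abs (t j - b k)]
  have hsingle : ∀ j k, |t j - b k| - s j k * (t j - b k) ≤
      crossDist t b - (pairDist t / 2 + pairDist b / 2) := by
    intro j k
    rw [← hlin, crossDist]
    simp only [← Finset.sum_sub_distrib]
    refine le_trans ?_ (Finset.single_le_sum (f := fun j => ∑ k, (|t j - b k| - s j k * (t j - b k)))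
      (fun j _ => Finset.sum_nonneg fun k _ => hpos j k) (Finset.mem_univ j))
    exact Finset.single_le_sum (f := fun k => (|t j - b k| - s j k * (t j - b k)))
      (fun k _ => hpos j k) (Finset.mem_univ k)
  constructor
  · rw [← hlin]
    refine Finset.sum_le_sum fun j _ => Finset.sum_le_sum fun k _ => ?_
    linarith [hpos j k]
  · intro B hB j
    obtain ⟨n, rfl⟩ : ∃ n, N = n + 1 := ⟨N - 1, by have := j.2; omega⟩
    -- The sign of `t j` decides which end of the rows gives the slack: the two largest entries, or
    -- the two smallest.
    rcases le_total 0 (t j) with h0 | h0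
    · have h1 := hsingle (Fin.last n) (Fin.last (n + 1))
      have h2 : s (Fin.last n) (Fin.last (n + 1)) = -1 := by simp [hs]
      have h3 := ht (Fin.le_last j)
      have h4 := hB (Fin.last (n + 1))
      rw [h2] at h1
      rw [abs_of_nonneg h0]
      linarith [le_abs_self (t (Fin.last n) - b (Fin.last (n + 1))),
        le_abs_self (b (Fin.last (n + 1)))]
    · have h1 := hsingle 0 0
      have h2 : s 0 0 = 1 := by simp [hs]
      have h3 := ht (Fin.zero_le j)
      have h4 := hB 0
      rw [h2] at h1
      rw [abs_of_nonpos h0]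
      linarith [neg_le_abs (t 0 - b 0), neg_le_abs (b 0)]

lemma pairDist_comp_perm {N : ℕ} (b : Fin N → ℝ) (σ : Equiv.Perm (Fin N)) :
    pairDist (b ∘ σ) = pairDist b := by
  simp only [pairDist, Function.comp_apply]
  rw [Equiv.sum_comp σ (fun i => ∑ j, |b i - b (σ j)|)]
  exact Finset.sum_congr rfl fun i _ => Equiv.sum_comp σ (fun j => |b i - b j|)

lemma crossDist_comp_perm {M N : ℕ} (t : Fin M → ℝ) (b : Fin N → ℝ) (σ : Equiv.Perm (Fin M))
    (τ : Equiv.Perm (Fin N)) : crossDist (t ∘ σ) (b ∘ τ) = crossDist t b := by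
  simp only [crossDist, Function.comp_apply]
  rw [Equiv.sum_comp σ (fun i => ∑ j, |t i - b (τ j)|)]
  exact Finset.sum_congr rfl fun i _ => Equiv.sum_comp τ (fun j => |t i - b j|)

/-- Both distances are symmetric in the entries, so the rows may be sorted. The term with the
maximum is what later makes the integral over t converge. -/
lemma energy_le {N : ℕ} (t : Fin N → ℝ) (b : Fin (N + 1) → ℝ) :
    pairDist t / 2 + pairDist b / 2 + 2 * max (‖t‖ - ‖b‖) 0 ≤ crossDist t b := by
  have h := energy_of_monotone (Tuple.monotone_sort t) (Tuple.monotone_sort b)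
  rw [pairDist_comp_perm, pairDist_comp_perm, crossDist_comp_perm] at h
  rcases le_total (‖t‖ - ‖b‖) 0 with h0 | h0
  · rw [max_eq_right h0]; linarith [h.1]
  · rw [max_eq_left h0]
    have hB : ∀ k, |(b ∘ Tuple.sort b) k| ≤ ‖b‖ := fun k => norm_le_pi_norm b _
    have h2 : ‖t‖ ≤ ‖b‖ + max 0 ((crossDist t b - pairDist t / 2 - pairDist b / 2) / 2) := by
      refine (pi_norm_le_iff_of_nonneg (by positivity)).2 fun j => ?_
      have := h.2 _ hB ((Tuple.sort t).symm j)
      simp only [Function.comp_apply, Equiv.apply_symm_apply] at this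
      rw [Real.norm_eq_abs]
      refine le_trans ?_ (add_le_add_right (le_max_right _ _) _)
      linarith
    rw [max_eq_right (by linarith [h.1])] at h2
    linarith

/-! ### Domination of the recursion by an integrable function. -/

lemma one_add_pow_le_exp (K : ℕ) {s : ℝ} (hs : 0 ≤ s) :
    (1 + s) ^ K ≤ K.factorial * Real.exp 1 * Real.exp s := by
  have := Real.pow_div_factorial_le_exp (1 + s) (by linarith) K
  rw [div_le_iff₀ (by positivity)] at this
  rw [Real.exp_add] at this
  linarith

/-- The rate π/4 of `pairDist t` is the growth π/2 of the density less the decay π/4 of the inner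
wave function. The rate -π/4 of `pairDist b` on the right has the form required for the next row.
The power N + 1 makes the last factor integrable on ℝ^N. -/
lemma exists_energy_bound (N M : ℕ) : ∃ (C : ℝ) (M' : ℕ), 0 ≤ C ∧
    ∀ (b : Fin (N + 1) → ℝ) (t : Fin N → ℝ),
      (1 + (‖b‖ + ‖t‖)) ^ M *
        Real.exp (-(Real.pi / 2) * crossDist t b + Real.pi / 4 * pairDist t) ≤
      C * (1 + ‖b‖) ^ M' * Real.exp (-(Real.pi / 4) * pairDist b) * ((1 + ‖t‖) ^ (N + 1))⁻¹ := by
  refine ⟨2 ^ M * ((M + (N + 1)).factorial * Real.exp 1), M + (N + 1), by positivity,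
    fun b t => ?_⟩
  set s := max (‖t‖ - ‖b‖) 0 with hs
  have hs0 : 0 ≤ s := le_max_right _ _
  have hs1 : ‖t‖ - ‖b‖ ≤ s := le_max_left _ _
  have hb := norm_nonneg b
  have ht := norm_nonneg t
  have e1 : 1 + (‖b‖ + ‖t‖) ≤ 2 * ((1 + ‖b‖) * (1 + s)) := by nlinarith
  have e2 : 1 + ‖t‖ ≤ (1 + ‖b‖) * (1 + s) := by nlinarith
  have e3 : Real.exp (-(Real.pi / 2) * crossDist t b + Real.pi / 4 * pairDist t) ≤
      Real.exp (-(Real.pi / 4) * pairDist b) * Real.exp (-s) := by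
    rw [← Real.exp_add, Real.exp_le_exp]
    -- The energy inequality leaves exp(-πs); weakening it to exp(-s) still absorbs every polynomial
    -- in 1 + s.
    have := mul_le_mul_of_nonneg_left (energy_le t b) (show 0 ≤ Real.pi / 2 by positivity)
    rw [← hs] at this
    have h3 : s * 1 ≤ s * Real.pi := by gcongr; linarith [Real.pi_gt_three]
    linarith
  rw [← div_eq_mul_inv, le_div_iff₀ (by positivity)]
  calc _ ≤ (2 * ((1 + ‖b‖) * (1 + s))) ^ M *
        (Real.exp (-(Real.pi / 4) * pairDist b) * Real.exp (-s)) *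
        ((1 + ‖b‖) * (1 + s)) ^ (N + 1) := by gcongr
    _ = 2 ^ M * (1 + ‖b‖) ^ (M + (N + 1)) * Real.exp (-(Real.pi / 4) * pairDist b) *
        ((1 + s) ^ (M + (N + 1)) * Real.exp (-s)) := by
        rw [pow_add, pow_add, mul_pow, mul_pow, mul_pow]; ring
    _ ≤ 2 ^ M * (1 + ‖b‖) ^ (M + (N + 1)) * Real.exp (-(Real.pi / 4) * pairDist b) *
        ((M + (N + 1)).factorial * Real.exp 1) := by
        refine mul_le_mul_of_nonneg_left ?_ (by positivity)
        have := mul_le_mul_of_nonneg_right (one_add_pow_le_exp (M + (N + 1)) hs0)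
          (Real.exp_pos (-s)).le
        refine this.trans (le_of_eq ?_)
        rw [mul_assoc, ← Real.exp_add]; simp
    _ = _ := by ring

lemma integrable_inv_one_add_norm_pow (N : ℕ) :
    MeasureTheory.Integrable fun t : Fin N → ℝ => ((1 + ‖t‖) ^ (N + 1))⁻¹ := by
  have := integrable_one_add_norm (E := Fin N → ℝ) (μ := MeasureTheory.volume) (r := N + 1)
    (by simp)
  refine this.congr (Filter.Eventually.of_forall fun t => ?_)
  simp only
  rw [Real.rpow_neg (by positivity)]
  congr 1
  exact_mod_cast Real.rpow_natCast (1 + ‖t‖) (N + 1)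

/-! ### The kernel identity -/

/-- `f` is a polynomial function of degree at most `d`. -/
def IsPolyDeg (d : ℕ) (f : ℂ → ℂ) : Prop :=
  ∃ p : Polynomial ℂ, p.natDegree ≤ d ∧ ∀ v, p.eval v = f v

namespace IsPolyDeg

lemma mul {d e : ℕ} {f g : ℂ → ℂ} (hf : IsPolyDeg d f) (hg : IsPolyDeg e g) :
    IsPolyDeg (d + e) (fun v => f v * g v) := by
  obtain ⟨p, hp, hp'⟩ := hf
  obtain ⟨q, hq, hq'⟩ := hg
  exact ⟨p * q, Polynomial.natDegree_mul_le_of_le hp hq, fun v => by simp [hp', hq']⟩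

lemma add {d : ℕ} {f g : ℂ → ℂ} (hf : IsPolyDeg d f) (hg : IsPolyDeg d g) :
    IsPolyDeg d (fun v => f v + g v) := by
  obtain ⟨p, hp, hp'⟩ := hf
  obtain ⟨q, hq, hq'⟩ := hg
  exact ⟨p + q, Polynomial.natDegree_add_le_of_degree_le hp hq, fun v => by simp [hp', hq']⟩

lemma const (a : ℂ) : IsPolyDeg 0 (fun _ => a) := ⟨Polynomial.C a, by simp, by simp⟩

lemma linear (a b : ℂ) : IsPolyDeg 1 (fun v => a + b * v) :=
  ⟨Polynomial.C b * Polynomial.X + Polynomial.C a, Polynomial.natDegree_linear_le,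
    fun v => by simp; ring⟩

lemma const_mul {d : ℕ} {f : ℂ → ℂ} (a : ℂ) (hf : IsPolyDeg d f) :
    IsPolyDeg d (fun v => a * f v) := by simpa using (const a).mul hf

lemma sum {ι : Type*} {d : ℕ} (s : Finset ι) {f : ι → ℂ → ℂ} (h : ∀ i ∈ s, IsPolyDeg d (f i)) :
    IsPolyDeg d (fun v => ∑ i ∈ s, f i v) := by
  classical
  induction s using Finset.induction_on with
  | empty => exact ⟨0, by simp, by simp⟩
  | insert a s ha ih =>
    simp only [Finset.sum_insert ha]
    exact (h a (by simp)).add (ih fun i hi => h i (by simp [hi]))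

lemma prod_linear {ι : Type*} (s : Finset ι) {f : ι → ℂ → ℂ} (h : ∀ i ∈ s, IsPolyDeg 1 (f i)) :
    IsPolyDeg s.card (fun v => ∏ i ∈ s, f i v) := by
  classical
  induction s using Finset.induction_on with
  | empty => simpa using const 1
  | insert a s ha ih =>
    simp only [Finset.prod_insert ha, Finset.card_insert_of_notMem ha]
    rw [add_comm]
    exact (h a (by simp)).mul (ih fun i hi => h i (by simp [hi]))

lemma eq_of_card {d : ℕ} {f g : ℂ → ℂ} (hf : IsPolyDeg d f) (hg : IsPolyDeg d g) (S : Finset ℂ)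
    (hS : d < S.card) (h : ∀ v ∈ S, f v = g v) (v : ℂ) : f v = g v := by
  obtain ⟨p, hp, hp'⟩ := hf
  obtain ⟨q, hq, hq'⟩ := hg
  have : p = q := by
    refine Polynomial.eq_of_degrees_lt_of_eval_finset_eq S ?_ ?_ fun v hv => ?_
    · exact Polynomial.degree_le_natDegree.trans_lt (by exact_mod_cast (by omega))
    · exact Polynomial.degree_le_natDegree.trans_lt (by exact_mod_cast (by omega))
    · rw [hp', hq', h v hv]
  rw [← hp', ← hq', this]

end IsPolyDeg

section Kernel

set_option linter.unusedSectionVars false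

variable {ι κ : Type*} [DecidableEq ι] [DecidableEq κ]

/-- The coefficient of the shift in the directions `I` of the difference operator on the
variables `lam i`, `i ∈ A`. -/
def shiftCoef (η : ℂ) (lam : ι → ℂ) (A I : Finset ι) : ℂ :=
  ∏ i ∈ I, ∏ j ∈ A \ I, (2 * η - lam i + lam j) / (lam i - lam j)

/-- The contribution of `I ⊆ A` to the action of the difference operator on the kernel. -/
def kernelTerm (η : ℂ) (lam : ι → ℂ) (c : κ → ℂ) (A : Finset ι) (B : Finset κ)
    (I : Finset ι) : ℂ :=
  shiftCoef η lam A I *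
    ((∏ i ∈ I, ∏ l ∈ B, (lam i - c l + η)) * ∏ i ∈ A \ I, ∏ l ∈ B, (η - lam i + c l))

variable (η : ℂ) (lam : ι → ℂ) (c : κ → ℂ)

lemma kernelTerm_insert_right {A : Finset ι} {B : Finset κ} {m : κ} (hm : m ∉ B) (I : Finset ι) :
    kernelTerm η lam c A (insert m B) I = kernelTerm η lam c A B I *
      ((∏ i ∈ I, (lam i - c m + η)) * ∏ i ∈ A \ I, (η - lam i + c m)) := by
  simp only [kernelTerm, Finset.prod_insert hm, Finset.prod_mul_distrib]
  ring

lemma kernelTerm_insert_left {A : Finset ι} {B : Finset κ} {k : ι} (hk : k ∉ A) {I : Finset ι}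
    (hI : I ⊆ A) :
    kernelTerm η lam c (insert k A) B I = kernelTerm η lam c A B I *
      ((∏ i ∈ I, (2 * η - lam i + lam k) / (lam i - lam k)) * ∏ l ∈ B, (η - lam k + c l)) := by
  have hkI : k ∉ I := fun h => hk (hI h)
  have hkA : k ∉ A \ I := by simp [hk]
  simp only [kernelTerm, shiftCoef, Finset.insert_sdiff_of_notMem A hkI, Finset.prod_insert hkA,
    Finset.prod_mul_distrib]
  ring

lemma kernelTerm_insert_insert {A : Finset ι} {B : Finset κ} {k : ι} (hk : k ∉ A) {I : Finset ι}
    (hI : I ⊆ A) :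
    kernelTerm η lam c (insert k A) B (insert k I) = kernelTerm η lam c A B I *
      ((∏ j ∈ A \ I, (2 * η - lam k + lam j) / (lam k - lam j)) *
        ∏ l ∈ B, (lam k - c l + η)) := by
  have hkI : k ∉ I := fun h => hk (hI h)
  simp only [kernelTerm, shiftCoef, Finset.insert_sdiff_insert, Finset.prod_insert hkI,
    Finset.sdiff_insert_of_notMem hk]
  ring

lemma prod_mul_prod_sdiff {A I : Finset ι} (hI : I ⊆ A) (f : ι → ℂ) :
    (∏ i ∈ I, f i) * ∏ i ∈ A \ I, f i = ∏ i ∈ A, f i := by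
  rw [mul_comm, Finset.prod_sdiff hI]

lemma prod_div_mul_cancel {A : Finset ι} {f g : ι → ℂ} (h : ∀ i ∈ A, g i ≠ 0) :
    (∏ i ∈ A, f i / g i) * ∏ i ∈ A, g i = ∏ i ∈ A, f i := by
  rw [← Finset.prod_mul_distrib]
  exact Finset.prod_congr rfl fun i hi => div_mul_cancel₀ _ (h i hi)

/-- The left-hand side of the kernel identity at `c m = v`, as a function of `v`. -/
def kernelSumLeft (w : ℕ → ℂ) (A : Finset ι) (B : Finset κ) (v : ℂ) : ℂ :=
  ∑ I ∈ A.powerset, w I.card * (kernelTerm η lam c A B I *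
    ((∏ i ∈ I, (lam i - v + η)) * ∏ i ∈ A \ I, (η - lam i + v)))

/-- The right-hand side of the kernel identity at `c m = v`, as a function of `v`. -/
def kernelSumRight (w : ℕ → ℂ) (A : Finset ι) (B : Finset κ) (v : ℂ) : ℂ :=
  ∑ J ∈ B.powerset, kernelTerm η (-c) (-lam) B A J *
    ((w J.card + w (J.card + 1)) *
        ((∏ l ∈ J, (2 * η + c l - v) / (v - c l)) * ∏ k ∈ A, (η - lam k + v)) +
      (w (J.card + 1) + w (J.card + 2)) *
        ((∏ l ∈ B \ J, (2 * η + v - c l) / (c l - v)) * ∏ k ∈ A, (lam k - v + η)))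

lemma kernelSumLeft_eq (w : ℕ → ℂ) (A : Finset ι) {B : Finset κ} {m : κ} (hm : m ∉ B) :
    ∑ I ∈ A.powerset, w I.card * kernelTerm η lam c A (insert m B) I =
      kernelSumLeft η lam c w A B (c m) := by
  simp only [kernelSumLeft, kernelTerm_insert_right η lam c hm]

lemma kernelSumRight_eq (w : ℕ → ℂ) (A : Finset ι) {B : Finset κ} {m : κ} (hm : m ∉ B) :
    ∑ J ∈ (insert m B).powerset, (w J.card + w (J.card + 1)) *
        kernelTerm η (-c) (-lam) (insert m B) A J =
      kernelSumRight η lam c w A B (c m) := by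
  rw [Finset.sum_powerset_insert hm, ← Finset.sum_add_distrib]
  refine Finset.sum_congr rfl fun J hJ => ?_
  have hJ' := Finset.mem_powerset.1 hJ
  rw [kernelTerm_insert_left η _ _ hm hJ', kernelTerm_insert_insert η _ _ hm hJ',
    Finset.card_insert_of_notMem (fun h => hm (hJ' h))]
  simp only [Pi.neg_apply, sub_neg_eq_add, neg_add_eq_sub]
  have e1 : ∀ l, η - lam l + c m = η + c m - lam l := fun l => by ring
  have e2 : ∀ l, 2 * η + c l + -c m = 2 * η + c l - c m := fun l => by ring
  have e3 : ∀ l, 2 * η + c m + -c l = 2 * η + c m - c l := fun l => by ring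
  have e4 : ∀ l, -lam l + (η + c m) = η + c m - lam l := fun l => by ring
  have e5 : ∀ l, η + c m + -lam l = η + c m - lam l := fun l => by ring
  simp only [e1, e2, e3, e5]
  ring

/-- At v = λ_k + η the factor λ_k - v + η kills every subset containing k. What remains is the sum
for the smaller set A. -/
lemma kernelSumLeft_eval_add (w : ℕ → ℂ) {A : Finset ι} (B : Finset κ) {k : ι} (hk : k ∉ A)
    (hlam : ∀ i ∈ A, lam i ≠ lam k) :
    kernelSumLeft η lam c w (insert k A) B (lam k + η) =
      (2 * η * (∏ i ∈ A, (2 * η - lam i + lam k)) * ∏ l ∈ B, (η - lam k + c l)) *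
        ∑ I ∈ A.powerset, w I.card * kernelTerm η lam c A B I := by
  rw [kernelSumLeft, Finset.sum_powerset_insert hk, Finset.mul_sum, ← Finset.sum_add_distrib]
  refine Finset.sum_congr rfl fun I hI => ?_
  have hI' := Finset.mem_powerset.1 hI
  have hkI : k ∉ I := fun h => hk (hI' h)
  have hkA : k ∉ A \ I := by simp [hk]
  rw [kernelTerm_insert_left η _ _ hk hI', Finset.prod_insert hkI,
    Finset.insert_sdiff_of_notMem A hkI, Finset.prod_insert hkA,
    ← prod_mul_prod_sdiff hI' (fun i => 2 * η - lam i + lam k),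
    ← prod_div_mul_cancel (A := I) (f := fun i => 2 * η - lam i + lam k)
      (g := fun i => lam i - lam k) fun i hi => sub_ne_zero.2 (hlam i (hI' hi))]
  have e1 : ∀ i, lam i - (lam k + η) + η = lam i - lam k := fun i => by ring
  have e2 : ∀ i, η - lam i + (lam k + η) = 2 * η - lam i + lam k := fun i => by ring
  simp only [e1, e2]
  ring

/-- At v = λ_k - η only the subsets containing k survive, so the weight is read one cardinality
higher. This shift is why the weight is kept arbitrary in the induction. -/
lemma kernelSumLeft_eval_sub (w : ℕ → ℂ) {A : Finset ι} (B : Finset κ) {k : ι} (hk : k ∉ A)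
    (hlam : ∀ i ∈ A, lam i ≠ lam k) :
    kernelSumLeft η lam c w (insert k A) B (lam k - η) =
      (2 * η * (∏ i ∈ A, (2 * η - lam k + lam i)) * ∏ l ∈ B, (lam k - c l + η)) *
        ∑ I ∈ A.powerset, w (I.card + 1) * kernelTerm η lam c A B I := by
  rw [kernelSumLeft, Finset.sum_powerset_insert hk, Finset.mul_sum, ← Finset.sum_add_distrib]
  refine Finset.sum_congr rfl fun I hI => ?_
  have hI' := Finset.mem_powerset.1 hI
  have hkI : k ∉ I := fun h => hk (hI' h)
  have hkA : k ∉ A \ I := by simp [hk]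
  rw [kernelTerm_insert_insert η _ _ hk hI', Finset.prod_insert hkI,
    Finset.insert_sdiff_of_notMem A hkI, Finset.insert_sdiff_insert, Finset.prod_insert hkA,
    Finset.sdiff_insert_of_notMem hk, Finset.card_insert_of_notMem hkI,
    ← prod_mul_prod_sdiff hI' (fun i => 2 * η - lam k + lam i),
    ← prod_div_mul_cancel (A := A \ I) (f := fun i => 2 * η - lam k + lam i)
      (g := fun i => lam k - lam i)
      fun i hi => sub_ne_zero.2 (hlam i (Finset.mem_sdiff.1 hi).1).symm]
  have e1 : ∀ i, lam i - (lam k - η) + η = 2 * η - lam k + lam i := fun i => by ring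
  have e2 : ∀ i, η - lam i + (lam k - η) = lam k - lam i := fun i => by ring
  simp only [e1, e2]
  ring

/-- One of the two summands in `kernelSumRight` vanishes, and the prefactor is the same as for
`kernelSumLeft`. The kernel identity at these points is thereby reduced to one variable fewer on
each side. -/
lemma kernelSumRight_eval_add (w : ℕ → ℂ) {A : Finset ι} (B : Finset κ) {k : ι} (hk : k ∉ A)
    (hc : ∀ l ∈ B, lam k - c l + η ≠ 0) :
    kernelSumRight η lam c w (insert k A) B (lam k + η) =
      (2 * η * (∏ i ∈ A, (2 * η - lam i + lam k)) * ∏ l ∈ B, (η - lam k + c l)) *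
        ∑ J ∈ B.powerset, (w J.card + w (J.card + 1)) * kernelTerm η (-c) (-lam) B A J := by
  rw [kernelSumRight, Finset.mul_sum]
  refine Finset.sum_congr rfl fun J hJ => ?_
  have hJ' := Finset.mem_powerset.1 hJ
  rw [kernelTerm_insert_right η _ _ hk, Finset.prod_insert hk, Finset.prod_insert hk,
    ← prod_mul_prod_sdiff hJ' (fun l => η - lam k + c l),
    ← prod_div_mul_cancel (A := J) (f := fun l => η - lam k + c l)
      (g := fun l => lam k - c l + η) fun l hl => hc l (hJ' hl)]
  have e1 : ∀ l, 2 * η + c l - (lam k + η) = η - lam k + c l := fun i => by ring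
  have e2 : ∀ l, lam k + η - c l = lam k - c l + η := fun i => by ring
  have e3 : ∀ i, η - lam i + (lam k + η) = 2 * η - lam i + lam k := fun i => by ring
  have e4 : ∀ l, (-c) l - (-lam) k + η = lam k - c l + η := fun i => by simp; ring
  have e5 : ∀ l, η - (-c) l + (-lam) k = η - lam k + c l := fun i => by simp; ring
  simp only [e1, e2, e3, e4, e5]
  ring

lemma kernelSumRight_eval_sub (w : ℕ → ℂ) {A : Finset ι} (B : Finset κ) {k : ι} (hk : k ∉ A)
    (hc : ∀ l ∈ B, η - lam k + c l ≠ 0) :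
    kernelSumRight η lam c w (insert k A) B (lam k - η) =
      (2 * η * (∏ i ∈ A, (2 * η - lam k + lam i)) * ∏ l ∈ B, (lam k - c l + η)) *
        ∑ J ∈ B.powerset, (w (J.card + 1) + w (J.card + 1 + 1)) *
          kernelTerm η (-c) (-lam) B A J := by
  rw [kernelSumRight, Finset.mul_sum]
  refine Finset.sum_congr rfl fun J hJ => ?_
  have hJ' := Finset.mem_powerset.1 hJ
  rw [kernelTerm_insert_right η _ _ hk, Finset.prod_insert hk, Finset.prod_insert hk,
    ← prod_mul_prod_sdiff hJ' (fun l => lam k - c l + η),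
    ← prod_div_mul_cancel (A := B \ J) (f := fun l => lam k - c l + η)
      (g := fun l => η - lam k + c l) fun l hl => hc l (Finset.mem_sdiff.1 hl).1]
  have e1 : ∀ l, 2 * η + (lam k - η) - c l = lam k - c l + η := fun i => by ring
  have e2 : ∀ l, c l - (lam k - η) = η - lam k + c l := fun i => by ring
  have e3 : ∀ i, lam i - (lam k - η) + η = 2 * η - lam k + lam i := fun i => by ring
  have e4 : ∀ l, (-c) l - (-lam) k + η = lam k - c l + η := fun i => by simp; ring
  have e5 : ∀ l, η - (-c) l + (-lam) k = η - lam k + c l := fun i => by simp; ring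
  have e6 : η - lam k + (lam k - η) = 0 := by ring
  simp only [e1, e2, e3, e4, e5, e6]
  ring

lemma isPolyDeg_kernelSumLeft (w : ℕ → ℂ) (A : Finset ι) (B : Finset κ) :
    IsPolyDeg A.card (kernelSumLeft η lam c w A B) := by
  refine IsPolyDeg.sum _ fun I hI => IsPolyDeg.const_mul _ (IsPolyDeg.const_mul _ ?_)
  have h := (IsPolyDeg.prod_linear I (f := fun i v => lam i - v + η) fun i _ => by
    convert IsPolyDeg.linear (lam i + η) (-1) using 2; ring).mul
    (IsPolyDeg.prod_linear (A \ I) (f := fun i v => η - lam i + v) fun i _ => by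
    convert IsPolyDeg.linear (η - lam i) 1 using 2; ring)
  rwa [add_comm, Finset.card_sdiff_add_card_eq_card (Finset.mem_powerset.1 hI)] at h

/-- The denominators of the right-hand side in v are simple factors v - c_l, up to sign; clearing
them allows polynomial interpolation. -/
lemma exists_isPolyDeg_kernelSumRight (w : ℕ → ℂ) (A : Finset ι) (B : Finset κ) :
    ∃ f, IsPolyDeg (B.card + A.card) f ∧ ∀ v, (∀ l ∈ B, v ≠ c l) →
      f v = (∏ l ∈ B, (v - c l)) * kernelSumRight η lam c w A B v := by
  refine ⟨fun v => ∑ J ∈ B.powerset, kernelTerm η (-c) (-lam) B A J *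
    ((w J.card + w (J.card + 1)) *
        (((∏ l ∈ J, (2 * η + c l - v)) * ∏ l ∈ B \ J, (v - c l)) * ∏ k ∈ A, (η - lam k + v)) +
      (w (J.card + 1) + w (J.card + 2)) *
        (((∏ l ∈ J, (v - c l)) * ∏ l ∈ B \ J, (-2 * η - v + c l)) *
          ∏ k ∈ A, (lam k - v + η))), ?_, ?_⟩
  · refine IsPolyDeg.sum _ fun J hJ => IsPolyDeg.const_mul _ ?_
    rw [← Finset.card_sdiff_add_card_eq_card (Finset.mem_powerset.1 hJ), add_comm (B \ J).card]
    refine IsPolyDeg.add (IsPolyDeg.const_mul _ ?_) (IsPolyDeg.const_mul _ ?_)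
    · refine IsPolyDeg.mul (IsPolyDeg.mul ?_ ?_) ?_ <;>
        refine IsPolyDeg.prod_linear _ fun i _ => ?_
      · convert IsPolyDeg.linear (2 * η + c i) (-1) using 2; ring
      · convert IsPolyDeg.linear (-c i) 1 using 2; ring
      · convert IsPolyDeg.linear (η - lam i) 1 using 2; ring
    · refine IsPolyDeg.mul (IsPolyDeg.mul ?_ ?_) ?_ <;>
        refine IsPolyDeg.prod_linear _ fun i _ => ?_
      · convert IsPolyDeg.linear (-c i) 1 using 2; ring
      · convert IsPolyDeg.linear (-2 * η + c i) (-1) using 2; ring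
      · convert IsPolyDeg.linear (lam i + η) (-1) using 2; ring
  · intro v hv
    rw [kernelSumRight, Finset.mul_sum]
    refine Finset.sum_congr rfl fun J hJ => ?_
    have hJ' := Finset.mem_powerset.1 hJ
    have h1 := prod_div_mul_cancel (A := J) (f := fun l => 2 * η + c l - v)
      (g := fun l => v - c l) fun l hl => sub_ne_zero.2 (hv l (hJ' hl))
    have h2 := prod_div_mul_cancel (A := B \ J) (f := fun l => -2 * η - v + c l)
      (g := fun l => v - c l) fun l hl => sub_ne_zero.2 (hv l (Finset.mem_sdiff.1 hl).1)
    have h3 : ∀ l, (-2 * η - v + c l) / (v - c l) = (2 * η + v - c l) / (c l - v) := fun l => by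
      rw [← neg_div_neg_eq]; congr 1 <;> ring
    simp only [h3] at h2
    rw [← prod_mul_prod_sdiff hJ' (fun l => v - c l), ← h1, ← h2]
    ring

/-- The action of the difference operator in `n` variables on the kernel agrees with the action of
the dual operators in `n - 1` variables. -/
theorem kernel_identity {η : ℝ} (hη : η ≠ 0) (B : Finset κ) (hc0 : ∀ l ∈ B, (c l).re = 0)
    (hc : Set.InjOn c B) : ∀ (A : Finset ι), A.card = B.card + 1 →
      (∀ i ∈ A, (lam i).re = 0) → Set.InjOn lam A → ∀ w : ℕ → ℂ,
      ∑ I ∈ A.powerset, w I.card * kernelTerm η lam c A B I =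
        ∑ J ∈ B.powerset, (w J.card + w (J.card + 1)) * kernelTerm η (-c) (-lam) B A J := by
  induction B using Finset.induction_on with
  | empty =>
    intro A hA _ _ w
    obtain ⟨a, rfl⟩ := Finset.card_eq_one.1 (by simpa using hA)
    rw [← insert_empty_eq a, Finset.sum_powerset_insert (by simp)]
    simp [kernelTerm, shiftCoef]
  | insert m B hm ih =>
    intro A hA hA0 hlam w
    -- Both sides are regarded as functions of v = c_m. After multiplication by ∏ (v - c_l) they are
    -- polynomials of degree at most |B| + |A| = 2|A| - 2, and are compared at the 2|A| points λ_k ±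
    -- η.
    rw [kernelSumLeft_eq η lam c w A hm, kernelSumRight_eq η lam c w A hm]
    have ih' := ih (fun l hl => hc0 l (by simp [hl])) (hc.mono (by simp))
    obtain ⟨f, hf, hf'⟩ := exists_isPolyDeg_kernelSumRight (η : ℂ) lam c w A B
    have hBcard : (insert m B).card = B.card + 1 := Finset.card_insert_of_notMem hm
    have hP : IsPolyDeg B.card (fun v => ∏ l ∈ B, (v - c l)) :=
      IsPolyDeg.prod_linear _ fun l _ => by
        convert IsPolyDeg.linear (-c l) 1 using 2; ring
    have hne : ∀ l ∈ B, c m ≠ c l := fun l hl h =>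
      hm (hc (by simp) (by simp [hl]) h ▸ hl)
    have hre : ∀ (k : ι) (l : κ), k ∈ A → l ∈ B → (lam k).re = 0 ∧ (c l).re = 0 :=
      fun k l hk hl => ⟨hA0 k hk, hc0 l (by simp [hl])⟩
    set S : Finset ℂ := A.image (fun k => lam k + η) ∪ A.image (fun k => lam k - η) with hS
    have hScard : S.card = A.card + A.card := by
      rw [hS, Finset.card_union_of_disjoint, Finset.card_image_of_injOn,
        Finset.card_image_of_injOn]
      · exact fun i hi j hj h => hlam hi hj (by simpa using h)
      · exact fun i hi j hj h => hlam hi hj (by simpa using h)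
      · rw [Finset.disjoint_left]
        -- The two families of nodes have real parts η and -η, so they are disjoint.
        intro v h1 h2
        obtain ⟨i, hi, rfl⟩ := Finset.mem_image.1 h1
        obtain ⟨j, hj, h⟩ := Finset.mem_image.1 h2
        have := congrArg Complex.re h
        simp [hA0 i hi, hA0 j hj] at this
        exact hη (by linarith)
    have key : ∀ v ∈ S, (∏ l ∈ B, (v - c l)) * kernelSumLeft (η : ℂ) lam c w A B v = f v := by
      intro v hv
      have hsplit : ∀ k ∈ A, insert k (A.erase k) = A ∧ (∀ i ∈ A.erase k, lam i ≠ lam k) ∧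
          ∀ w : ℕ → ℂ, ∑ I ∈ (A.erase k).powerset, w I.card * kernelTerm η lam c (A.erase k) B I =
            ∑ J ∈ B.powerset, (w J.card + w (J.card + 1)) *
              kernelTerm η (-c) (-lam) B (A.erase k) J := fun k hk =>
        ⟨Finset.insert_erase hk, fun i hi h =>
          (Finset.mem_erase.1 hi).1 (hlam (Finset.mem_erase.1 hi).2 hk h),
          ih' (A.erase k) (by rw [Finset.card_erase_of_mem hk]; omega)
            (fun i hi => hA0 i (Finset.mem_erase.1 hi).2) (hlam.mono (by simp))⟩
      rcases Finset.mem_union.1 hv with h1 | h1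
      · obtain ⟨k, hk, rfl⟩ := Finset.mem_image.1 h1
        obtain ⟨e, h2, h3⟩ := hsplit k hk
        rw [hf']
        · congr 1
          have hc' : ∀ l ∈ B, lam k - c l + η ≠ 0 := fun l hl h => by
            have := congrArg Complex.re h
            simp [hre k l hk hl] at this
            exact hη this
          have a1 := kernelSumLeft_eval_add (η : ℂ) lam c w B (Finset.notMem_erase k A) h2
          have a2 := kernelSumRight_eval_add (η : ℂ) lam c w B (Finset.notMem_erase k A) hc'
          rw [e] at a1 a2
          rw [a1, a2, h3]
        · intro l hl h
          have := congrArg Complex.re h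
          simp [hre k l hk hl] at this
          exact hη this
      · obtain ⟨k, hk, rfl⟩ := Finset.mem_image.1 h1
        obtain ⟨e, h2, h3⟩ := hsplit k hk
        rw [hf']
        · congr 1
          have hc' : ∀ l ∈ B, (η : ℂ) - lam k + c l ≠ 0 := fun l hl h => by
            have := congrArg Complex.re h
            simp [hre k l hk hl] at this
            exact hη this
          have a1 := kernelSumLeft_eval_sub (η : ℂ) lam c w B (Finset.notMem_erase k A) h2
          have a2 := kernelSumRight_eval_sub (η : ℂ) lam c w B (Finset.notMem_erase k A) hc'
          rw [e] at a1 a2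
          -- The induction hypothesis is used with the shifted weight.
          rw [a1, a2, h3 (fun s => w (s + 1))]
        · intro l hl h
          have := congrArg Complex.re h
          simp [hre k l hk hl] at this
          exact hη this
    have hfin := IsPolyDeg.eq_of_card
      (hP.mul (isPolyDeg_kernelSumLeft (η : ℂ) lam c w A B)) hf S (by omega) key (c m)
    rw [hf' _ hne] at hfin
    exact mul_left_cancel₀ (Finset.prod_ne_zero_iff.2 fun l hl => sub_ne_zero.2 (hne l hl)) hfin

end Kernel

open MeasureTheory Filter Topology

/-! ### Holomorphic functions of several variables -/

/-- Cauchy's estimate on the complex line through q in the direction v, on a disc of radius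
R/(2‖v‖). -/
lemma norm_fderiv_le_of_norm_le {n : ℕ} {f : (Fin n → ℂ) → ℂ} {q : Fin n → ℂ} {R B : ℝ}
    (hR : 0 < R) (hf : DifferentiableOn ℂ f (Metric.ball q R))
    (hB : ∀ p ∈ Metric.ball q R, ‖f p‖ ≤ B) : ‖fderiv ℂ f q‖ ≤ 2 * B / R := by
  have hB0 : 0 ≤ B := (norm_nonneg _).trans (hB q (Metric.mem_ball_self hR))
  refine ContinuousLinearMap.opNorm_le_bound _ (by positivity) fun v => ?_
  by_cases hv : v = 0
  · simp [hv]
  have hv' : 0 < ‖v‖ := norm_pos_iff.2 hv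
  have hline : ∀ s ∈ Metric.closedBall (0 : ℂ) (R / (2 * ‖v‖)), q + s • v ∈ Metric.ball q R := by
    intro s hs
    rw [mem_closedBall_zero_iff, le_div_iff₀ (by positivity)] at hs
    rw [mem_ball_iff_norm, add_sub_cancel_left, norm_smul]
    linarith
  have hφ : DifferentiableOn ℂ (fun s : ℂ => f (q + s • v))
      (Metric.closedBall (0 : ℂ) (R / (2 * ‖v‖))) :=
    hf.comp (by fun_prop) hline
  have hd : HasDerivAt (fun s : ℂ => f (q + s • v)) (fderiv ℂ f q v) 0 := by
    have h1 : HasFDerivAt f (fderiv ℂ f q) (q + (0 : ℂ) • v) := by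
      simpa using (hf.differentiableAt (Metric.ball_mem_nhds q hR)).hasFDerivAt
    have h2 : HasDerivAt (fun s : ℂ => q + s • v) v 0 := by
      simpa using ((hasDerivAt_id (0 : ℂ)).smul_const v).const_add q
    exact h1.comp_hasDerivAt 0 h2
  have := Complex.norm_deriv_le_of_forall_mem_sphere_norm_le (c := 0) (C := B)
    (R := R / (2 * ‖v‖)) (by positivity)
    ((hφ.mono Metric.closure_ball_subset_closedBall).diffContOnCl) fun s hs =>
      hB _ (hline s (Metric.sphere_subset_closedBall hs))
  rw [hd.deriv] at this
  refine this.trans (le_of_eq ?_)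
  field_simp

/-- A directional derivative is a pointwise limit of difference quotients, which are measurable. -/
lemma aestronglyMeasurable_fderiv_apply {n : ℕ} {T : Type*} [MeasurableSpace T] {μ : Measure T}
    {U : Set (Fin n → ℂ)} (hU : IsOpen U) {f : (Fin n → ℂ) → T → ℂ}
    (hmeas : ∀ p ∈ U, AEStronglyMeasurable (f p) μ)
    (hdiff : ∀ t, DifferentiableOn ℂ (fun p => f p t) U) {p : Fin n → ℂ} (hp : p ∈ U)
    (v : Fin n → ℂ) : AEStronglyMeasurable (fun t => fderiv ℂ (fun p => f p t) p v) μ := by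
  have hc : Tendsto (fun k : ℕ => ((k : ℂ))⁻¹ • v) atTop (𝓝 0) := by
    have := (tendsto_inv_atTop_nhds_zero_nat (𝕜 := ℂ)).smul_const v
    simpa using this
  have hev : ∀ᶠ k : ℕ in atTop, p + ((k : ℂ))⁻¹ • v ∈ U := by
    have : Tendsto (fun k : ℕ => p + ((k : ℂ))⁻¹ • v) atTop (𝓝 p) := by
      simpa using hc.const_add p
    exact this.eventually (hU.mem_nhds hp)
  obtain ⟨k₀, hk₀⟩ := eventually_atTop.1 hev
  refine aestronglyMeasurable_of_tendsto_ae atTop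
    (f := fun (k : ℕ) t => ((k + k₀ : ℕ) : ℂ) • (f (p + (((k + k₀ : ℕ) : ℂ))⁻¹ • v) t - f p t))
    (fun k => ((hmeas _ (hk₀ (k + k₀) (by omega))).sub (hmeas p hp)).const_smul ((k + k₀ : ℕ) : ℂ))
    (Eventually.of_forall fun t => ?_)
  have h1 : HasFDerivAt (fun p => f p t) (fderiv ℂ (fun p => f p t) p) p :=
    ((hdiff t).differentiableAt (hU.mem_nhds hp)).hasFDerivAt
  have h2 : Tendsto (fun k : ℕ => ‖((k : ℕ) : ℂ)‖) atTop atTop := by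
    simpa using tendsto_natCast_atTop_atTop (R := ℝ)
  exact (h1.lim v h2).comp (tendsto_add_atTop_nat k₀)

/-- A locally uniformly dominated parameter integral of holomorphic functions is holomorphic. -/
lemma differentiableOn_integral_of_dominated {n : ℕ} {T : Type*} [MeasurableSpace T]
    {μ : Measure T} {U : Set (Fin n → ℂ)} (hU : IsOpen U) {f : (Fin n → ℂ) → T → ℂ}
    (hmeas : ∀ p ∈ U, AEStronglyMeasurable (f p) μ)
    (hdiff : ∀ t, DifferentiableOn ℂ (fun p => f p t) U)
    (hbound : ∀ p ∈ U, ∃ r > 0, ∃ bound : T → ℝ, Integrable bound μ ∧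
      ∀ q ∈ Metric.ball p r, q ∈ U → ∀ t, ‖f q t‖ ≤ bound t) :
    DifferentiableOn ℂ (fun p => ∫ t, f p t ∂μ) U := by
  intro p hp
  obtain ⟨r, hr, bound, hint, hb⟩ := hbound p hp
  obtain ⟨R', hR', hRU⟩ := Metric.isOpen_iff.1 hU p hp
  -- Half the radius leaves room for a Cauchy disc of radius R around each point of the ball of
  -- radius R.
  set R := min r R' / 2 with hR
  have hR0 : 0 < R := by positivity
  have hsub : ∀ q ∈ Metric.ball p R, Metric.ball q R ⊆ Metric.ball p r ∩ U := by
    intro q hq y hy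
    have h1 : dist y p < R + R := (dist_triangle y q p).trans_lt (add_lt_add hy hq)
    have h2 : R + R = min r R' := by rw [hR]; ring
    rw [h2] at h1
    exact ⟨h1.trans_le (min_le_left _ _), hRU (h1.trans_le (min_le_right _ _))⟩
  have hpU : ∀ q ∈ Metric.ball p R, q ∈ U := fun q hq =>
    (hsub q hq (Metric.mem_ball_self hR0)).2
  have key := hasFDerivAt_integral_of_dominated_of_fderiv_le (𝕜 := ℂ) (μ := μ) (F := f) (x₀ := p)
    (F' := fun q t => fderiv ℂ (fun q => f q t) q) (bound := fun t => 2 * bound t / R)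
    (s := Metric.ball p R) (Metric.ball_mem_nhds p hR0)
    (by filter_upwards [hU.mem_nhds hp] with q hq using hmeas q hq)
    (hint.mono' (hmeas p hp) (Eventually.of_forall fun t =>
      hb p (Metric.mem_ball_self hr) hp t)) ?_
    (Eventually.of_forall fun t q hq => norm_fderiv_le_of_norm_le hR0
      ((hdiff t).mono fun y hy => (hsub q hq hy).2)
      fun y hy => hb y (hsub q hq hy).1 (hsub q hq hy).2 t)
    ((hint.const_mul 2).div_const R)
    (Eventually.of_forall fun t q hq =>
      ((hdiff t).differentiableAt (hU.mem_nhds (hpU q hq))).hasFDerivAt)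
  · exact key.differentiableAt.differentiableWithinAt
  -- Measurability of the full derivative is reduced to that of its finitely many coordinates.
  · have : ∀ t, fderiv ℂ (fun q => f q t) p = ∑ i : Fin n,
        (fderiv ℂ (fun q => f q t) p (Pi.single i 1)) •
          (ContinuousLinearMap.proj i : (Fin n → ℂ) →L[ℂ] ℂ) := by
      intro t
      ext v
      conv_lhs => rw [pi_eq_sum_univ' v]
      simp only [map_sum, map_smul, _root_.sum_apply,
        _root_.smul_apply, ContinuousLinearMap.proj_apply, smul_eq_mul]
      refine Finset.sum_congr rfl fun i _ => ?_
      rw [mul_comm]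
    rw [show (fun t => fderiv ℂ (fun q => f q t) p) = _ from funext this]
    exact Finset.aestronglyMeasurable_fun_sum _ fun i _ =>
      (aestronglyMeasurable_fderiv_apply hU hmeas hdiff hp _).smul_const _

/-- Invariance under imaginary translations makes the derivative along the imaginary axis vanish,
hence the complex derivative. This replaces Cauchy's theorem in shifting contours and in extending
translation covariance. -/
lemma eq_of_imag_periodic {f : ℂ → ℂ} {S : Set ℂ} (hopen : IsOpen S) (hS : IsPreconnected S)
    (hf : DifferentiableOn ℂ f S)
    (hper : ∀ c (σ : ℝ), f (c + Complex.I * σ) = f c) {c c' : ℂ} (hc : c ∈ S) (hc' : c' ∈ S) :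
    f c = f c' := by
  refine hopen.is_const_of_deriv_eq_zero hS hf (fun z hz => ?_) hc hc'
  have hd := (hf.differentiableAt (hopen.mem_nhds hz)).hasDerivAt
  have h1 : HasDerivAt (fun σ : ℝ => f (z + Complex.I * σ)) (deriv f z * Complex.I) 0 := by
    have e : HasDerivAt (fun σ : ℝ => z + Complex.I * (σ : ℂ)) Complex.I 0 := by
      simpa using ((Complex.ofRealCLM.hasDerivAt (x := (0 : ℝ))).const_mul Complex.I).const_add z
    have hd' : HasDerivAt f (deriv f z) (z + Complex.I * ((0 : ℝ) : ℂ)) := by simpa using hd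
    exact hd'.comp (0 : ℝ) e
  have h2 : HasDerivAt (fun σ : ℝ => f (z + Complex.I * σ)) 0 0 := by
    simp only [hper]; exact hasDerivAt_const _ _
  simpa using h1.unique h2

/-- The imaginary parts of the entries of a row. -/
def imVec {N : ℕ} (c : Fin N → ℂ) : Fin N → ℝ := fun j => (c j).im

/-- The purely imaginary row with imaginary parts `t`. -/
def imRow {N : ℕ} (t : Fin N → ℝ) : Fin N → ℂ := fun j => Complex.I * t j

@[simp] lemma imRow_re {N : ℕ} (t : Fin N → ℝ) (j : Fin N) : (imRow t j).re = 0 := by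
  simp [imRow]

@[simp] lemma imVec_imRow {N : ℕ} (t : Fin N → ℝ) : imVec (imRow t) = t := by
  ext j; simp [imRow, imVec]

lemma continuous_imRow {N : ℕ} : Continuous (imRow : (Fin N → ℝ) → Fin N → ℂ) := by
  unfold imRow; fun_prop

/-- Translation of the contour of integration by the real vector `ε`. -/
lemma integral_imRow_add {N : ℕ} (ε : Fin N → ℝ) {h : (Fin N → ℂ) → ℂ} {δ C : ℝ} (hδ : 0 < δ)
    (hC : 0 ≤ C)
    (hd : ∀ c : Fin N → ℂ, (∃ s, -δ < s ∧ s < 1 + δ ∧ ∀ j, (c j).re = s * ε j) →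
      DifferentiableAt ℂ h c)
    (hb : ∀ c : Fin N → ℂ, (∃ s, -δ < s ∧ s < 1 + δ ∧ ∀ j, (c j).re = s * ε j) →
      ‖h c‖ ≤ C * ((1 + ‖imVec c‖) ^ (N + 1))⁻¹) :
    ∫ t : Fin N → ℝ, h (fun j => imRow t j + ε j) = ∫ t : Fin N → ℝ, h (imRow t) := by
  -- The real translation parameter is made complex. An imaginary change of s is a translation of t
  -- and leaves the integral unchanged, so the integral is constant in s; compare s = 1 with s = 0.
  set pt : ℂ → (Fin N → ℝ) → Fin N → ℂ := fun s t j => imRow t j + s * ε j with hpt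
  have hptre : ∀ s : ℂ, -δ < s.re ∧ s.re < 1 + δ → ∀ t,
      (∃ r, -δ < r ∧ r < 1 + δ ∧ ∀ j, (pt s t j).re = r * ε j) := fun s hs t =>
    ⟨s.re, hs.1, hs.2, fun j => by simp [hpt]⟩
  have hptim : ∀ (s : ℂ) t, imVec (pt s t) = t + s.im • ε := by
    intro s t
    ext j
    simp [hpt, imVec, imRow]
  have hopen : IsOpen {p : Fin 1 → ℂ | -δ < (p 0).re ∧ (p 0).re < 1 + δ} :=
    (isOpen_lt continuous_const (Complex.continuous_re.comp (continuous_apply 0))).inter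
      (isOpen_lt (Complex.continuous_re.comp (continuous_apply 0)) continuous_const)
  have hG : DifferentiableOn ℂ (fun p : Fin 1 → ℂ => ∫ t : Fin N → ℝ, h (pt (p 0) t))
      {p | -δ < (p 0).re ∧ (p 0).re < 1 + δ} := by
    refine differentiableOn_integral_of_dominated hopen (fun p hp => ?_) (fun t p hp => ?_)
      fun p hp => ?_
    · refine Continuous.aestronglyMeasurable ?_
      refine continuous_iff_continuousAt.2 fun t => ?_
      refine ContinuousAt.comp (hd _ (hptre _ hp t)).continuousAt (f := fun t => pt (p 0) t) ?_
      simp only [hpt]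
      exact (continuous_pi fun j => (continuous_const.mul
        (Complex.continuous_ofReal.comp (continuous_apply j))).add continuous_const).continuousAt
    · refine DifferentiableAt.differentiableWithinAt ?_
      refine DifferentiableAt.comp p (hd _ (hptre _ hp t)) (f := fun p : Fin 1 → ℂ => pt (p 0) t) ?_
      simp only [hpt]
      fun_prop
    · set K := (|(p 0).im| + 1) * ‖ε‖ with hK
      refine ⟨1, one_pos, fun t => C * ((1 + K) ^ (N + 1) * ((1 + ‖t‖) ^ (N + 1))⁻¹),
        ((integrable_inv_one_add_norm_pow N).const_mul _).const_mul _, fun q hq hqU t => ?_⟩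
      refine (hb _ (hptre _ hqU t)).trans (mul_le_mul_of_nonneg_left ?_ hC)
      rw [← div_eq_mul_inv, le_div_iff₀ (by positivity), inv_mul_le_iff₀ (by positivity),
        ← mul_pow, hptim]
      gcongr
      have h1 : |(q 0).im| ≤ |(p 0).im| + 1 := by
        have h2 : ‖q 0 - p 0‖ < 1 := by
          have := (dist_le_pi_dist q p 0).trans_lt hq
          rwa [dist_eq_norm] at this
        have h3 := (Complex.abs_im_le_norm (q 0 - p 0)).trans h2.le
        rw [Complex.sub_im] at h3
        have := abs_sub_abs_le_abs_sub (q 0).im (p 0).im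
        linarith
      have h4 : ‖t‖ ≤ ‖t + (q 0).im • ε‖ + K := by
        have := norm_sub_le (t + (q 0).im • ε) ((q 0).im • ε)
        rw [add_sub_cancel_right, norm_smul, Real.norm_eq_abs] at this
        have h5 : |(q 0).im| * ‖ε‖ ≤ K := by rw [hK]; gcongr
        linarith
      have hK0 : 0 ≤ K := by positivity
      nlinarith [norm_nonneg (t + (q 0).im • ε)]
  have hH : DifferentiableOn ℂ (fun s : ℂ => ∫ t : Fin N → ℝ, h (pt s t))
      {s | -δ < s.re ∧ s.re < 1 + δ} :=
    hG.comp (f := fun (s : ℂ) (_ : Fin 1) => s) (by fun_prop) fun s hs => hs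
  have hper : ∀ (s : ℂ) (σ : ℝ), ∫ t : Fin N → ℝ, h (pt (s + Complex.I * σ) t) =
      ∫ t : Fin N → ℝ, h (pt s t) := by
    intro s σ
    rw [← integral_add_right_eq_self (fun t => h (pt s t)) (σ • ε)]
    congr 1
    ext t
    congr 1
    ext j
    simp [hpt, imRow]
    ring
  have := eq_of_imag_periodic
    ((isOpen_lt continuous_const Complex.continuous_re).inter
      (isOpen_lt Complex.continuous_re continuous_const))
    ((convex_halfSpace_re_gt (-δ)).inter (convex_halfSpace_re_lt (1 + δ))).isPreconnected
    hH hper (c := 1) (c' := 0) (by simp; constructor <;> linarith)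
    (by simp; constructor <;> linarith)
  simpa [hpt] using this

/-! ### Uniqueness of analytic continuation -/

/-- Near p, a point q is joined to imaginary points by the complex line s ↦ i Im q + s Re q. This
line is imaginary for imaginary s and passes through q at s = 1, so the one-variable identity
theorem applies. -/
lemma eventually_eq_zero_of_imagSpace {n : ℕ} {V : Set (Fin n → ℂ)} (hV : IsOpen V)
    {f : (Fin n → ℂ) → ℂ} (hf : DifferentiableOn ℂ f V)
    (h0 : ∀ p ∈ V, p ∈ imagSpace n → f p = 0) {p : Fin n → ℂ} (hp : p ∈ V)
    (hpi : p ∈ imagSpace n) : ∀ᶠ q in 𝓝 p, f q = 0 := by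
  obtain ⟨ρ, hρ, hρV⟩ := Metric.isOpen_iff.1 hV p hp
  -- With ρ/4, the disc |s| < 2, which contains s = 1, is mapped within distance 3ρ/4 of p.
  filter_upwards [Metric.ball_mem_nhds p (show 0 < ρ / 4 by positivity)] with q hq
  set u : ℂ → Fin n → ℂ := fun s j => Complex.I * (q j).im + s * (q j).re with hu
  have huV : ∀ s ∈ Metric.ball (0 : ℂ) 2, u s ∈ V := by
    intro s hs
    refine hρV ?_
    rw [mem_ball_zero_iff] at hs
    refine lt_of_le_of_lt ((dist_pi_le_iff (r := 3 * (ρ / 4)) (by positivity)).2 fun j => ?_)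
      (by linarith)
    have hj : ‖q j - p j‖ ≤ ρ / 4 := by
      rw [← dist_eq_norm]; exact (dist_le_pi_dist q p j).trans hq.le
    have h1 := (Complex.abs_im_le_norm (q j - p j)).trans hj
    have h2 := (Complex.abs_re_le_norm (q j - p j)).trans hj
    rw [Complex.sub_re, hpi j, sub_zero] at h2
    have e : u s j - p j = Complex.I * ((q j - p j).im : ℝ) + s * (q j).re := by
      have : p j = Complex.I * ((p j).im : ℝ) := by
        conv_lhs => rw [← Complex.re_add_im (p j), hpi j]
        simp [mul_comm]
      simp only [hu, Complex.sub_im, Complex.ofReal_sub, mul_sub]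
      rw [← this]
      ring
    rw [dist_eq_norm, e]
    refine (norm_add_le _ _).trans ?_
    rw [norm_mul, norm_mul, Complex.norm_I, Complex.norm_real, Complex.norm_real, one_mul,
      Real.norm_eq_abs, Real.norm_eq_abs]
    have : ‖s‖ * |(q j).re| ≤ 2 * (ρ / 4) := by gcongr
    linarith
  have hφ : DifferentiableOn ℂ (fun s => f (u s)) (Metric.ball (0 : ℂ) 2) :=
    hf.comp (by simp only [hu]; fun_prop) huV
  have hlim : Tendsto (fun σ : ℝ => Complex.I * (σ : ℂ)) (𝓝[>] 0) (𝓝[≠] 0) := by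
    refine tendsto_nhdsWithin_iff.2 ⟨?_, ?_⟩
    · have : Continuous fun σ : ℝ => Complex.I * (σ : ℂ) := by fun_prop
      have h := this.tendsto 0
      simp only [Complex.ofReal_zero, mul_zero] at h
      exact h.mono_left nhdsWithin_le_nhds
    · filter_upwards [self_mem_nhdsWithin] with σ hσ
      simpa using (ne_of_gt hσ : σ ≠ 0)
  have hz : ∀ᶠ σ : ℝ in 𝓝[>] 0, f (u (Complex.I * σ)) = 0 := by
    have : ∀ᶠ σ : ℝ in 𝓝[>] 0, Complex.I * (σ : ℂ) ∈ Metric.ball (0 : ℂ) 2 :=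
      (hlim.mono_right nhdsWithin_le_nhds).eventually (Metric.ball_mem_nhds _ two_pos)
    filter_upwards [this] with σ hσ
    exact h0 _ (huV _ hσ) fun j => by simp [hu]
  have hfreq : ∃ᶠ s in 𝓝[≠] (0 : ℂ), f (u s) = 0 := hlim.frequently hz.frequently
  have := (hφ.analyticOnNhd Metric.isOpen_ball).eqOn_zero_of_preconnected_of_frequently_eq_zero
    (convex_ball (0 : ℂ) 2).isPreconnected (Metric.mem_ball_self two_pos) hfreq
    (show (1 : ℂ) ∈ Metric.ball (0 : ℂ) 2 by simp)
  have hu1 : u 1 = q := by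
    ext j
    simp only [hu, one_mul]
    rw [add_comm, mul_comm, Complex.re_add_im]
  simpa [hu1] using this

/-- The points near which f vanishes form an open set that is relatively closed in V. Closedness
follows by restricting f to complex lines through a point of this set inside a ball. -/
lemma eqOn_zero_of_eventually_eq_zero {n : ℕ} {V : Set (Fin n → ℂ)} (hV : IsOpen V)
    (hVc : IsPreconnected V) {f : (Fin n → ℂ) → ℂ} (hf : DifferentiableOn ℂ f V)
    {p : Fin n → ℂ} (hp : p ∈ V) (h0 : ∀ᶠ q in 𝓝 p, f q = 0) : ∀ q ∈ V, f q = 0 := by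
  have hsub : V ⊆ {x | ∀ᶠ q in 𝓝 x, f q = 0} := by
    refine hVc.subset_of_closure_inter_subset isOpen_setOfPred_eventually_nhds ⟨p, hp, h0⟩ ?_
    rintro x ⟨hx, hxV⟩
    obtain ⟨ρ, hρ, hρV⟩ := Metric.isOpen_iff.1 hV x hxV
    obtain ⟨q, hq, hqx⟩ := Metric.mem_closure_iff.1 hx ρ hρ
    have hqb : q ∈ Metric.ball x ρ := by rwa [Metric.mem_ball, dist_comm]
    filter_upwards [Metric.ball_mem_nhds x hρ] with y hy
    set ℓ : ℂ → Fin n → ℂ := fun s => q + s • (y - q) with hℓ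
    have hcont : Continuous ℓ := by simp only [hℓ]; fun_prop
    have hDo : IsOpen (ℓ ⁻¹' Metric.ball x ρ) := Metric.isOpen_ball.preimage hcont
    have hDc : Convex ℝ (ℓ ⁻¹' Metric.ball x ρ) := by
      intro a ha b hb α β hα hβ hαβ
      have e : ℓ (α • a + β • b) = α • ℓ a + β • ℓ b := by
        have hβ' : (β : ℂ) = 1 - α := by
          rw [eq_sub_iff_add_eq', ← Complex.ofReal_add, hαβ, Complex.ofReal_one]
        ext j
        simp only [hℓ, Pi.add_apply, Pi.smul_apply, smul_eq_mul, Complex.real_smul, Pi.sub_apply,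
          hβ']
        ring
      rw [Set.mem_preimage, e]
      exact convex_ball x ρ ha hb hα hβ hαβ
    have hl0 : ℓ 0 = q := by simp [hℓ]
    have hl1 : ℓ 1 = y := by simp [hℓ]
    have hφ : DifferentiableOn ℂ (fun s => f (ℓ s)) (ℓ ⁻¹' Metric.ball x ρ) :=
      (hf.mono hρV).comp (by simp only [hℓ]; fun_prop) fun s hs => hs
    have hev : ∀ᶠ s in 𝓝 (0 : ℂ), f (ℓ s) = 0 := by
      have := hcont.tendsto 0
      rw [hl0] at this
      exact this.eventually hq
    have := (hφ.analyticOnNhd hDo).eqOn_zero_of_preconnected_of_eventuallyEq_zero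
      hDc.isPreconnected (show (0 : ℂ) ∈ _ by rw [Set.mem_preimage, hl0]; exact hqb) hev
      (show (1 : ℂ) ∈ _ by rw [Set.mem_preimage, hl1]; exact hy)
    simpa [hl1] using this
  exact fun q hq => (hsub hq).self_of_nhds

/-- A holomorphic function on a connected open set that vanishes at its purely imaginary points is
zero, if there are such points. -/
lemma eqOn_zero_of_imagSpace {n : ℕ} {V : Set (Fin n → ℂ)} (hV : IsOpen V)
    (hVc : IsPreconnected V) {f : (Fin n → ℂ) → ℂ} (hf : DifferentiableOn ℂ f V)
    (hne : (V ∩ imagSpace n).Nonempty)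
    (h0 : ∀ p ∈ V, p ∈ imagSpace n → f p = 0) : ∀ q ∈ V, f q = 0 := by
  obtain ⟨p, hp, hpi⟩ := hne
  exact eqOn_zero_of_eventually_eq_zero hV hVc hf hp
    (eventually_eq_zero_of_imagSpace hV hf h0 hp hpi)

/-! ### The recursive wave function -/

/-- The product of the two Gamma factors attached to the difference `z` of a spectral parameter and
an integration variable. -/
def gammaPair (g : ℝ) (z : ℂ) : ℂ :=
  Complex.Gamma ((-z + g) / 2) * Complex.Gamma ((z + g) / 2)

/-- The kernel of the recursion. -/
def kern {M N : ℕ} (g : ℝ) (lam : Fin N → ℂ) (c : Fin M → ℂ) : ℂ :=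
  ∏ j, ∏ k, gammaPair g (lam k - c j)

/-- A product of reciprocal Gamma functions of the differences of the entries of a row. -/
def gammaDensity {N : ℕ} (α β : Fin N → Fin N → ℝ) (c : Fin N → ℂ) : ℂ :=
  ∏ r, ∏ s ∈ univ.erase r, (Complex.Gamma ((c r - c s) / 2 + α r s))⁻¹ *
    (Complex.Gamma ((c r - c s) / 2 + β r s))⁻¹

/-- The density of the spectral measure. -/
def density {N : ℕ} (g : ℝ) (c : Fin N → ℂ) : ℂ := gammaDensity (fun _ _ => 0) (fun _ _ => g) c

/-- The exponential factor of the recursion. -/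
def expFactor {M N : ℕ} (y : ℝ) (lam : Fin N → ℂ) (c : Fin M → ℂ) : ℂ :=
  Complex.exp ((∑ k, lam k - ∑ j, c j) * y)

/-- The wave function up to the elementary factor, defined by integrating out one row at a time. -/
def wave (g : ℝ) (X : ℕ → ℝ) : ∀ N : ℕ, (Fin N → ℂ) → ℂ
  | 0, _ => 1
  | N + 1, lam => ∫ t : Fin N → ℝ,
      kern g lam (imRow t) * density g (imRow t) * expFactor (X N) lam (imRow t) *
        wave g X N (imRow t)

lemma wave_zero (g : ℝ) (X : ℕ → ℝ) : wave g X 0 = fun _ => 1 := by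
  ext; rw [wave]

lemma wave_succ (g : ℝ) (X : ℕ → ℝ) (N : ℕ) : wave g X (N + 1) = fun lam => ∫ t : Fin N → ℝ,
    kern g lam (imRow t) * density g (imRow t) * expFactor (X N) lam (imRow t) *
      wave g X N (imRow t) := by
  ext; rw [wave]

/-! #### Bounds -/

/-- Each Gamma factor has half the imaginary part and hence decays at rate π/4; a < g keeps both
arguments in the right half-plane. -/
lemma expPolyBound_gammaPair {g a : ℝ} (ha : a < g) :
    ExpPolyBound {z : ℂ | |z.re| ≤ a} (fun z => |z.im|) (fun z => -(Real.pi / 2) * |z.im|)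
      (gammaPair g) := by
  have hG := expPolyBound_Gamma (δ := (g - a) / 2) (R := (g + a) / 2) (by linarith)
  have hmap : ∀ σ : ℝ, |σ| = 1 → ExpPolyBound {z : ℂ | |z.re| ≤ a} (fun z => |z.im|)
      (fun z => -(Real.pi / 4) * |z.im|) (fun z => Complex.Gamma ((σ * z + g) / 2)) := by
    intro σ hσ
    have hre : ∀ z : ℂ, ((σ * z + g) / 2).re = (σ * z.re + g) / 2 := fun z => by simp
    have him : ∀ z : ℂ, |((σ * z + g) / 2).im| = |z.im| / 2 := fun z => by
      simp [abs_div, abs_mul, hσ]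
    refine hG.comp (fun z : ℂ => (σ * z + g) / 2) 1 (fun _ => abs_nonneg _) (fun _ => abs_nonneg _)
      (fun z hz => ?_) (fun z _ => ?_) (fun z _ => ?_)
    · have h1 : |σ * z.re| ≤ a := by rw [abs_mul, hσ, one_mul]; exact hz
      have := abs_le.1 h1
      simp only [Set.mem_ofPred_eq, hre]
      constructor <;> linarith
    · rw [him]; linarith [abs_nonneg z.im]
    · rw [him]; linarith
  have h := (hmap (-1) (by simp)).mul (fun _ => abs_nonneg _) (hmap 1 (by simp))
  refine ExpPolyBound.mono (w := fun z => -(Real.pi / 4) * |z.im| + -(Real.pi / 4) * |z.im|) ?_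
    (fun _ => abs_nonneg _) subset_rfl (fun z _ => by linarith)
  have e : gammaPair g = fun z => Complex.Gamma ((-z + g) / 2) * Complex.Gamma ((z + g) / 2) := rfl
  rw [e]
  simpa using h

lemma expPolyBound_inv_Gamma_sub {N : ℕ} (a α : ℝ) (r s : Fin N) :
    ExpPolyBound {c : Fin N → ℂ | ∀ j, |(c j).re| ≤ a} (fun c => ‖imVec c‖)
      (fun c => Real.pi / 4 * |imVec c r - imVec c s|)
      (fun c => (Complex.Gamma ((c r - c s) / 2 + α))⁻¹) := by
  refine (expPolyBound_inv_Gamma (a + |α|)).comp (fun c : Fin N → ℂ => (c r - c s) / 2 + α) 1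
    (fun _ => abs_nonneg _) (fun _ => norm_nonneg _) (fun c hc => ?_) (fun c _ => ?_) (fun c _ => ?_)
  · have h1 := abs_le.1 (hc r)
    have h2 := abs_le.1 (hc s)
    have h3 := neg_abs_le α
    have h4 := le_abs_self α
    simp only [Set.mem_ofPred_eq]
    simp [abs_le]
    constructor <;> linarith
  · have h1 := norm_le_pi_norm (imVec c) r
    have h2 := norm_le_pi_norm (imVec c) s
    have h3 := abs_sub (c r).im (c s).im
    simp only [imVec, Real.norm_eq_abs] at h1 h2
    have e : |((c r - c s) / 2 + α).im| = |(c r).im - (c s).im| / 2 := by simp [abs_div]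
    rw [e]
    linarith
  · have e : |((c r - c s) / 2 + α).im| = |(c r).im - (c s).im| / 2 := by simp [abs_div]
    rw [e]
    simp only [imVec]
    linarith

lemma expPolyBound_gammaDensity {N : ℕ} (a : ℝ) (α β : Fin N → Fin N → ℝ) :
    ExpPolyBound {c : Fin N → ℂ | ∀ j, |(c j).re| ≤ a} (fun c => ‖imVec c‖)
      (fun c => Real.pi / 2 * pairDist (imVec c)) (gammaDensity α β) := by
  have h := ExpPolyBound.prod (s := {c : Fin N → ℂ | ∀ j, |(c j).re| ≤ a})
    (ρ := fun c => ‖imVec c‖) (fun _ => norm_nonneg _) univ fun r _ =>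
    ExpPolyBound.prod (fun _ => norm_nonneg _) (univ.erase r) fun s _ =>
      (expPolyBound_inv_Gamma_sub a (α r s) r s).mul (fun _ => norm_nonneg _)
        (expPolyBound_inv_Gamma_sub a (β r s) r s)
  refine h.mono (fun _ => norm_nonneg _) subset_rfl fun c _ => ?_
  rw [pairDist, Finset.mul_sum]
  refine Finset.sum_le_sum fun r _ => ?_
  rw [Finset.mul_sum]
  refine (Finset.sum_le_univ_sum_of_nonneg fun s => by positivity).trans (le_of_eq ?_)
  exact Finset.sum_congr rfl fun s _ => by ring

lemma expPolyBound_kern {M N : ℕ} {g a : ℝ} (ha : a < g) :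
    ExpPolyBound {p : (Fin N → ℂ) × (Fin M → ℂ) | ∀ j k, |(p.1 k - p.2 j).re| ≤ a}
      (fun p => ‖imVec p.1‖ + ‖imVec p.2‖)
      (fun p => -(Real.pi / 2) * crossDist (imVec p.2) (imVec p.1))
      (fun p => kern g p.1 p.2) := by
  have hρ : ∀ p : (Fin N → ℂ) × (Fin M → ℂ), 0 ≤ ‖imVec p.1‖ + ‖imVec p.2‖ :=
    fun _ => by positivity
  have h := ExpPolyBound.prod (s := {p : (Fin N → ℂ) × (Fin M → ℂ) | ∀ j k,
      |(p.1 k - p.2 j).re| ≤ a}) hρ univ fun j _ => ExpPolyBound.prod hρ univ fun k _ =>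
      (expPolyBound_gammaPair ha).comp
        (ρ' := fun p : (Fin N → ℂ) × (Fin M → ℂ) => ‖imVec p.1‖ + ‖imVec p.2‖)
        (w' := fun p => -(Real.pi / 2) * |imVec p.2 j - imVec p.1 k|)
        (s' := {p : (Fin N → ℂ) × (Fin M → ℂ) | ∀ j k, |(p.1 k - p.2 j).re| ≤ a})
        (fun p : (Fin N → ℂ) × (Fin M → ℂ) => p.1 k - p.2 j) 1 (fun _ => abs_nonneg _) hρ
        (fun p hp => hp j k)
        (fun p _ => by
          have h1 := norm_le_pi_norm (imVec p.1) k
          have h2 := norm_le_pi_norm (imVec p.2) j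
          have h3 := abs_sub (p.1 k).im (p.2 j).im
          simp only [imVec, Real.norm_eq_abs] at h1 h2
          simp only [Complex.sub_im]
          linarith)
        (fun p _ => by rw [abs_sub_comm (imVec p.2 j)]; simp [imVec])
  refine h.mono hρ subset_rfl fun c _ => le_of_eq ?_
  simp only [crossDist, Finset.mul_sum]

lemma norm_expFactor_le {M N : ℕ} {a : ℝ} (y : ℝ) {lam : Fin N → ℂ} {c : Fin M → ℂ}
    (hl : ∀ k, |(lam k).re| ≤ a) (hc : ∀ j, |(c j).re| ≤ a) :
    ‖expFactor y lam c‖ ≤ Real.exp ((N * a + M * a) * |y|) := by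
  rw [expFactor, Complex.norm_exp, Real.exp_le_exp]
  simp only [Complex.mul_re, Complex.ofReal_re, Complex.ofReal_im, mul_zero, sub_zero,
    Complex.sub_re, Complex.re_sum]
  refine (le_abs_self _).trans ?_
  rw [abs_mul]
  gcongr
  refine (abs_sub _ _).trans ?_
  gcongr
  · refine (Finset.abs_sum_le_sum_abs _ _).trans ((Finset.sum_le_sum fun k _ => hl k).trans ?_)
    simp
  · refine (Finset.abs_sum_le_sum_abs _ _).trans ((Finset.sum_le_sum fun k _ => hc k).trans ?_)
    simp

/-- Domination of the integrand of the recursion. The row `c'` in the kernel may differ from `c`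
by a real translation. -/
lemma exists_bound_integrand {N : ℕ} {g a b : ℝ} (ha : a < g) (y : ℝ)
    (α β : Fin N → Fin N → ℝ) {Q : (Fin N → ℂ) → ℂ}
    (hQ : ExpPolyBound {c : Fin N → ℂ | ∀ j, |(c j).re| ≤ b} (fun c => ‖imVec c‖)
      (fun c => -(Real.pi / 4) * pairDist (imVec c)) Q) :
    ∃ (C : ℝ) (M : ℕ), 0 ≤ C ∧ ∀ (lam : Fin (N + 1) → ℂ) (c c' : Fin N → ℂ),
      (∀ k, |(lam k).re| ≤ b) → (∀ j, |(c j).re| ≤ b) → (∀ j k, |(lam k - c' j).re| ≤ a) →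
      imVec c' = imVec c →
      ‖kern g lam c' * gammaDensity α β c * expFactor y lam c * Q c‖ ≤
        C * (1 + ‖imVec lam‖) ^ M * Real.exp (-(Real.pi / 4) * pairDist (imVec lam)) *
          ((1 + ‖imVec c‖) ^ (N + 1))⁻¹ := by
  obtain ⟨C₁, M₁, hC₁, h₁⟩ := expPolyBound_kern (M := N) (N := N + 1) ha
  obtain ⟨C₂, M₂, hC₂, h₂⟩ := (expPolyBound_gammaDensity b α β).mul (fun _ => norm_nonneg _) hQ
  obtain ⟨C₃, M₃, hC₃, h₃⟩ := exists_energy_bound N (M₁ + M₂)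
  refine ⟨C₁ * C₂ * Real.exp ((((N + 1 : ℕ) : ℝ) * b + N * b) * |y|) * C₃, M₃, by positivity,
    fun lam c c' hl hc hlc hcc => ?_⟩
  have k1 := h₁ (lam, c') hlc
  have k2 := h₂ c hc
  have k3 := norm_expFactor_le y hl hc
  have k4 := h₃ (imVec lam) (imVec c)
  simp only [hcc] at k1
  have e1 : (1 + ‖imVec c‖) ^ M₂ ≤ (1 + (‖imVec lam‖ + ‖imVec c‖)) ^ M₂ := by
    gcongr
    linarith [norm_nonneg (imVec lam)]
  calc _ = ‖kern g lam c'‖ * ‖gammaDensity α β c * Q c‖ * ‖expFactor y lam c‖ := by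
        simp only [norm_mul]; ring
    _ ≤ (C₁ * (1 + (‖imVec lam‖ + ‖imVec c‖)) ^ M₁ *
          Real.exp (-(Real.pi / 2) * crossDist (imVec c) (imVec lam))) *
        (C₂ * (1 + (‖imVec lam‖ + ‖imVec c‖)) ^ M₂ *
          Real.exp (Real.pi / 2 * pairDist (imVec c) + -(Real.pi / 4) * pairDist (imVec c))) *
        Real.exp ((((N + 1 : ℕ) : ℝ) * b + N * b) * |y|) := by
        gcongr
        refine k2.trans ?_
        gcongr
    _ = C₁ * C₂ * Real.exp ((((N + 1 : ℕ) : ℝ) * b + N * b) * |y|) *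
        ((1 + (‖imVec lam‖ + ‖imVec c‖)) ^ (M₁ + M₂) *
        Real.exp (-(Real.pi / 2) * crossDist (imVec c) (imVec lam) +
          Real.pi / 4 * pairDist (imVec c))) := by
        have e : Real.exp (-(Real.pi / 2) * crossDist (imVec c) (imVec lam) +
            Real.pi / 4 * pairDist (imVec c)) =
            Real.exp (-(Real.pi / 2) * crossDist (imVec c) (imVec lam)) * Real.exp
            (Real.pi / 2 * pairDist (imVec c) + -(Real.pi / 4) * pairDist (imVec c)) := by
          rw [← Real.exp_add]; congr 1; ring
        rw [e, pow_add]
        ring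
    _ ≤ C₁ * C₂ * Real.exp ((((N + 1 : ℕ) : ℝ) * b + N * b) * |y|) *
        (C₃ * (1 + ‖imVec lam‖) ^ M₃ * Real.exp (-(Real.pi / 4) * pairDist (imVec lam)) *
          ((1 + ‖imVec c‖) ^ (N + 1))⁻¹) := by gcongr
    _ = _ := by ring

/-- The rate -π/4 is the one that `exists_energy_bound` carries from a row to the next. -/
lemma expPolyBound_wave {g : ℝ} (X : ℕ → ℝ) (N : ℕ) : ∀ a < g,
    ExpPolyBound {c : Fin N → ℂ | ∀ j, |(c j).re| ≤ a} (fun c => ‖imVec c‖)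
      (fun c => -(Real.pi / 4) * pairDist (imVec c)) (wave g X N) := by
  induction N with
  | zero =>
    intro a _
    exact ⟨1, 0, zero_le_one, fun c _ => by simp [wave, pairDist]⟩
  | succ N ih =>
    intro a ha
    rcases lt_or_ge a 0 with h0 | h0
    -- For negative a the set is empty, since the row has at least one entry.
    · exact ⟨0, 0, le_rfl, fun c hc => absurd (hc 0) (by
        have := abs_nonneg (c 0).re
        linarith)⟩
    obtain ⟨C, M, hC, h⟩ := exists_bound_integrand ha (X N) (fun _ _ => 0) (fun _ _ => g)
      (ih a ha)
    refine ⟨C * ∫ t : Fin N → ℝ, ((1 + ‖t‖) ^ (N + 1))⁻¹, M,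
      mul_nonneg hC (integral_nonneg fun t => by positivity), fun lam hl => ?_⟩
    rw [wave]
    refine (norm_integral_le_of_norm_le ((integrable_inv_one_add_norm_pow N).const_mul
      (C * (1 + ‖imVec lam‖) ^ M * Real.exp (-(Real.pi / 4) * pairDist (imVec lam))))
      (Eventually.of_forall fun t => ?_)).trans (le_of_eq ?_)
    · have := h lam (imRow t) (imRow t) hl (fun j => by simpa using h0)
        (fun j k => by simpa using hl k) rfl
      rwa [imVec_imRow] at this
    · rw [integral_const_mul]; ring

/-! #### Holomorphy -/

lemma differentiableAt_gammaPair {g : ℝ} {z : ℂ} (hz : |z.re| < g) :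
    DifferentiableAt ℂ (gammaPair g) z := by
  have h := abs_lt.1 hz
  have hG : ∀ u : ℂ, 0 < u.re → DifferentiableAt ℂ Complex.Gamma u := fun u hu =>
    Complex.differentiableAt_Gamma u fun m hm => by
      have h1 := congrArg Complex.re hm
      simp at h1
      have h2 : (0 : ℝ) ≤ m := by positivity
      linarith
  unfold gammaPair
  refine DifferentiableAt.mul ?_ ?_
  · exact (hG _ (by simp; linarith)).comp z (f := fun z : ℂ => (-z + g) / 2) (by fun_prop)
  · exact (hG _ (by simp; linarith)).comp z (f := fun z : ℂ => (z + g) / 2) (by fun_prop)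

lemma differentiableAt_prod {E ι : Type*} [NormedAddCommGroup E] [NormedSpace ℂ E] (s : Finset ι)
    {f : ι → E → ℂ} {p : E} (h : ∀ i ∈ s, DifferentiableAt ℂ (f i) p) :
    DifferentiableAt ℂ (fun p => ∏ i ∈ s, f i p) p := by
  classical
  exact (HasFDerivAt.finsetProd fun i hi => (h i hi).hasFDerivAt).differentiableAt

lemma differentiableAt_kern {E : Type*} [NormedAddCommGroup E] [NormedSpace ℂ E] {M N : ℕ} {g : ℝ}
    {lam : E → Fin N → ℂ} {c : E → Fin M → ℂ} {p : E} (hl : DifferentiableAt ℂ lam p)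
    (hc : DifferentiableAt ℂ c p) (h : ∀ j k, |(lam p k - c p j).re| < g) :
    DifferentiableAt ℂ (fun p => kern g (lam p) (c p)) p := by
  unfold kern
  refine differentiableAt_prod _ fun j _ => differentiableAt_prod _ fun k _ => ?_
  exact (differentiableAt_gammaPair (h j k)).comp p (f := fun p => lam p k - c p j)
    ((differentiableAt_pi.1 hl k).sub (differentiableAt_pi.1 hc j))

lemma differentiable_gammaDensity {N : ℕ} (α β : Fin N → Fin N → ℝ) :
    Differentiable ℂ (gammaDensity α β) := by
  intro c
  unfold gammaDensity
  refine differentiableAt_prod _ fun r _ => differentiableAt_prod _ fun s _ => ?_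
  have : ∀ a : ℝ, DifferentiableAt ℂ
      (fun c : Fin N → ℂ => (Complex.Gamma ((c r - c s) / 2 + a))⁻¹) c := fun a =>
    (Complex.differentiable_one_div_Gamma _).comp c (f := fun c : Fin N → ℂ => (c r - c s) / 2 + a)
      (by fun_prop)
  exact (this _).mul (this _)

lemma isOpen_abs_re_lt (N : ℕ) (g : ℝ) : IsOpen {c : Fin N → ℂ | ∀ j, |(c j).re| < g} := by
  rw [Set.ofPred_forall]
  exact isOpen_iInter_of_finite fun j =>
    isOpen_lt ((Complex.continuous_re.comp (continuous_apply j)).abs) continuous_const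

/-- The parameters occur only in `kern` and `expFactor`; against imaginary integration variables the
first poles of `kern` lie at |Re λ_k| = g. -/
lemma differentiableOn_wave {g : ℝ} (hg : 0 < g) (X : ℕ → ℝ) (N : ℕ) :
    DifferentiableOn ℂ (wave g X N) {c | ∀ j, |(c j).re| < g} := by
  induction N with
  | zero =>
    intro c _
    rw [wave_zero]
    fun_prop
  | succ N ih =>
    have hW : Continuous fun t : Fin N → ℝ => wave g X N (imRow t) :=
      ih.continuousOn.comp_continuous continuous_imRow fun t j => by simpa using hg
    have hdens : Continuous fun t : Fin N → ℝ => density g (imRow t) :=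
      (differentiable_gammaDensity _ _).continuous.comp continuous_imRow
    rw [wave_succ]
    refine differentiableOn_integral_of_dominated (isOpen_abs_re_lt (N + 1) g) (fun lam hl => ?_)
      (fun t lam hl => ?_) fun lam hl => ?_
    · refine Continuous.aestronglyMeasurable ?_
      refine ((Continuous.mul ?_ hdens).mul ?_).mul hW
      · refine continuous_iff_continuousAt.2 fun t => ?_
        exact ContinuousAt.comp (f := imRow) (g := fun c : Fin N → ℂ => kern g lam c)
          (differentiableAt_kern (by fun_prop) (by fun_prop)
            (fun j k => by simpa using hl k)).continuousAt continuous_imRow.continuousAt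
      · unfold expFactor
        have := continuous_imRow (N := N)
        fun_prop
    · refine DifferentiableAt.differentiableWithinAt ?_
      refine ((DifferentiableAt.mul ?_ (differentiableAt_const _)).mul ?_).mul
        (differentiableAt_const _)
      · exact differentiableAt_kern (by fun_prop) (by fun_prop) fun j k => by simpa using hl k
      · unfold expFactor; fun_prop
    · obtain ⟨a, ha, hla⟩ : ∃ a < g, ∀ k, |(lam k).re| < a := by
        have hfin : ∀ k, ∃ a < g, |(lam k).re| < a := fun k =>
          ⟨(|(lam k).re| + g) / 2, by linarith [hl k], by linarith [hl k]⟩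
        choose A hA hA' using hfin
        refine ⟨univ.sup' ⟨0, mem_univ _⟩ A, ?_, fun k => (hA' k).trans_le ?_⟩
        · exact (Finset.sup'_lt_iff _).2 fun k _ => hA k
        · exact Finset.le_sup' A (mem_univ k)
      obtain ⟨C, M, hC, h⟩ := exists_bound_integrand ha (X N) (fun _ _ => 0) (fun _ _ => g)
        (expPolyBound_wave X N a ha)
      obtain ⟨r, hr, hrb⟩ := Metric.isOpen_iff.1 (isOpen_abs_re_lt (N + 1) a) lam hla
      have ha0 : 0 < a := (abs_nonneg _).trans_lt (hla 0)
      refine ⟨min r 1, lt_min hr one_pos, fun t => C * (1 + (‖imVec lam‖ + 1)) ^ M *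
        ((1 + ‖t‖) ^ (N + 1))⁻¹, (integrable_inv_one_add_norm_pow N).const_mul _,
        fun q hq _ t => ?_⟩
      have hqa : ∀ k, |(q k).re| < a := hrb (Metric.ball_subset_ball (min_le_left _ _) hq)
      have := h q (imRow t) (imRow t) (fun k => (hqa k).le) (fun j => by simpa using ha0.le)
        (fun j k => by simpa using (hqa k).le) rfl
      refine this.trans ?_
      rw [imVec_imRow]
      have hq1 : ‖imVec q‖ ≤ ‖imVec lam‖ + 1 := by
        refine (pi_norm_le_iff_of_nonneg (by positivity)).2 fun k => ?_
        have h1 : ‖q k - lam k‖ ≤ 1 := by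
          rw [← dist_eq_norm]
          exact (dist_le_pi_dist q lam k).trans (hq.le.trans (min_le_right _ _))
        have h2 := (Complex.abs_im_le_norm _).trans h1
        have h3 := norm_le_pi_norm (imVec lam) k
        have h4 := abs_sub_abs_le_abs_sub (q k).im (lam k).im
        rw [Complex.sub_im] at h2
        simp only [imVec, Real.norm_eq_abs] at h3 ⊢
        linarith
      have hexp : Real.exp (-(Real.pi / 4) * pairDist (imVec q)) ≤ 1 := by
        rw [Real.exp_le_one_iff]
        have : 0 ≤ pairDist (imVec q) :=
          Finset.sum_nonneg fun i _ => Finset.sum_nonneg fun j _ => abs_nonneg _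
        have := Real.pi_pos
        nlinarith
      calc _ ≤ C * (1 + (‖imVec lam‖ + 1)) ^ M * 1 * ((1 + ‖t‖) ^ (N + 1))⁻¹ := by gcongr
        _ = _ := by ring

/-! #### Covariance under translations -/

lemma gammaDensity_add_const {N : ℕ} (α β : Fin N → Fin N → ℝ) (c : Fin N → ℂ) (u : ℂ) :
    gammaDensity α β (fun j => c j + u) = gammaDensity α β c := by
  simp [gammaDensity]

lemma kern_add_const {M N : ℕ} (g : ℝ) (lam : Fin N → ℂ) (c : Fin M → ℂ) (u : ℂ) :
    kern g (fun k => lam k + u) (fun j => c j + u) = kern g lam c := by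
  simp [kern]

/-- Translate all integration variables along with the parameters: `kern` and `density` depend on
differences only, so the exponentials alone change. -/
lemma wave_add_imag (g : ℝ) (X : ℕ → ℝ) (σ : ℝ) (N : ℕ) : ∀ lam : Fin N → ℂ,
    wave g X N (fun k => lam k + Complex.I * σ) =
      Complex.exp (Complex.I * σ * ∑ i ∈ range N, (X i : ℂ)) * wave g X N lam := by
  induction N with
  | zero => intro lam; simp [wave]
  | succ N ih =>
    intro lam
    rw [wave, wave, ← integral_add_right_eq_self _ (fun _ : Fin N => σ), ← integral_const_mul]
    congr 1
    ext t
    have e : imRow (t + fun _ => σ) = fun j => imRow t j + Complex.I * σ := by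
      ext j
      simp [imRow, mul_add]
    have e2 : expFactor (X N) (fun k => lam k + Complex.I * σ)
        (fun j => imRow t j + Complex.I * σ) =
        Complex.exp (Complex.I * σ * X N) * expFactor (X N) lam (imRow t) := by
      rw [expFactor, expFactor, ← Complex.exp_add]
      congr 1
      simp only [Finset.sum_add_distrib, Finset.sum_const, Finset.card_univ, Fintype.card_fin,
        nsmul_eq_mul]
      push_cast
      ring
    rw [e, kern_add_const, density, gammaDensity_add_const, ← density, e2, ih,
      Finset.sum_range_succ, mul_add, Complex.exp_add]
    ring

/-- Compensated by the exponential, `wave` is holomorphic in a common complex translation s and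
invariant under imaginary changes of s, hence constant on the convex set of admissible s. -/
lemma wave_add_real {g : ℝ} (hg : 0 < g) (X : ℕ → ℝ) {N : ℕ} {lam : Fin N → ℂ} {u : ℝ}
    (h0 : ∀ k, |(lam k).re| < g) (h1 : ∀ k, |(lam k + u).re| < g) :
    wave g X N (fun k => lam k + u) =
      Complex.exp (u * ∑ i ∈ range N, (X i : ℂ)) * wave g X N lam := by
  set S : Set ℂ := {s | ∀ k, |(lam k + s).re| < g} with hS
  have hSeq : S = ⋂ k, ({s : ℂ | s.re < g - (lam k).re} ∩ {s : ℂ | -g - (lam k).re < s.re}) := by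
    ext s
    simp only [hS, Set.mem_ofPred_eq, Set.mem_iInter, Set.mem_inter_iff, Complex.add_re, abs_lt]
    refine forall_congr' fun k => ⟨fun h => ⟨by linarith [h.2], by linarith [h.1]⟩,
      fun h => ⟨by linarith [h.2], by linarith [h.1]⟩⟩
  have hopen : IsOpen S := by
    rw [hSeq]
    exact isOpen_iInter_of_finite fun k =>
      (isOpen_lt Complex.continuous_re continuous_const).inter
        (isOpen_lt continuous_const Complex.continuous_re)
  have hconv : Convex ℝ S := by
    rw [hSeq]
    exact convex_iInter fun k => (convex_halfSpace_re_lt _).inter (convex_halfSpace_re_gt _)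
  have hf : DifferentiableOn ℂ (fun s : ℂ => Complex.exp (-(s * ∑ i ∈ range N, (X i : ℂ))) *
      wave g X N (fun k => lam k + s)) S := by
    refine DifferentiableOn.mul (by fun_prop) ?_
    exact (differentiableOn_wave hg X N).comp (f := fun (s : ℂ) (k : Fin N) => lam k + s)
      (by fun_prop) fun s hs => hs
  have := eq_of_imag_periodic hopen hconv.isPreconnected hf (fun s σ => ?_) (c := u) (c' := 0) h1
    (fun k => by simpa using h0 k)
  · simp only [zero_mul, neg_zero, Complex.exp_zero, one_mul, add_zero] at this
    rw [← this, ← mul_assoc, ← Complex.exp_add]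
    simp
  · have e : (fun k => lam k + (s + Complex.I * σ)) = fun k => (lam k + s) + Complex.I * σ := by
      ext k; ring
    rw [e, wave_add_imag, ← mul_assoc, ← Complex.exp_add]
    congr 2
    ring

/-! ### The difference equations for purely imaginary parameters -/

/-- The vector with entries `1` on `I` and `-1` off `I`. -/
def signVec {N : ℕ} (I : Finset (Fin N)) : Fin N → ℝ := fun i => if i ∈ I then 1 else -1

lemma abs_signVec {N : ℕ} (I : Finset (Fin N)) (i : Fin N) : |signVec I i| = 1 := by
  unfold signVec; split_ifs <;> simp

lemma sum_signVec {N : ℕ} (I : Finset (Fin N)) :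
    ∑ i, (signVec I i : ℂ) = 2 * (I.card : ℂ) - N := by
  have : ∀ i, (signVec I i : ℂ) = 2 * (if i ∈ I then 1 else 0) - 1 := fun i => by
    unfold signVec; split_ifs <;> norm_num
  simp only [this, Finset.sum_sub_distrib, ← Finset.mul_sum]
  simp

lemma prod_ite_sdiff {ι : Type*} [Fintype ι] [DecidableEq ι] (I : Finset ι) (f h : ι → ℂ) :
    ∏ i, (if i ∈ I then f i else h i) = (∏ i ∈ I, f i) * ∏ i ∈ univ \ I, h i := by
  rw [← prod_mul_prod_sdiff (Finset.subset_univ I)]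
  congr 1
  · exact Finset.prod_congr rfl fun i hi => if_pos hi
  · exact Finset.prod_congr rfl fun i hi => if_neg (Finset.mem_sdiff.1 hi).2

/-- The common factor of the values of `gammaPair` at `z + 1` and `z - 1`. -/
def gammaPairBase (g : ℝ) (z : ℂ) : ℂ :=
  Complex.Gamma ((-z - 1 + g) / 2) * Complex.Gamma ((z - 1 + g) / 2) / 2

/-- With symmetric shifts by ±1, both shifted values share a Gamma product and differ by a linear
factor. Hence the action of the operators on the kernel becomes an algebraic identity with η = g -
1. -/
lemma gammaPair_add_one {g : ℝ} (hg : 1 < g) {z : ℂ} (hz : z.re = 0) :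
    gammaPair g (z + 1) = gammaPairBase g z * (z + (g - 1 : ℝ)) := by
  have h : (z - 1 + g) / 2 ≠ 0 := fun h => by
    have := congrArg Complex.re h
    simp [hz] at this
    linarith
  rw [gammaPair, gammaPairBase, show (z + 1 + g) / 2 = (z - 1 + g) / 2 + 1 by ring,
    Complex.Gamma_add_one _ h, show -(z + 1) + (g : ℂ) = -z - 1 + g by ring]
  push_cast
  ring

lemma gammaPair_sub_one {g : ℝ} (hg : 1 < g) {z : ℂ} (hz : z.re = 0) :
    gammaPair g (z - 1) = gammaPairBase g z * ((g - 1 : ℝ) - z) := by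
  have h1 := gammaPair_add_one hg (z := -z) (by simp [hz])
  have h2 : gammaPair g (z - 1) = gammaPair g (-z + 1) := by
    rw [gammaPair, gammaPair, mul_comm, show -(z - 1) + (g : ℂ) = -z + 1 + g by ring,
      show -(-z + 1) + (g : ℂ) = z - 1 + g by ring]
  rw [h2, h1, gammaPairBase, gammaPairBase, neg_neg]
  ring

section

variable {N : ℕ} {g : ℝ}

lemma kern_add_signVec {M : ℕ} (hg : 1 < g) {lam : Fin N → ℂ} {c : Fin M → ℂ}
    (hl : ∀ k, (lam k).re = 0) (hc : ∀ j, (c j).re = 0) (I : Finset (Fin N)) :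
    kern g (fun k => lam k + signVec I k) c = (∏ k, ∏ j, gammaPairBase g (lam k - c j)) *
      ((∏ k ∈ I, ∏ j, (lam k - c j + (g - 1 : ℝ))) *
        ∏ k ∈ univ \ I, ∏ j, ((g - 1 : ℝ) - lam k + c j)) := by
  rw [kern, Finset.prod_comm, ← prod_ite_sdiff, ← Finset.prod_mul_distrib]
  refine Finset.prod_congr rfl fun k _ => ?_
  have hre : ∀ j, (lam k - c j).re = 0 := fun j => by simp [hl, hc]
  split_ifs with hk
  · rw [← Finset.prod_mul_distrib]
    refine Finset.prod_congr rfl fun j _ => ?_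
    rw [← gammaPair_add_one hg (hre j), signVec, if_pos hk]
    congr 1
    push_cast; ring
  · rw [← Finset.prod_mul_distrib]
    refine Finset.prod_congr rfl fun j _ => ?_
    rw [sub_add, ← gammaPair_sub_one hg (hre j), signVec, if_neg hk]
    congr 1
    push_cast; ring

lemma kern_sub_signVec {M : ℕ} (hg : 1 < g) {lam : Fin N → ℂ} {c : Fin M → ℂ}
    (hl : ∀ k, (lam k).re = 0) (hc : ∀ j, (c j).re = 0) (J : Finset (Fin M)) :
    kern g lam (fun j => c j - signVec J j) = (∏ k, ∏ j, gammaPairBase g (lam k - c j)) *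
      ((∏ j ∈ J, ∏ k, (lam k - c j + (g - 1 : ℝ))) *
        ∏ j ∈ univ \ J, ∏ k, ((g - 1 : ℝ) - lam k + c j)) := by
  rw [kern, Finset.prod_comm (f := fun k j => gammaPairBase g (lam k - c j)), ← prod_ite_sdiff,
    ← Finset.prod_mul_distrib]
  refine Finset.prod_congr rfl fun j _ => ?_
  have hre : ∀ k, (lam k - c j).re = 0 := fun k => by simp [hl, hc]
  split_ifs with hj
  · rw [← Finset.prod_mul_distrib]
    refine Finset.prod_congr rfl fun k _ => ?_
    rw [← gammaPair_add_one hg (hre k), signVec, if_pos hj]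
    congr 1
    push_cast; ring
  · rw [← Finset.prod_mul_distrib]
    refine Finset.prod_congr rfl fun k _ => ?_
    rw [sub_add, ← gammaPair_sub_one hg (hre k), signVec, if_neg hj]
    congr 1
    push_cast; ring

/-- The kernel identity in Gamma form: shifts of the outer parameters are traded for opposite shifts
of the integration variables. With w the indicator of r, the right-hand weight selects |J| = r and
|J| = r - 1. -/
lemma sum_shiftCoef_mul_kern (hg : 1 < g) {lam : Fin (N + 1) → ℂ} {c : Fin N → ℂ}
    (hl : ∀ k, (lam k).re = 0) (hc : ∀ j, (c j).re = 0) (hli : Function.Injective lam)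
    (hci : Function.Injective c) (w : ℕ → ℂ) :
    ∑ I ∈ (univ : Finset (Fin (N + 1))).powerset, w I.card *
        (shiftCoef (g - 1 : ℝ) lam univ I * kern g (fun k => lam k + signVec I k) c) =
      ∑ J ∈ (univ : Finset (Fin N)).powerset, (w J.card + w (J.card + 1)) *
        (shiftCoef (g - 1 : ℝ) (-c) univ J * kern g lam (fun j => c j - signVec J j)) := by
  have h := kernel_identity lam c (η := g - 1) (by linarith) univ (fun l _ => hc l) hci.injOn univ
    (by simp) (fun i _ => hl i) hli.injOn w
  have h' := congrArg ((∏ k, ∏ j, gammaPairBase g (lam k - c j)) * ·) h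
  simp only [Finset.mul_sum] at h'
  convert h' using 1
  · refine Finset.sum_congr rfl fun I _ => ?_
    rw [kern_add_signVec hg hl hc, kernelTerm]
    ring
  · refine Finset.sum_congr rfl fun J _ => ?_
    rw [kern_sub_signVec hg hl hc, kernelTerm]
    have e1 : ∀ l k, (-c) l - (-lam) k + ((g - 1 : ℝ) : ℂ) = lam k - c l + (g - 1 : ℝ) :=
      fun l k => by simp; ring
    have e2 : ∀ l k, ((g - 1 : ℝ) : ℂ) - (-c) l + (-lam) k = (g - 1 : ℝ) - lam k + c l :=
      fun l k => by simp; ring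
    simp only [e1, e2]
    ring

lemma prod_offDiag_eq (J : Finset (Fin N)) (u : Fin N → Fin N → ℂ)
    (hu : ∀ r s, (r ∈ J ↔ s ∈ J) → u r s = 1) :
    ∏ r, ∏ s ∈ univ.erase r, u r s = ∏ r ∈ J, ∏ s ∈ univ \ J, u r s * u s r := by
  have h1 : ∀ r ∈ J, ∏ s ∈ univ.erase r, u r s = ∏ s ∈ univ \ J, u r s := fun r hr => by
    refine (Finset.prod_subset (fun s hs => ?_) fun s _ hs => ?_).symm
    · have := (Finset.mem_sdiff.1 hs).2
      exact Finset.mem_erase.2 ⟨fun h => this (h ▸ hr), mem_univ _⟩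
    · exact hu r s (by simpa [hr] using hs)
  have h2 : ∀ r ∈ univ \ J, ∏ s ∈ univ.erase r, u r s = ∏ s ∈ J, u r s := fun r hr => by
    have hr' := (Finset.mem_sdiff.1 hr).2
    refine (Finset.prod_subset (fun s hs => ?_) fun s _ hs => ?_).symm
    · exact Finset.mem_erase.2 ⟨fun h => hr' (h ▸ hs), mem_univ _⟩
    · exact hu r s (by simpa [hr'] using hs)
  rw [← prod_mul_prod_sdiff (Finset.subset_univ J), Finset.prod_congr rfl h1,
    Finset.prod_congr rfl h2, Finset.prod_comm (s := univ \ J)]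
  simp only [Finset.prod_mul_distrib]

/-- The first offsets of the density multiplied by the coefficient of a shift. -/
def offsetLeft (J : Finset (Fin N)) (r s : Fin N) : ℝ := if r ∉ J ∧ s ∈ J then 1 else 0

/-- The second offsets of the density multiplied by the coefficient of a shift. -/
def offsetRight (g : ℝ) (J : Finset (Fin N)) (r s : Fin N) : ℝ :=
  if r ∈ J ∧ s ∉ J then g - 1 else g

/-- The relation 1/Γ(d) = d/Γ(d + 1) absorbs the numerators and denominators of the coefficient into
the offsets. The product is thus entire, and no poles obstruct the translation of the contour. -/
lemma gammaDensity_offset {c : Fin N → ℂ} (hci : Function.Injective c) (J : Finset (Fin N)) :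
    gammaDensity (offsetLeft J) (offsetRight g J) c =
      density g c * shiftCoef (g - 1 : ℝ) (-c) univ J := by
  set u : Fin N → Fin N → ℂ := fun r s =>
    if r ∈ J ∧ s ∉ J then (c r - c s) / 2 + (g - 1 : ℝ) else
      if r ∉ J ∧ s ∈ J then ((c r - c s) / 2)⁻¹ else 1 with hu
  have hfac : ∀ r, ∀ s ∈ univ.erase r,
      (Complex.Gamma ((c r - c s) / 2 + offsetLeft J r s))⁻¹ *
        (Complex.Gamma ((c r - c s) / 2 + offsetRight g J r s))⁻¹ =
      ((Complex.Gamma ((c r - c s) / 2 + (0 : ℝ)))⁻¹ *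
        (Complex.Gamma ((c r - c s) / 2 + g))⁻¹) * u r s := by
    intro r s hs
    have hrs : (c r - c s) / 2 ≠ 0 :=
      div_ne_zero (sub_ne_zero.2 fun h => (Finset.mem_erase.1 hs).1 (hci h).symm) two_ne_zero
    by_cases h1 : r ∈ J <;> by_cases h2 : s ∈ J
    · simp [hu, offsetLeft, offsetRight, h1, h2]
    · simp only [hu, offsetLeft, offsetRight, h1, h2, not_true, not_false_eq_true, and_true,
        and_false, if_true, if_false]
      rw [Complex.one_div_Gamma_eq_self_mul_one_div_Gamma_add_one
        ((c r - c s) / 2 + ((g - 1 : ℝ) : ℂ))]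
      rw [show (c r - c s) / 2 + ((g - 1 : ℝ) : ℂ) + 1 = (c r - c s) / 2 + g by push_cast; ring]
      ring
    · simp only [hu, offsetLeft, offsetRight, h1, h2, not_true, not_false_eq_true, and_true,
        and_false, if_true, if_false]
      rw [Complex.ofReal_zero, add_zero, Complex.one_div_Gamma_eq_self_mul_one_div_Gamma_add_one
        ((c r - c s) / 2), Complex.ofReal_one]
      generalize (c r - c s) / 2 = d at hrs
      field_simp
    · simp [hu, offsetLeft, offsetRight, h1, h2]
  rw [gammaDensity, density, gammaDensity,
    Finset.prod_congr rfl fun r _ => Finset.prod_congr rfl (hfac r)]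
  simp only [Finset.prod_mul_distrib]
  congr 1
  rw [prod_offDiag_eq J u fun r s h => by simp only [hu]; simp [h], shiftCoef]
  refine Finset.prod_congr rfl fun r hr => Finset.prod_congr rfl fun s hs => ?_
  have hs' := (Finset.mem_sdiff.1 hs).2
  have hrs : c r - c s ≠ 0 := sub_ne_zero.2 fun h => hs' (hci h ▸ hr)
  have hrs' : c s - c r ≠ 0 := by rw [← neg_sub]; exact neg_ne_zero.2 hrs
  have hrs'' : -c r + c s ≠ 0 := by rwa [neg_add_eq_sub]
  simp only [hu, hr, hs', not_true, not_false_eq_true, and_true, and_false, if_true, if_false,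
    Pi.neg_apply, sub_neg_eq_add, neg_add_eq_sub]
  field_simp
  ring

/-- The same entire function, read on the translated contour, is the density times the coefficient
at c instead of -c. Together with `gammaDensity_offset` this expresses adjointness of the difference
operators with respect to the density. -/
lemma gammaDensity_offset_add {c : Fin N → ℂ} (hci : Function.Injective c) (J : Finset (Fin N)) :
    gammaDensity (offsetLeft J) (offsetRight g J) (fun j => c j + signVec J j) =
      density g c * shiftCoef (g - 1 : ℝ) c univ J := by
  set u : Fin N → Fin N → ℂ := fun r s =>
    if r ∈ J ∧ s ∉ J then ((c r - c s) / 2)⁻¹ else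
      if r ∉ J ∧ s ∈ J then (c r - c s) / 2 + (g - 1 : ℝ) else 1 with hu
  have hfac : ∀ r, ∀ s ∈ univ.erase r,
      (Complex.Gamma ((c r + signVec J r - (c s + signVec J s)) / 2 + offsetLeft J r s))⁻¹ *
        (Complex.Gamma ((c r + signVec J r - (c s + signVec J s)) / 2 + offsetRight g J r s))⁻¹ =
      ((Complex.Gamma ((c r - c s) / 2 + (0 : ℝ)))⁻¹ *
        (Complex.Gamma ((c r - c s) / 2 + g))⁻¹) * u r s := by
    intro r s hs
    have hrs : (c r - c s) / 2 ≠ 0 :=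
      div_ne_zero (sub_ne_zero.2 fun h => (Finset.mem_erase.1 hs).1 (hci h).symm) two_ne_zero
    by_cases h1 : r ∈ J <;> by_cases h2 : s ∈ J
    · simp [hu, offsetLeft, offsetRight, signVec, h1, h2]
    · simp only [hu, offsetLeft, offsetRight, signVec, h1, h2, not_true, not_false_eq_true,
        and_true, and_false, if_true, if_false]
      rw [Complex.ofReal_zero, add_zero, add_zero,
        Complex.one_div_Gamma_eq_self_mul_one_div_Gamma_add_one ((c r - c s) / 2),
        show (c r + ((1 : ℝ) : ℂ) - (c s + ((-1 : ℝ) : ℂ))) / 2 = (c r - c s) / 2 + 1 by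
          push_cast; ring,
        show (c r - c s) / 2 + 1 + ((g - 1 : ℝ) : ℂ) = (c r - c s) / 2 + g by push_cast; ring]
      generalize (c r - c s) / 2 = d at hrs
      field_simp
    · simp only [hu, offsetLeft, offsetRight, signVec, h1, h2, not_true, not_false_eq_true,
        and_true, and_false, if_true, if_false]
      rw [show (c r + ((-1 : ℝ) : ℂ) - (c s + ((1 : ℝ) : ℂ))) / 2 + ((1 : ℝ) : ℂ) =
          (c r - c s) / 2 + ((0 : ℝ) : ℂ) by push_cast; ring,
        show (c r + ((-1 : ℝ) : ℂ) - (c s + ((1 : ℝ) : ℂ))) / 2 + (g : ℂ) =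
          (c r - c s) / 2 + ((g - 1 : ℝ) : ℂ) by push_cast; ring,
        Complex.one_div_Gamma_eq_self_mul_one_div_Gamma_add_one
        ((c r - c s) / 2 + ((g - 1 : ℝ) : ℂ)),
        show (c r - c s) / 2 + ((g - 1 : ℝ) : ℂ) + 1 = (c r - c s) / 2 + g by push_cast; ring]
      ring
    · simp [hu, offsetLeft, offsetRight, signVec, h1, h2]
  rw [gammaDensity, density, gammaDensity,
    Finset.prod_congr rfl fun r _ => Finset.prod_congr rfl (hfac r)]
  simp only [Finset.prod_mul_distrib]
  congr 1
  rw [prod_offDiag_eq J u fun r s h => by simp only [hu]; simp [h], shiftCoef]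
  refine Finset.prod_congr rfl fun r hr => Finset.prod_congr rfl fun s hs => ?_
  have hs' := (Finset.mem_sdiff.1 hs).2
  have hrs : c r - c s ≠ 0 := sub_ne_zero.2 fun h => hs' (hci h ▸ hr)
  simp only [hu, hr, hs', not_true, not_false_eq_true, and_true, and_false, if_true, if_false]
  field_simp
  ring

/-- The integrand of the recursion with shifted kernel and a general density. -/
def shiftedIntegrand (g : ℝ) (X : ℕ → ℝ) (α β : Fin N → Fin N → ℝ) (ε : Fin N → ℝ)
    (lam : Fin (N + 1) → ℂ) (c : Fin N → ℂ) : ℂ :=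
  kern g lam (fun j => c j - ε j) * gammaDensity α β c * expFactor (X N) lam c * wave g X N c

lemma differentiableAt_shiftedIntegrand (hg : 0 < g) (X : ℕ → ℝ) (α β : Fin N → Fin N → ℝ)
    (ε : Fin N → ℝ) {lam : Fin (N + 1) → ℂ} {c : Fin N → ℂ} (hc : ∀ j, |(c j).re| < g)
    (h : ∀ j k, |(lam k - (c j - ε j)).re| < g) :
    DifferentiableAt ℂ (shiftedIntegrand g X α β ε lam) c := by
  have hW := (differentiableOn_wave hg X N).differentiableAt
    ((isOpen_abs_re_lt N g).mem_nhds hc)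
  have hK : DifferentiableAt ℂ (fun c : Fin N → ℂ => kern g lam (fun j => c j - ε j)) c :=
    differentiableAt_kern (by fun_prop) (by fun_prop) h
  have hE : DifferentiableAt ℂ (expFactor (X N) lam) c := by unfold expFactor; fun_prop
  exact ((hK.mul (differentiable_gammaDensity α β c)).mul hE).mul hW

lemma exists_bound_shiftedIntegrand (X : ℕ → ℝ) (α β : Fin N → Fin N → ℝ)
    (ε : Fin N → ℝ) {a : ℝ} (ha : a < g) (lam : Fin (N + 1) → ℂ) (hl : ∀ k, |(lam k).re| ≤ a) :
    ∃ C, 0 ≤ C ∧ ∀ c : Fin N → ℂ, (∀ j, |(c j).re| ≤ a) →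
      (∀ j k, |(lam k - (c j - ε j)).re| ≤ a) →
      ‖shiftedIntegrand g X α β ε lam c‖ ≤ C * ((1 + ‖imVec c‖) ^ (N + 1))⁻¹ := by
  obtain ⟨C, M, hC, h⟩ := exists_bound_integrand ha (X N) α β (expPolyBound_wave X N a ha)
  refine ⟨C * (1 + ‖imVec lam‖) ^ M * Real.exp (-(Real.pi / 4) * pairDist (imVec lam)),
    by positivity, fun c hc hlc => ?_⟩
  exact h lam c (fun j => c j - ε j) hl hc hlc (by ext j; simp [imVec])

lemma integrable_shiftedIntegrand (hg : 0 < g) (X : ℕ → ℝ) (α β : Fin N → Fin N → ℝ)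
    (ε u : Fin N → ℝ) {a : ℝ} (ha : a < g) {lam : Fin (N + 1) → ℂ} (hl : ∀ k, |(lam k).re| ≤ a)
    (hu : ∀ j, |u j| ≤ a) (h : ∀ j k, |(lam k).re - (u j - ε j)| ≤ a) :
    Integrable fun t : Fin N → ℝ =>
      shiftedIntegrand g X α β ε lam (fun j => imRow t j + u j) := by
  obtain ⟨C, hC, hb⟩ := exists_bound_shiftedIntegrand X α β ε ha lam hl
  have hre : ∀ (t : Fin N → ℝ) j, (imRow t j + (u j : ℂ)).re = u j := fun t j => by simp
  have hre' : ∀ (t : Fin N → ℝ) j k, (lam k - (imRow t j + (u j : ℂ) - ε j)).re =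
      (lam k).re - (u j - ε j) := fun t j k => by simp
  refine ((integrable_inv_one_add_norm_pow N).const_mul C).mono' ?_
    (Eventually.of_forall fun t => ?_)
  · refine Continuous.aestronglyMeasurable (continuous_iff_continuousAt.2 fun t => ?_)
    refine ContinuousAt.comp (f := fun t : Fin N → ℝ => fun j => imRow t j + (u j : ℂ))
      (differentiableAt_shiftedIntegrand hg X α β ε (fun j => ?_) fun j k => ?_).continuousAt ?_
    · rw [hre]; exact (hu j).trans_lt ha
    · rw [hre']; exact (h j k).trans_lt ha
    · exact (continuous_pi fun j =>
        ((continuous_apply j).comp continuous_imRow).add continuous_const).continuousAt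
  · have := hb (fun j => imRow t j + u j) (fun j => by rw [hre]; exact hu j)
      fun j k => by rw [hre']; exact h j k
    have e : imVec (fun j => imRow t j + (u j : ℂ)) = t := by
      ext j; simp [imVec, imRow]
    rwa [e] at this

/-- The coefficients have denominators c_i - c_j, so pointwise identities are available only off the
diagonals, a null set. -/
lemma ae_injective (N : ℕ) : ∀ᵐ t : Fin N → ℝ, Function.Injective t := by
  have h : ∀ i j : Fin N, i ≠ j → ∀ᵐ t : Fin N → ℝ, t i ≠ t j := by
    intro i j hij
    set L : Submodule ℝ (Fin N → ℝ) :=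
      LinearMap.ker (LinearMap.proj (R := ℝ) (φ := fun _ : Fin N => ℝ) i - LinearMap.proj j)
    have hL : L ≠ ⊤ := by
      intro h
      have : Pi.single i (1 : ℝ) ∈ L := h ▸ Submodule.mem_top
      simp [L, hij] at this
    have := Measure.addHaar_submodule volume L hL
    rw [ae_iff]
    convert this using 2
    ext t
    simp [L, sub_eq_zero]
  have h' : ∀ᵐ t : Fin N → ℝ, ∀ i j : Fin N, i ≠ j → t i ≠ t j :=
    ae_all_iff.2 fun i => ae_all_iff.2 fun j => by
      by_cases hij : i = j
      · exact Eventually.of_forall fun t h => absurd hij h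
      · filter_upwards [h i j hij] with t ht _ using ht
  filter_upwards [h'] with t ht i j hij
  by_contra hne
  exact ht i j hne hij

lemma injective_imRow {t : Fin N → ℝ} (ht : Function.Injective t) :
    Function.Injective (imRow t) := fun i j h => ht (by simpa [imRow] using h)

/-! ### Recursion for the eigenvalue sums. -/

lemma sum_powerset_univ_succ {M : Type*} [AddCommMonoid M] (F : Finset (Fin (N + 1)) → M) :
    ∑ I ∈ (univ : Finset (Fin (N + 1))).powerset, F I =
      ∑ J ∈ (univ : Finset (Fin N)).powerset,
        (F (J.image Fin.castSucc) + F (insert (Fin.last N) (J.image Fin.castSucc))) := by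
  have h : (univ : Finset (Fin (N + 1))) =
      insert (Fin.last N) ((univ : Finset (Fin N)).image Fin.castSucc) := by
    ext i
    induction i using Fin.lastCases <;> simp
  have hlast : Fin.last N ∉ (univ : Finset (Fin N)).image Fin.castSucc := by
    simp
  have hinj := Finset.image_injective (Fin.castSucc_injective N)
  rw [h, Finset.sum_powerset_insert hlast, Finset.powerset_image,
    Finset.sum_image fun _ _ _ _ h => hinj h, Finset.sum_image fun _ _ _ _ h => hinj h,
    Finset.sum_add_distrib]

lemma sum_exp_signVec_succ (X : ℕ → ℝ) (w : ℕ → ℂ) :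
    ∑ I ∈ (univ : Finset (Fin (N + 1))).powerset, w I.card *
        Complex.exp (∑ k, (signVec I k : ℂ) * X k) =
      ∑ J ∈ (univ : Finset (Fin N)).powerset,
        (w J.card * Complex.exp (-X N) + w (J.card + 1) * Complex.exp (X N)) *
          Complex.exp (∑ k, (signVec J k : ℂ) * X k) := by
  rw [sum_powerset_univ_succ]
  refine Finset.sum_congr rfl fun J _ => ?_
  have hlast : Fin.last N ∉ J.image Fin.castSucc := by simp [Fin.castSucc_ne_last]
  rw [Finset.card_insert_of_notMem hlast,
    Finset.card_image_of_injective _ (Fin.castSucc_injective N)]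
  simp only [Fin.sum_univ_castSucc]
  have e1 : ∀ k : Fin N, signVec (J.image Fin.castSucc) k.castSucc = signVec J k := fun k => by
    simp [signVec]
  have e2 : ∀ k : Fin N, signVec (insert (Fin.last N) (J.image Fin.castSucc)) k.castSucc =
      signVec J k := fun k => by
    simp [signVec]
  have e3 : signVec (J.image Fin.castSucc) (Fin.last N) = -1 := by
    simp [signVec, Fin.castSucc_ne_last]
  have e4 : signVec (insert (Fin.last N) (J.image Fin.castSucc)) (Fin.last N) = 1 := by
    simp [signVec]
  simp only [e1, e2, e3, e4, Fin.val_castSucc, Fin.val_last, Complex.exp_add]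
  push_cast
  rw [neg_one_mul, one_mul]
  ring

/-- The difference equations in symmetric form, for all orders at once through the weight w. The
weight passed to the induction hypothesis mixes two consecutive orders, as the symmetric sums do in
`sum_exp_signVec_succ`. -/
theorem sum_shiftCoef_mul_wave (hg : 1 < g) (X : ℕ → ℝ) (N : ℕ) : ∀ (w : ℕ → ℂ)
    (lam : Fin N → ℂ), (∀ k, (lam k).re = 0) → Function.Injective lam →
    ∑ I ∈ (univ : Finset (Fin N)).powerset, w I.card *
        (shiftCoef (g - 1 : ℝ) lam univ I * wave g X N (fun k => lam k + signVec I k)) =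
      (∑ I ∈ (univ : Finset (Fin N)).powerset, w I.card *
        Complex.exp (∑ k, (signVec I k : ℂ) * X k)) * wave g X N lam := by
  have hg0 : 0 < g := by linarith
  induction N with
  | zero =>
    intro w lam _ _
    simp [shiftCoef, wave_zero]
  | succ N ih =>
    intro w lam hl hli
    -- The factor by which `expFactor` changes under a shift depends only on |I| and is absorbed
    -- into the weight.
    set w' : ℕ → ℂ := fun s => w s * Complex.exp ((2 * (s : ℂ) - (N + 1 : ℕ)) * X N) with hw'
    set h : Finset (Fin N) → (Fin N → ℂ) → ℂ := fun J =>
      shiftedIntegrand g X (offsetLeft J) (offsetRight g J) (signVec J) lam with hh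
    have hl1 : ∀ (I : Finset (Fin (N + 1))) k, |(lam k + signVec I k).re| = 1 := fun I k => by
      simp [hl, abs_signVec]
    have hI : ∀ I : Finset (Fin (N + 1)), Integrable fun t : Fin N → ℝ =>
        kern g (fun k => lam k + signVec I k) (imRow t) * density g (imRow t) *
          expFactor (X N) (fun k => lam k + signVec I k) (imRow t) * wave g X N (imRow t) := by
      intro I
      have := integrable_shiftedIntegrand hg0 X (fun _ _ => 0) (fun _ _ => g) 0 0 hg
        (lam := fun k => lam k + signVec I k) (fun k => (hl1 I k).le) (by simp)
        (fun j k => by simpa using (hl1 I k).le)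
      simpa [shiftedIntegrand, density] using this
    have hJ0 : ∀ J : Finset (Fin N), Integrable fun t : Fin N → ℝ => h J (imRow t) := by
      intro J
      have := integrable_shiftedIntegrand hg0 X (offsetLeft J) (offsetRight g J) (signVec J) 0 hg
        (lam := lam) (fun k => by simp [hl]) (by simp) (fun j k => by simp [hl, abs_signVec])
      simpa [hh] using this
    have hJ1 : ∀ J : Finset (Fin N), Integrable fun t : Fin N → ℝ =>
        h J (fun j => imRow t j + signVec J j) := fun J =>
      integrable_shiftedIntegrand hg0 X (offsetLeft J) (offsetRight g J) (signVec J) (signVec J) hg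
        (lam := lam) (fun k => by simp [hl]) (fun j => (abs_signVec J j).le)
        (fun j k => by simp [hl])
    have hshift : ∀ J : Finset (Fin N), ∫ t : Fin N → ℝ, h J (imRow t) =
        ∫ t : Fin N → ℝ, h J (fun j => imRow t j + signVec J j) := by
      intro J
      -- Along the translation, Re c_j = ±s and the kernel differences have real part ±(1 - s). For
      -- -δ < s < 1 + δ both stay below 1 + δ < g in absolute value.
      set δ := (g - 1) / 2 with hδ
      have hδ0 : 0 < δ := by rw [hδ]; linarith
      have hδg : 1 + δ < g := by rw [hδ]; linarith
      obtain ⟨C, hC, hb⟩ := exists_bound_shiftedIntegrand X (offsetLeft J) (offsetRight g J)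
        (signVec J) hδg lam (fun k => by simp [hl]; linarith)
      have hre1 : ∀ c : Fin N → ℂ, (∃ s, -δ < s ∧ s < 1 + δ ∧ ∀ j, (c j).re = s * signVec J j) →
          (∀ j, |(c j).re| ≤ 1 + δ) ∧ ∀ j k, |(lam k - (c j - signVec J j)).re| ≤ 1 + δ := by
        rintro c ⟨s, h1, h2, hs⟩
        refine ⟨fun j => ?_, fun j k => ?_⟩
        · rw [hs, abs_mul, abs_signVec, mul_one, abs_le]
          constructor <;> linarith
        · have : (lam k - (c j - signVec J j)).re = (1 - s) * signVec J j := by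
            simp [hl, hs]; ring
          rw [this, abs_mul, abs_signVec, mul_one, abs_le]
          constructor <;> linarith
      refine (integral_imRow_add (signVec J) hδ0 hC (fun c hc => ?_) fun c hc => ?_).symm
      · exact differentiableAt_shiftedIntegrand hg0 X _ _ _
          (fun j => ((hre1 c hc).1 j).trans_lt hδg) fun j k => ((hre1 c hc).2 j k).trans_lt hδg
      · exact hb c (hre1 c hc).1 (hre1 c hc).2
    have hexpI : ∀ (I : Finset (Fin (N + 1))) (c : Fin N → ℂ),
        expFactor (X N) (fun k => lam k + signVec I k) c =
          Complex.exp ((2 * (I.card : ℂ) - (N + 1 : ℕ)) * X N) * expFactor (X N) lam c := by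
      intro I c
      rw [expFactor, expFactor, Finset.sum_add_distrib, sum_signVec, ← Complex.exp_add]
      congr 1; ring
    have hexpJ : ∀ (J : Finset (Fin N)) (c : Fin N → ℂ),
        expFactor (X N) lam (fun j => c j + signVec J j) =
          Complex.exp (-(2 * (J.card : ℂ) - N) * X N) * expFactor (X N) lam c := by
      intro J c
      rw [expFactor, expFactor, Finset.sum_add_distrib, sum_signVec, ← Complex.exp_add]
      congr 1; ring
    -- Before the translation: the kernel identity under the integral sign.
    have hpt1 : ∀ᵐ t : Fin N → ℝ, ∑ I ∈ (univ : Finset (Fin (N + 1))).powerset, w I.card *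
        (shiftCoef (g - 1 : ℝ) lam univ I *
          (kern g (fun k => lam k + signVec I k) (imRow t) * density g (imRow t) *
          expFactor (X N) (fun k => lam k + signVec I k) (imRow t) * wave g X N (imRow t))) =
        ∑ J ∈ (univ : Finset (Fin N)).powerset, (w' J.card + w' (J.card + 1)) *
          h J (imRow t) := by
      filter_upwards [ae_injective N] with t ht
      have hci := injective_imRow ht
      have key := congrArg (· * (density g (imRow t) * expFactor (X N) lam (imRow t) *
        wave g X N (imRow t)))
        (sum_shiftCoef_mul_kern hg hl (imRow_re t) hli hci w')
      simp only [Finset.sum_mul] at key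
      convert key using 1
      · refine Finset.sum_congr rfl fun I _ => ?_
        rw [hexpI, hw']
        ring
      · refine Finset.sum_congr rfl fun J _ => ?_
        rw [hh]
        simp only [shiftedIntegrand]
        rw [gammaDensity_offset hci]
        ring
    set E : ℂ := ∑ J ∈ (univ : Finset (Fin N)).powerset,
        (w J.card * Complex.exp (-X N) + w (J.card + 1) * Complex.exp (X N)) *
          Complex.exp (∑ k, (signVec J k : ℂ) * X k) with hE
    -- After the translation the kernel is unshifted, and the induction hypothesis applies to the
    -- shifted inner wave functions.
    have hpt2 : ∀ᵐ t : Fin N → ℝ, ∑ J ∈ (univ : Finset (Fin N)).powerset,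
        (w' J.card + w' (J.card + 1)) * h J (fun j => imRow t j + signVec J j) =
        E * (kern g lam (imRow t) * density g (imRow t) * expFactor (X N) lam (imRow t) *
          wave g X N (imRow t)) := by
      filter_upwards [ae_injective N] with t ht
      have hci := injective_imRow ht
      have key := congrArg (kern g lam (imRow t) * density g (imRow t) *
          expFactor (X N) lam (imRow t) * ·)
        (ih (fun s => w s * Complex.exp (-X N) + w (s + 1) * Complex.exp (X N)) (imRow t)
          (imRow_re t) hci)
      rw [← hE] at key
      simp only [Finset.mul_sum] at key
      convert key using 1
      · refine Finset.sum_congr rfl fun J _ => ?_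
        rw [hh, hw']
        simp only [shiftedIntegrand, add_sub_cancel_right]
        rw [gammaDensity_offset_add hci, hexpJ]
        have e1 : Complex.exp ((2 * (J.card : ℂ) - (N + 1 : ℕ)) * X N) *
            Complex.exp (-(2 * (J.card : ℂ) - N) * X N) = Complex.exp (-X N) := by
          rw [← Complex.exp_add]; congr 1; push_cast; ring
        have e2 : Complex.exp ((2 * ((J.card + 1 : ℕ) : ℂ) - (N + 1 : ℕ)) * X N) *
            Complex.exp (-(2 * (J.card : ℂ) - N) * X N) = Complex.exp (X N) := by
          rw [← Complex.exp_add]; congr 1; push_cast; ring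
        rw [← e1, ← e2]
        ring
      · ring
    rw [sum_exp_signVec_succ, ← hE]
    simp only [wave_succ, ← integral_const_mul]
    rw [← integral_finsetSum _ fun I _ => ((hI I).const_mul _).const_mul _,
      integral_congr_ae hpt1, ← integral_congr_ae hpt2,
      integral_finsetSum _ fun J _ => (hJ0 J).const_mul _,
      integral_finsetSum _ fun J _ => (hJ1 J).const_mul _]
    simp only [integral_const_mul, hshift]

end

/-! ### The iterated integral -/

/-- Triangular arrays with rows of lengths `1, …, N`. -/
abbrev Rows (N : ℕ) : Type := ∀ i : Fin N, Fin ((i : ℕ) + 1) → ℝ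

/-- Adding a last row to a triangular array. -/
def rowsSnoc (N : ℕ) : (Fin (N + 1) → ℝ) × Rows N ≃ᵐ Rows (N + 1) where
  toEquiv := Fin.snocEquiv (fun i : Fin (N + 1) => Fin ((i : ℕ) + 1) → ℝ)
  measurable_toFun := by
    refine measurable_pi_iff.2 fun i => ?_
    induction i using Fin.lastCases with
    | last =>
      have : (fun p : (Fin (N + 1) → ℝ) × Rows N =>
          (Fin.snocEquiv (fun i : Fin (N + 1) => Fin ((i : ℕ) + 1) → ℝ)) p (Fin.last N)) =
          Prod.fst := by
        ext p : 1; simp [Fin.snocEquiv]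
      exact this ▸ measurable_fst
    | cast i =>
      have : (fun p : (Fin (N + 1) → ℝ) × Rows N =>
          (Fin.snocEquiv (fun i : Fin (N + 1) => Fin ((i : ℕ) + 1) → ℝ)) p i.castSucc) =
          fun p => p.2 i := by
        ext p : 1; simp [Fin.snocEquiv]
      exact this ▸ (measurable_pi_apply i).comp measurable_snd
  measurable_invFun := by
    refine Measurable.prodMk (measurable_pi_apply (Fin.last N)) ?_
    exact measurable_pi_iff.2 fun i => measurable_pi_apply i.castSucc

lemma rowsSnoc_last {N : ℕ} (p : (Fin (N + 1) → ℝ) × Rows N) :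
    rowsSnoc N p (Fin.last N) = p.1 := by
  exact Fin.snoc_last (α := fun i : Fin (N + 1) => Fin ((i : ℕ) + 1) → ℝ) p.1 p.2

lemma rowsSnoc_castSucc {N : ℕ} (p : (Fin (N + 1) → ℝ) × Rows N) (i : Fin N) :
    rowsSnoc N p i.castSucc = p.2 i := by
  exact Fin.snoc_castSucc (α := fun i : Fin (N + 1) => Fin ((i : ℕ) + 1) → ℝ) p.1 p.2 i

lemma measurePreserving_rowsSnoc (N : ℕ) :
    MeasurePreserving (rowsSnoc N) (volume.prod volume) volume := by
  refine ⟨(rowsSnoc N).measurable, (Measure.pi_eq fun s hs => ?_).symm⟩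
  rw [Measure.map_apply (rowsSnoc N).measurable (MeasurableSet.univ_pi hs)]
  have : (rowsSnoc N) ⁻¹' (Set.univ.pi s) =
      (s (Fin.last N)) ×ˢ (Set.univ.pi fun i : Fin N => s i.castSucc) := by
    ext p
    simp only [Set.mem_preimage, Set.mem_pi, Set.mem_univ, true_implies, Set.mem_prod]
    rw [Fin.forall_fin_succ', rowsSnoc_last, and_comm]
    simp only [rowsSnoc_castSucc]
  rw [this, Measure.prod_prod, Fin.prod_univ_castSucc, mul_comm]
  congr 1
  exact Measure.pi_pi _ _

lemma gam_top {n : ℕ} (lam : Fin n → ℂ) (t : ∀ i : Fin (n - 1), Fin ((i : ℕ) + 1) → ℝ)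
    (j : Fin n) : gam lam t n j = lam j := by
  simp [gam]

lemma gam_eq_zero {n : ℕ} (lam : Fin n → ℂ) (t : ∀ i : Fin (n - 1), Fin ((i : ℕ) + 1) → ℝ)
    {i j : ℕ} (h : i ≤ j) : gam lam t i j = 0 := by
  simp [gam, not_lt.2 h]

lemma gam_of_le {N : ℕ} (lam : Fin (N + 2) → ℂ) (t : Rows (N + 1)) {i : ℕ} (hi : i ≤ N + 1)
    (j : ℕ) : gam lam t i j =
      gam (n := N + 1) (imRow (t (Fin.last N))) (fun i : Fin N => t i.castSucc) i j := by
  unfold gam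
  by_cases hj : j < i
  · rw [dif_pos hj, dif_pos hj, dif_neg (by omega), dif_pos (by omega)]
    by_cases h : i = N + 1
    · subst h
      rw [dif_pos rfl]
      rfl
    · rw [dif_neg h, dif_pos (by omega)]
      rfl
  · rw [dif_neg hj, dif_neg hj]

lemma gam_last {N : ℕ} (lam : Fin (N + 2) → ℂ) (t : Rows (N + 1)) (j : Fin (N + 1)) :
    gam lam t (N + 1) j = imRow (t (Fin.last N)) j := by
  rw [gam_of_le lam t le_rfl]
  exact gam_top (n := N + 1) _ _ j

lemma prod_range_erase {n : ℕ} (r : Fin n) (f : ℕ → ℂ) :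
    ∏ s ∈ (range n).erase r, f s = ∏ s ∈ univ.erase r, f (s : Fin n) := by
  have : (range n).erase r = (univ.erase r).map Fin.valEmbedding := by
    ext s
    simp only [Finset.mem_erase, Finset.mem_range, Finset.mem_map, Finset.mem_univ, and_true,
      Fin.valEmbedding_apply]
    constructor
    · rintro ⟨h1, h2⟩
      exact ⟨⟨s, h2⟩, fun h => h1 (congrArg Fin.val h), rfl⟩
    · rintro ⟨a, ha, rfl⟩
      exact ⟨fun h => ha (Fin.ext h), a.2⟩
  rw [this, Finset.prod_map]
  rfl

/-- The top row enters only through its interaction with the row below and through the exponent of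
the last coordinate; the other factors form the integrand with that lower row as its parameters. -/
lemma integrand_succ {N : ℕ} (g : ℝ) (lam : Fin (N + 2) → ℂ) (x : Fin (N + 2) → ℝ)
    (t : Rows (N + 1)) :
    integrand g lam x t =
      kern g lam (imRow (t (Fin.last N))) * density g (imRow (t (Fin.last N))) *
        expFactor (x (Fin.last (N + 1))) lam (imRow (t (Fin.last N))) *
        integrand (n := N + 1) g (imRow (t (Fin.last N))) (fun i => x i.castSucc)
          (fun i : Fin N => t i.castSucc) := by
  set c := imRow (t (Fin.last N)) with hc
  set t' : Rows N := fun i => t i.castSucc with ht'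
  have hle : ∀ i ≤ N + 1, ∀ j, gam lam t i j = gam (n := N + 1) c t' i j :=
    fun i hi j => gam_of_le lam t hi j
  have hkern : ∏ j ∈ range (N + 1), ∏ k ∈ range (N + 2),
      Complex.Gamma ((gam lam t (N + 1) j - gam lam t (N + 2) k + g) / 2) *
        Complex.Gamma ((gam lam t (N + 2) k - gam lam t (N + 1) j + g) / 2) = kern g lam c := by
    rw [Finset.prod_range, kern]
    refine Finset.prod_congr rfl fun j _ => ?_
    rw [Finset.prod_range]
    refine Finset.prod_congr rfl fun k _ => ?_
    rw [gam_last, gam_top, gammaPair, neg_sub]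
  have hdens : (∏ r ∈ range (N + 1), ∏ s ∈ (range (N + 1)).erase r,
      Complex.Gamma ((gam lam t (N + 1) r - gam lam t (N + 1) s) / 2) *
        Complex.Gamma ((gam lam t (N + 1) r - gam lam t (N + 1) s + 2 * g) / 2))⁻¹ =
      density g c := by
    rw [Finset.prod_range, density, gammaDensity, ← Finset.prod_inv_distrib]
    refine Finset.prod_congr rfl fun r _ => ?_
    rw [prod_range_erase, ← Finset.prod_inv_distrib]
    refine Finset.prod_congr rfl fun s _ => ?_
    rw [gam_last, gam_last, mul_inv, Complex.ofReal_zero, add_zero, add_div,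
      mul_div_cancel_left₀ _ two_ne_zero]
  have hexp : ∑ i : Fin (N + 2),
      (∑ j ∈ range (N + 2), (gam lam t ((i : ℕ) + 1) j - gam lam t i j)) * (x i : ℂ) =
      (∑ k, lam k - ∑ j, c j) * x (Fin.last (N + 1)) + ∑ i : Fin (N + 1),
      (∑ j ∈ range (N + 1), (gam (n := N + 1) c t' ((i : ℕ) + 1) j -
        gam (n := N + 1) c t' i j)) * (x i.castSucc : ℂ) := by
    rw [Fin.sum_univ_castSucc, add_comm]
    congr 1
    · rw [Fin.val_last, Finset.sum_sub_distrib, Finset.sum_range, Finset.sum_range_succ,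
        Finset.sum_range, gam_eq_zero _ _ le_rfl, add_zero]
      congr 2
      · exact Finset.sum_congr rfl fun k _ => gam_top lam t k
      · exact Finset.sum_congr rfl fun k _ => gam_last lam t k
    · refine Finset.sum_congr rfl fun i _ => ?_
      have hi : (i : ℕ) + 1 ≤ N + 1 := i.2
      congr 1
      -- The index j = N + 1 lies outside the lower rows and contributes zero, so the range shortens
      -- by one.
      rw [Finset.sum_range_succ, Fin.val_castSucc, gam_eq_zero _ _ hi,
        gam_eq_zero _ _ (by omega : (i : ℕ) ≤ N + 1), sub_zero, add_zero]
      exact Finset.sum_congr rfl fun j _ => by rw [hle _ hi, hle _ (by omega)]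
  rw [integrand, integrand, hexp, Complex.exp_add, ← expFactor,
    show N + 2 - 1 = N + 1 from rfl, show N + 1 - 1 = N from rfl, Finset.prod_range_succ, hkern,
    div_eq_mul_inv (kern g lam c), hdens]
  have : ∀ i ∈ range N, ∀ j, gam lam t (i + 1) j = gam (n := N + 1) c t' (i + 1) j ∧
      gam lam t (i + 2) j = gam (n := N + 1) c t' (i + 2) j := fun i hi j => by
    have := Finset.mem_range.1 hi
    exact ⟨hle _ (by omega) j, hle _ (by omega) j⟩
  have aux : ∀ P P' k d e E : ℂ, P = P' → P * (k * d) * (e * E) = k * d * e * (P' * E) := by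
    rintro P _ k d e E rfl; ring
  exact aux _ _ _ _ _ _ (Finset.prod_congr rfl fun i hi => by simp only [this i hi])

lemma integrand_one (g : ℝ) (lam : Fin 1 → ℂ) (x : Fin 1 → ℝ) (t : Rows 0) :
    integrand g lam x t = Complex.exp (lam 0 * x 0) := by
  have h1 : gam lam t 1 0 = lam 0 := gam_top lam t 0
  have h2 : gam lam t 0 0 = 0 := gam_eq_zero lam t le_rfl
  simp [integrand, h1, h2]

/-- Γ is discontinuous at its poles, but it is the pointwise inverse of an entire function. -/
lemma measurable_Gamma : Measurable Complex.Gamma := by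
  have e : Complex.Gamma = (fun s => (Complex.Gamma s)⁻¹)⁻¹ := by ext; simp
  rw [e]
  exact Complex.differentiable_one_div_Gamma.continuous.measurable.inv

lemma measurable_integrand {n : ℕ} (g : ℝ) (lam : Fin n → ℂ) (x : Fin n → ℝ) :
    Measurable (integrand g lam x) := by
  have hgam : ∀ i j, Measurable fun t => gam lam t i j := by
    intro i j
    unfold gam
    split_ifs
    · exact measurable_const
    · exact measurable_const.mul (Complex.measurable_ofReal.comp
        ((measurable_pi_apply _).comp (measurable_pi_apply _)))
    · exact measurable_const
    · exact measurable_const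
  have hG : ∀ {f : (∀ i : Fin (n - 1), Fin ((i : ℕ) + 1) → ℝ) → ℂ}, Measurable f →
      Measurable fun t => Complex.Gamma (f t) := fun hf => measurable_Gamma.comp hf
  unfold integrand
  refine Measurable.mul (Finset.measurable_fun_prod _ fun i _ => Measurable.div ?_ ?_) ?_
  · refine Finset.measurable_fun_prod _ fun j _ => Finset.measurable_fun_prod _ fun k _ => ?_
    exact (hG ((((hgam _ _).sub (hgam _ _)).add_const _).div_const _)).mul
      (hG ((((hgam _ _).sub (hgam _ _)).add_const _).div_const _))
  · refine Finset.measurable_fun_prod _ fun j _ => Finset.measurable_fun_prod _ fun k _ => ?_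
    exact (hG (((hgam _ _).sub (hgam _ _)).div_const _)).mul
      (hG ((((hgam _ _).sub (hgam _ _)).add_const _).div_const _))
  · refine Complex.measurable_exp.comp (Finset.measurable_fun_sum _ fun i _ => ?_)
    exact (Finset.measurable_fun_sum _ fun j _ => (hgam _ _).sub (hgam _ _)).mul_const _

/-- The Mellin–Barnes integral converges absolutely and is computed by the recursion. -/
theorem integrand_integral {g : ℝ} (hg : 0 < g) (X : ℕ → ℝ) (N : ℕ) :
    ∃ (C : ℝ) (M : ℕ), 0 ≤ C ∧ ∀ lam ∈ imagSpace (N + 1),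
      Integrable (fun t : Rows N => integrand (n := N + 1) g lam (fun i => X i) t) ∧
      ∫ t : Rows N, integrand (n := N + 1) g lam (fun i => X i) t = wave g X (N + 1) lam ∧
      ∫ t : Rows N, ‖integrand (n := N + 1) g lam (fun i => X i) t‖ ≤
        C * (1 + ‖imVec lam‖) ^ M * Real.exp (-(Real.pi / 4) * pairDist (imVec lam)) := by
  induction N with
  | zero =>
    refine ⟨1, 0, zero_le_one, fun lam hl => ?_⟩
    -- With no rows to integrate the space is one point, and its measure is a Dirac mass.
    have hvol : ∀ {E : Type} [NormedAddCommGroup E] [NormedSpace ℝ E] [CompleteSpace E]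
        (e : E), ∫ _ : Rows 0, e = e := fun e => by
      rw [volume_pi, Measure.pi_of_empty]
      exact integral_dirac _ _
    have hfin : IsFiniteMeasure (volume : Measure (Rows 0)) := by
      rw [volume_pi, Measure.pi_of_empty]
      infer_instance
    simp only [integrand_one]
    refine ⟨integrable_const _, ?_, ?_⟩
    · rw [hvol, wave_succ]
      simp only [wave_zero]
      simp [kern, density, gammaDensity, expFactor]
      rw [Measure.real, volume_pi, Measure.pi_of_empty]
      simp
    · rw [hvol, Complex.norm_exp]
      simp [hl 0, pairDist]
  | succ N ih =>
    obtain ⟨C, M, hC, hS⟩ := ih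
    -- Q stands in for the inner wave function in `exists_bound_integrand`: it is the inductive
    -- bound for the integral of the norm, which absolute convergence requires.
    set Q : (Fin (N + 1) → ℂ) → ℂ := fun c =>
      ((C * (1 + ‖imVec c‖) ^ M * Real.exp (-(Real.pi / 4) * pairDist (imVec c)) : ℝ) : ℂ) with hQ
    have hQb : ExpPolyBound {c : Fin (N + 1) → ℂ | ∀ j, |(c j).re| ≤ 0} (fun c => ‖imVec c‖)
        (fun c => -(Real.pi / 4) * pairDist (imVec c)) Q := by
      refine ⟨C, M, hC, fun c _ => le_of_eq ?_⟩
      rw [hQ, Complex.norm_real, Real.norm_of_nonneg (by positivity)]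
    obtain ⟨C', M', hC', hb⟩ := exists_bound_integrand hg (X (N + 1)) (fun _ _ => 0)
      (fun _ _ => g) hQb
    refine ⟨C' * ∫ t : Fin (N + 1) → ℝ, ((1 + ‖t‖) ^ (N + 1 + 1))⁻¹, M',
      mul_nonneg hC' (integral_nonneg fun t => by positivity), fun lam hl => ?_⟩
    set A : (Fin (N + 1) → ℝ) → ℂ := fun a =>
      kern g lam (imRow a) * density g (imRow a) * expFactor (X (N + 1)) lam (imRow a) with hA
    set f : (Fin (N + 1) → ℝ) × Rows N → ℂ := fun p =>
      integrand (n := N + 2) g lam (fun i => X i) (rowsSnoc N p) with hf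
    have hfA : ∀ p, f p =
        A p.1 * integrand (n := N + 1) g (imRow p.1) (fun i => X i) p.2 := by
      intro p
      simp only [hf, hA]
      rw [integrand_succ, rowsSnoc_last]
      simp only [rowsSnoc_castSucc, Fin.val_last, Fin.val_castSucc]
    have hmeas : AEStronglyMeasurable f (volume.prod volume) :=
      ((measurable_integrand (n := N + 2) g lam _).comp
        (rowsSnoc N).measurable).aestronglyMeasurable
    have him : ∀ a : Fin (N + 1) → ℝ, imRow a ∈ imagSpace (N + 1) := fun a j => imRow_re a j
    have hnorm : ∀ a : Fin (N + 1) → ℝ, ∫ t' : Rows N, ‖f (a, t')‖ ≤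
        C' * (1 + ‖imVec lam‖) ^ M' * Real.exp (-(Real.pi / 4) * pairDist (imVec lam)) *
          ((1 + ‖a‖) ^ (N + 1 + 1))⁻¹ := by
      intro a
      have e : ∀ t' : Rows N, ‖f (a, t')‖ =
          ‖A a‖ * ‖integrand (n := N + 1) g (imRow a) (fun i => X i) t'‖ := fun t' => by
        rw [hfA, norm_mul]
      simp only [e]
      rw [integral_const_mul]
      have h1 := (hS (imRow a) (him a)).2.2
      have h2 := hb lam (imRow a) (imRow a) (fun k => by rw [hl k, abs_zero])
        (fun j => by simp) (fun j k => by simp [hl k]) rfl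
      rw [imVec_imRow] at h1 h2
      calc _ ≤ ‖A a‖ * ‖Q (imRow a)‖ := by
            refine mul_le_mul_of_nonneg_left (h1.trans ?_) (norm_nonneg _)
            rw [hQ, Complex.norm_real, imVec_imRow]
            exact le_abs_self _
        _ = ‖A a * Q (imRow a)‖ := (norm_mul _ _).symm
        _ ≤ _ := h2
    have hnormInt : Integrable fun a : Fin (N + 1) → ℝ => ∫ t' : Rows N, ‖f (a, t')‖ := by
      refine ((integrable_inv_one_add_norm_pow (N + 1)).const_mul
        (C' * (1 + ‖imVec lam‖) ^ M' * Real.exp (-(Real.pi / 4) * pairDist (imVec lam)))).mono'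
        hmeas.norm.integral_prod_right' (Eventually.of_forall fun a => ?_)
      rw [Real.norm_of_nonneg (integral_nonneg fun _ => norm_nonneg _)]
      exact hnorm a
    have hfint : Integrable f (volume.prod volume) := by
      refine (integrable_prod_iff hmeas).2 ⟨Eventually.of_forall fun a => ?_, hnormInt⟩
      simp only [hfA]
      exact (hS (imRow a) (him a)).1.const_mul _
    have hmp := measurePreserving_rowsSnoc N
    have hemb := (rowsSnoc N).measurableEmbedding
    refine ⟨(hmp.integrable_comp_emb hemb).1 hfint, ?_, ?_⟩
    · rw [← hmp.integral_comp hemb]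
      change ∫ p, f p ∂(volume.prod volume) = _
      rw [integral_prod f hfint, wave_succ]
      refine integral_congr_ae (Eventually.of_forall fun a => ?_)
      simp only [hfA]
      rw [integral_const_mul, (hS (imRow a) (him a)).2.1]
    · rw [← hmp.integral_comp hemb]
      change ∫ p, ‖f p‖ ∂(volume.prod volume) ≤ _
      rw [integral_prod _ hfint.norm]
      refine (integral_mono hnormInt ((integrable_inv_one_add_norm_pow (N + 1)).const_mul _)
        hnorm).trans (le_of_eq ?_)
      rw [integral_const_mul]
      ring

/-! ### The analytic continuation -/

lemma tube_eq (n : ℕ) (g : ℝ) : tube n g = ⋂ j : Fin n, ⋂ k : Fin n,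
    (Complex.reLm ∘ₗ (LinearMap.proj (R := ℝ) (φ := fun _ : Fin n => ℂ) j - LinearMap.proj k)) ⁻¹'
      Metric.ball 0 (2 * g) := by
  ext lam
  simp [tube]

lemma isOpen_tube (n : ℕ) (g : ℝ) : IsOpen (tube n g) := by
  rw [tube_eq]
  exact isOpen_iInter_of_finite fun j => isOpen_iInter_of_finite fun k =>
    Metric.isOpen_ball.preimage (LinearMap.continuous_of_finiteDimensional _)

lemma isPreconnected_tube (n : ℕ) (g : ℝ) : IsPreconnected (tube n g) := by
  rw [tube_eq]
  exact (convex_iInter fun j => convex_iInter fun k =>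
    (convex_ball 0 (2 * g)).linear_preimage _).isPreconnected

lemma imagSpace_subset_tube {n : ℕ} {g : ℝ} (hg : 0 < g) : imagSpace n ⊆ tube n g :=
  fun lam hl j k => by rw [Complex.sub_re, hl j, hl k]; simpa using hg

/-- The midpoint of the largest and smallest real parts works, since these differ by less than 2g.
-/
lemma exists_center {n : ℕ} {g : ℝ} (hn : 1 ≤ n) {lam : Fin n → ℂ} (hl : lam ∈ tube n g) :
    ∃ u : ℝ, ∀ k, |(lam k - u).re| < g := by
  have hne : (univ : Finset (Fin n)).Nonempty := ⟨⟨0, hn⟩, mem_univ _⟩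
  obtain ⟨i, -, hi⟩ := Finset.exists_max_image univ (fun k => (lam k).re) hne
  obtain ⟨j, -, hj⟩ := Finset.exists_min_image univ (fun k => (lam k).re) hne
  refine ⟨((lam i).re + (lam j).re) / 2, fun k => ?_⟩
  have h1 := hi k (mem_univ _)
  have h2 := hj k (mem_univ _)
  have h3 := abs_lt.1 (hl i j)
  rw [Complex.sub_re] at h3
  rw [Complex.sub_re, Complex.ofReal_re, abs_lt]
  constructor <;> linarith [h3.2]

open Classical in
/-- The continuation of the recursive wave function to the tube. -/
def waveExt (g : ℝ) (X : ℕ → ℝ) (n : ℕ) (lam : Fin n → ℂ) : ℂ :=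
  if h : ∃ u : ℝ, ∀ k, |(lam k - u).re| < g then
    Complex.exp (h.choose * ∑ i ∈ range n, (X i : ℂ)) * wave g X n (fun k => lam k - h.choose)
  else 0

/-- By `wave_add_real` the value does not depend on the centre, so a fixed u may be used near a
given point. -/
lemma waveExt_eq {g : ℝ} (hg : 0 < g) (X : ℕ → ℝ) {n : ℕ} {lam : Fin n → ℂ} (u : ℝ)
    (hu : ∀ k, |(lam k - u).re| < g) :
    waveExt g X n lam =
      Complex.exp (u * ∑ i ∈ range n, (X i : ℂ)) * wave g X n (fun k => lam k - u) := by
  have h : ∃ u : ℝ, ∀ k, |(lam k - u).re| < g := ⟨u, hu⟩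
  rw [waveExt, dif_pos h]
  have hv := h.choose_spec
  set v := h.choose
  have e : ∀ k, lam k - u + ((u - v : ℝ) : ℂ) = lam k - v := fun k => by push_cast; ring
  have := wave_add_real hg X (lam := fun k => lam k - u) (u := u - v) hu
    fun k => by rw [e]; exact hv k
  simp only [e] at this
  rw [this, ← mul_assoc, ← Complex.exp_add]
  congr 2
  push_cast; ring

lemma differentiableOn_waveExt {g : ℝ} (hg : 0 < g) (X : ℕ → ℝ) {n : ℕ} (hn : 1 ≤ n) :
    DifferentiableOn ℂ (waveExt g X n) (tube n g) := by
  intro lam hl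
  obtain ⟨u, hu⟩ := exists_center hn hl
  refine DifferentiableAt.differentiableWithinAt ?_
  have hcont : Continuous fun (lam : Fin n → ℂ) k => lam k - (u : ℂ) := by fun_prop
  have hopen := (isOpen_abs_re_lt n g).preimage hcont
  have hd : DifferentiableAt ℂ (fun lam : Fin n → ℂ =>
      Complex.exp (u * ∑ i ∈ range n, (X i : ℂ)) * wave g X n (fun k => lam k - u)) lam := by
    refine DifferentiableAt.mul (by fun_prop) ?_
    exact ((differentiableOn_wave hg X n).differentiableAt
      ((isOpen_abs_re_lt n g).mem_nhds hu)).comp lam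
      (f := fun (lam : Fin n → ℂ) k => lam k - (u : ℂ)) (by fun_prop)
  refine hd.congr_of_eventuallyEq ?_
  filter_upwards [hopen.mem_nhds hu] with q hq
  exact waveExt_eq hg X u hq

lemma waveExt_of_imag {g : ℝ} (hg : 0 < g) (X : ℕ → ℝ) {n : ℕ} {lam : Fin n → ℂ}
    (hl : lam ∈ imagSpace n) : waveExt g X n lam = wave g X n lam := by
  rw [waveExt_eq hg X 0 fun k => by simpa [hl k] using hg]
  simp

/-- Centring at u = 1 turns the shifts by 0 or 2 into the symmetric shifts by ±1, which stay in the
strip because g > 1. -/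
lemma waveExt_shift {g : ℝ} (hg : 1 < g) (X : ℕ → ℝ) {n : ℕ} {lam : Fin n → ℂ}
    (hl : lam ∈ imagSpace n) (S : Finset (Fin n)) :
    waveExt g X n (shift S lam) = Complex.exp (∑ i ∈ range n, (X i : ℂ)) *
      wave g X n (fun k => lam k + signVec S k) := by
  have e : ∀ k, shift S lam k - ((1 : ℝ) : ℂ) = lam k + signVec S k := fun k => by
    unfold shift signVec
    split_ifs <;> push_cast <;> ring
  rw [waveExt_eq (by linarith) X 1 fun k => by
    rw [e]
    simpa [hl k, abs_signVec] using hg]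
  rw [funext e, Complex.ofReal_one, one_mul]

lemma shift_mem_tube {g : ℝ} (hg : 1 < g) {n : ℕ} {lam : Fin n → ℂ} (hl : lam ∈ imagSpace n)
    (S : Finset (Fin n)) : shift S lam ∈ tube n g := by
  have h : ∀ k, (shift S lam k).re = 0 ∨ (shift S lam k).re = 2 := fun k => by
    unfold shift
    split_ifs
    · right; simp [hl k]
    · left; exact hl k
  intro j k
  rw [Complex.sub_re, abs_lt]
  rcases h j with h1 | h1 <;> rcases h k with h2 | h2 <;> rw [h1, h2] <;>
    constructor <;> linarith

/-! ### The difference equations -/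

/-- Each of the r(n - r) factors changes sign, and r(n - r) ≡ r(n - 1) mod 2 because r(r - 1) is
even. -/
lemma sign_mul_prod_eq_shiftCoef {n : ℕ} (g : ℝ) (lam : Fin n → ℂ) {r : ℕ} (hr : 1 ≤ r)
    {S : Finset (Fin n)} (hS : S.card = r) :
    (-1 : ℂ) ^ (r * (n - 1)) *
        ∏ i ∈ S, ∏ j ∈ Sᶜ, (lam i - lam j + 2 - 2 * g) / (lam i - lam j) =
      shiftCoef (g - 1 : ℝ) lam univ S := by
  have hterm : ∀ i j, (2 * ((g - 1 : ℝ) : ℂ) - lam i + lam j) / (lam i - lam j) =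
      (-1) * ((lam i - lam j + 2 - 2 * g) / (lam i - lam j)) := fun i j => by
    push_cast; ring
  have hcard : Sᶜ.card = n - r := by rw [Finset.card_compl, hS, Fintype.card_fin]
  have hrn : r ≤ n := by
    rw [← hS]; simpa using Finset.card_le_univ S
  have hsign : (-1 : ℂ) ^ (r * (n - 1)) = ((-1) ^ (n - r)) ^ r := by
    obtain ⟨s, rfl⟩ : ∃ s, r = s + 1 := ⟨r - 1, by omega⟩
    obtain ⟨d, rfl⟩ : ∃ d, n = s + 1 + d := ⟨n - (s + 1), by omega⟩
    rw [show s + 1 + d - 1 = s + d by omega, show s + 1 + d - (s + 1) = d by omega, ← pow_mul,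
      show (s + 1) * (s + d) = s * (s + 1) + d * (s + 1) by ring, pow_add,
      (Nat.even_mul_succ_self s).neg_one_pow, one_mul]
  simp only [shiftCoef, hterm, Finset.prod_mul_distrib, Finset.prod_const,
    ← Finset.compl_eq_univ_sdiff, hcard, hS, hsign]

lemma dualHam_eq {n : ℕ} (g : ℝ) {r : ℕ} (hr : 1 ≤ r) (F : (Fin n → ℂ) → ℂ) (lam : Fin n → ℂ) :
    dualHam g r F lam = ∑ S ∈ powersetCard r (univ : Finset (Fin n)),
      shiftCoef (g - 1 : ℝ) lam univ S * F (shift S lam) := by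
  rw [dualHam, Finset.mul_sum]
  refine Finset.sum_congr rfl fun S hS => ?_
  rw [← mul_assoc, sign_mul_prod_eq_shiftCoef g lam hr (Finset.mem_powersetCard.1 hS).2]

lemma sum_powersetCard_eq {n : ℕ} (r : ℕ) (f : Finset (Fin n) → ℂ) :
    ∑ I ∈ (univ : Finset (Fin n)).powerset, (if I.card = r then (1 : ℂ) else 0) * f I =
      ∑ I ∈ powersetCard r univ, f I := by
  rw [Finset.powersetCard_eq_filter, Finset.sum_filter]
  exact Finset.sum_congr rfl fun I _ => by split_ifs <;> simp

/-- The factor exp(∑ x_i) turns the symmetric exponents ±x_k into 2x_k on I and 0 off I; it is the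
factor in `waveExt_shift`. -/
lemma eigenvalue_eq {n : ℕ} (r : ℕ) (X : ℕ → ℝ) :
    (eigenvalue r (fun i : Fin n => X i) : ℂ) = Complex.exp (∑ i ∈ range n, (X i : ℂ)) *
      ∑ I ∈ powersetCard r (univ : Finset (Fin n)),
        Complex.exp (∑ k, (signVec I k : ℂ) * X k) := by
  rw [eigenvalue, MvPolynomial.esymm, map_sum, Finset.mul_sum]
  push_cast
  refine Finset.sum_congr rfl fun I _ => ?_
  rw [map_prod, ← Complex.exp_add, Finset.sum_range, ← Finset.sum_add_distrib]
  have e : ∑ k : Fin n, ((X k : ℂ) + (signVec I k : ℂ) * X k) = ∑ k ∈ I, 2 * (X k : ℂ) := by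
    rw [← Finset.sum_subset (Finset.subset_univ I)
      (f := fun k : Fin n => (X k : ℂ) + (signVec I k : ℂ) * X k)]
    · exact Finset.sum_congr rfl fun k hk => by simp [signVec, hk]; ring
    · intro k _ hk
      simp [signVec, hk]
  rw [e, Complex.exp_sum]
  push_cast
  refine Finset.prod_congr rfl fun k _ => ?_
  rw [MvPolynomial.eval_X]
  push_cast; rfl

lemma dualHam_waveExt {n : ℕ} {g : ℝ} (hg : 1 < g) (X : ℕ → ℝ) {r : ℕ} (hr : 1 ≤ r)
    {lam : Fin n → ℂ} (hl : lam ∈ imagSpace n) (hli : Function.Injective lam) :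
    dualHam g r (waveExt g X n) lam =
      (eigenvalue r (fun i : Fin n => X i) : ℂ) * waveExt g X n lam := by
  have h := sum_shiftCoef_mul_wave hg X n (fun s => if s = r then 1 else 0) lam hl hli
  rw [sum_powersetCard_eq, sum_powersetCard_eq] at h
  rw [dualHam_eq g hr, eigenvalue_eq, waveExt_of_imag (by linarith) X hl, mul_assoc, ← h,
    Finset.mul_sum]
  refine Finset.sum_congr rfl fun S _ => ?_
  rw [waveExt_shift hg X hl]
  ring

/-- The product of all differences of the coordinates. -/
def offDiagProd {n : ℕ} (lam : Fin n → ℂ) : ℂ :=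
  ∏ p ∈ (univ : Finset (Fin n)).offDiag, (lam p.1 - lam p.2)

/-- The product of `offDiagProd` and `shiftCoef`, written without denominators. -/
def clearedCoef {n : ℕ} (η : ℂ) (S : Finset (Fin n)) (lam : Fin n → ℂ) : ℂ :=
  (∏ p ∈ univ.offDiag \ S ×ˢ Sᶜ, (lam p.1 - lam p.2)) *
    ∏ i ∈ S, ∏ j ∈ Sᶜ, (2 * η - lam i + lam j)

lemma offDiagProd_mul_shiftCoef {n : ℕ} (η : ℂ) (S : Finset (Fin n)) {lam : Fin n → ℂ}
    (hli : Function.Injective lam) :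
    offDiagProd lam * shiftCoef η lam univ S = clearedCoef η S lam := by
  have hsub : S ×ˢ Sᶜ ⊆ (univ : Finset (Fin n)).offDiag := fun p hp => by
    have h := Finset.mem_product.1 hp
    exact Finset.mem_offDiag.2 ⟨mem_univ _, mem_univ _, fun e =>
      Finset.mem_compl.1 h.2 (e ▸ h.1)⟩
  rw [offDiagProd, ← Finset.prod_sdiff hsub, clearedCoef, shiftCoef,
    ← Finset.compl_eq_univ_sdiff, mul_assoc, Finset.prod_product, ← Finset.prod_mul_distrib]
  congr 1
  refine Finset.prod_congr rfl fun i hi => ?_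
  rw [← Finset.prod_mul_distrib]
  refine Finset.prod_congr rfl fun j hj => mul_div_cancel₀ _ (sub_ne_zero.2 fun h => ?_)
  obtain rfl : i = j := hli h
  exact Finset.mem_compl.1 hj hi

lemma offDiagProd_ne_zero {n : ℕ} {lam : Fin n → ℂ} (hli : Function.Injective lam) :
    offDiagProd lam ≠ 0 :=
  Finset.prod_ne_zero_iff.2 fun _ hp => sub_ne_zero.2 fun h =>
    (Finset.mem_offDiag.1 hp).2.2 (hli h)

lemma offDiagProd_eq_zero {n : ℕ} {lam : Fin n → ℂ} (hli : ¬Function.Injective lam) :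
    offDiagProd lam = 0 := by
  obtain ⟨i, j, h, hij⟩ := Function.not_injective_iff.1 hli
  exact Finset.prod_eq_zero (i := (i, j)) (by simp [hij]) (by simp [h])

lemma differentiable_offDiagProd {n : ℕ} : Differentiable ℂ (offDiagProd (n := n)) := fun lam =>
  differentiableAt_prod _ fun p _ => by fun_prop

lemma differentiable_clearedCoef {n : ℕ} (η : ℂ) (S : Finset (Fin n)) :
    Differentiable ℂ (clearedCoef η S) := fun lam =>
  (differentiableAt_prod _ fun p _ => by fun_prop).mul
    (differentiableAt_prod _ fun i _ => differentiableAt_prod _ fun j _ => by fun_prop)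

/-- The difference equation propagates from purely imaginary points along connected open sets. -/
lemma dualHam_eq_of_imag {n : ℕ} (g : ℝ) {r : ℕ} (hr : 1 ≤ r) (e : ℂ) {W V : Set (Fin n → ℂ)}
    {F : (Fin n → ℂ) → ℂ} (hW : IsOpen W) (hF : DifferentiableOn ℂ F W) (hV : IsOpen V)
    (hVc : IsPreconnected V) (hVW : V ⊆ W) (hne : (V ∩ imagSpace n).Nonempty)
    (hshift : ∀ S : Finset (Fin n), S.card = r → ∀ lam ∈ V, shift S lam ∈ W)
    (him : ∀ lam ∈ V, lam ∈ imagSpace n → Function.Injective lam → dualHam g r F lam = e * F lam)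
    {lam : Fin n → ℂ} (hlam : lam ∈ V) (hli : Function.Injective lam) :
    dualHam g r F lam = e * F lam := by
  -- One factor `offDiagProd` clears the denominators. The second makes G vanish at imaginary points
  -- with coinciding coordinates, where no equation is available.
  set G : (Fin n → ℂ) → ℂ := fun lam => offDiagProd lam *
    (∑ S ∈ powersetCard r (univ : Finset (Fin n)),
      clearedCoef (g - 1 : ℝ) S lam * F (shift S lam) - e * (offDiagProd lam * F lam)) with hG
  have hGeq : ∀ lam : Fin n → ℂ, Function.Injective lam →
      G lam = offDiagProd lam ^ 2 * (dualHam g r F lam - e * F lam) := by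
    intro lam hli
    have h1 : ∑ S ∈ powersetCard r (univ : Finset (Fin n)),
        clearedCoef (g - 1 : ℝ) S lam * F (shift S lam) =
        offDiagProd lam * dualHam g r F lam := by
      rw [dualHam_eq g hr, Finset.mul_sum]
      refine Finset.sum_congr rfl fun S _ => ?_
      rw [← offDiagProd_mul_shiftCoef _ S hli, mul_assoc]
    rw [hG]
    simp only [h1]
    ring
  have hGd : DifferentiableOn ℂ G V := by
    intro q hq
    refine DifferentiableAt.differentiableWithinAt ?_
    refine (differentiable_offDiagProd q).mul (DifferentiableAt.sub
      (DifferentiableAt.fun_sum fun S hS => ?_) ?_)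
    · have hmem := hshift S (Finset.mem_powersetCard.1 hS).2 q hq
      refine (differentiable_clearedCoef _ S q).mul ?_
      refine (hF.differentiableAt (hW.mem_nhds hmem)).comp q (f := shift S) ?_
      refine differentiableAt_pi.2 fun i => ?_
      unfold shift
      split_ifs <;> fun_prop
    · exact (differentiableAt_const _).mul ((differentiable_offDiagProd q).mul
        (hF.differentiableAt (hW.mem_nhds (hVW hq))))
  have hG0 := eqOn_zero_of_imagSpace hV hVc hGd hne (fun q hq hqi => by
    by_cases hinj : Function.Injective q
    · rw [hGeq q hinj, him q hq hqi hinj, sub_self, mul_zero]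
    · rw [hG]
      simp only [offDiagProd_eq_zero hinj, zero_mul]) lam hlam
  rw [hGeq lam hli] at hG0
  exact sub_eq_zero.1 ((mul_eq_zero.1 hG0).resolve_left (pow_ne_zero 2 (offDiagProd_ne_zero hli)))

lemma dualHam_const_mul {n : ℕ} (g : ℝ) (r : ℕ) (a : ℂ) (F : (Fin n → ℂ) → ℂ)
    (lam : Fin n → ℂ) : dualHam g r (fun q => a * F q) lam = a * dualHam g r F lam := by
  simp only [dualHam, Finset.mul_sum]
  exact Finset.sum_congr rfl fun S _ => by ring

end Sutherland

end

/-! ### Assembly of the three claims. -/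

theorem theorem1 (n : ℕ) (hn : 1 ≤ n) (g : ℝ) (hg : 1 < g) (x : Fin n → ℝ) :
    -- the Mellin-Barnes integral converges absolutely for imaginary parameters
    (∀ lam ∈ Sutherland.imagSpace n,
      MeasureTheory.Integrable (Sutherland.integrand g lam x)) ∧
    -- the wave function continues analytically to the tube
    (∃ F : (Fin n → ℂ) → ℂ, DifferentiableOn ℂ F (Sutherland.tube n g) ∧
      ∀ lam ∈ Sutherland.imagSpace n, F lam = Sutherland.Psi g lam x) ∧
    -- any analytic continuation, to the tube or further, satisfies the difference equations
    (∀ (W : Set (Fin n → ℂ)) (F : (Fin n → ℂ) → ℂ),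
      IsOpen W → IsConnected W → Sutherland.tube n g ⊆ W →
      DifferentiableOn ℂ F W →
      (∀ lam ∈ Sutherland.imagSpace n, F lam = Sutherland.Psi g lam x) →
      ∀ r : ℕ, 1 ≤ r → r ≤ n →
      ∀ V : Set (Fin n → ℂ), IsOpen V → IsConnected V → V ⊆ W →
        (V ∩ Sutherland.imagSpace n).Nonempty →
        (∀ S : Finset (Fin n), S.card = r → ∀ lam ∈ V, Sutherland.shift S lam ∈ W) →
        ∀ lam ∈ V, Function.Injective lam →
          Sutherland.dualHam g r F lam =
            (Sutherland.eigenvalue r x : ℂ) * F lam) := by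
  have hg0 : 0 < g := by linarith
  -- The recursion reads coordinates from a sequence; the values beyond n are irrelevant.
  set X : ℕ → ℝ := fun i => if h : i < n then x ⟨i, h⟩ else 0 with hX
  have hx : x = fun i : Fin n => X i := by
    ext i; simp [hX]
  clear_value X
  subst hx
  -- The constant a collects the sinh factor and the power of i coming from dγ = i dt; neither
  -- depends on λ.
  obtain ⟨a, hint, hPsi⟩ : ∃ a : ℂ,
      (∀ lam ∈ Sutherland.imagSpace n,
        MeasureTheory.Integrable (Sutherland.integrand g lam fun i : Fin n => X i)) ∧
      ∀ lam ∈ Sutherland.imagSpace n,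
        Sutherland.Psi g lam (fun i => X i) = a * Sutherland.waveExt g X n lam := by
    obtain ⟨N, rfl⟩ : ∃ N, n = N + 1 := ⟨n - 1, by omega⟩
    obtain ⟨C, M, -, h⟩ := Sutherland.integrand_integral hg0 X N
    refine ⟨((∏ j : Fin (N + 1), ∏ k ∈ Finset.univ.filter (fun k => j < k),
      Real.sinh |X j - X k| ^ g : ℝ) : ℂ) * Complex.I ^ ((N + 1) * (N + 1 - 1) / 2),
      fun lam hl => (h lam hl).1, fun lam hl => ?_⟩
    rw [Sutherland.Psi, Sutherland.Phi, Sutherland.waveExt_of_imag hg0 X hl, ← (h lam hl).2.1,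
      ← mul_assoc]
    rfl
  have hdiff : DifferentiableOn ℂ (fun lam => a * Sutherland.waveExt g X n lam)
      (Sutherland.tube n g) :=
    (Sutherland.differentiableOn_waveExt hg0 X hn).const_mul a
  refine ⟨hint, ⟨_, hdiff, fun lam hl => (hPsi lam hl).symm⟩, ?_⟩
  intro W F hW _ hTW hF hFPsi r hr _ V hV hVc hVW hne hshift lam hlam hli
  have hsub := Sutherland.imagSpace_subset_tube (n := n) hg0
  -- Uniqueness identifies any continuation with the explicit one on the tube. This suffices for the
  -- equations at imaginary points, whose shifts stay in the tube.
  have hFeq : ∀ q ∈ Sutherland.tube n g, F q = a * Sutherland.waveExt g X n q := by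
    intro q hq
    refine sub_eq_zero.1 (Sutherland.eqOn_zero_of_imagSpace (Sutherland.isOpen_tube n g)
      (Sutherland.isPreconnected_tube n g) ((hF.mono hTW).sub hdiff) ?_ (fun p _ hpi => ?_) q hq)
    · obtain ⟨p, -, hp⟩ := hne
      exact ⟨p, hsub hp, hp⟩
    · rw [Pi.sub_apply, hFPsi p hpi, hPsi p hpi, sub_self]
  refine Sutherland.dualHam_eq_of_imag g hr _ hW hF hV hVc.isPreconnected hVW hne hshift
    (fun q _ hqi hqinj => ?_) hlam hli
  have h1 : Sutherland.dualHam g r F q =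
      Sutherland.dualHam g r (fun p => a * Sutherland.waveExt g X n p) q := by
    simp only [Sutherland.dualHam]
    congr 1
    refine Finset.sum_congr rfl fun S _ => ?_
    rw [hFeq _ (Sutherland.shift_mem_tube hg hqi S)]
  rw [h1, Sutherland.dualHam_const_mul, Sutherland.dualHam_waveExt hg X hr hqi hqinj,
    hFeq q (hsub hqi)]
  ring
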